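/- Let $(\Omega,\mathcal F,P)$ be a probability space, $T:\Omega\to\Omega$ a bijective bimeasurable transformation preserving $P$, and $\mathcal F_0\subseteq\mathcal F$ a sub-$\sigma$-algebra with $\mathcal F_0\subseteq T^{-1}(\mathcal F_0)$; put $\mathcal F_k=T^{-k}(\mathcal F_0)$ and $\mathbb E_k(\cdot)=\mathbb E(\cdot\mid\mathcal F_k)$. Let $X_0$ be an $\mathcal F_0$-measurable, square-integrable random variable with $\mathbb E(X_0)=0$, and put $X_k=X_0\circ T^k$, $S_n=\sum_{i=0}^{n-1}X_i$. For $m\ge1$ let $$Y_0^m=\frac1m\,\mathbb E_0(X_1+\cdots+X_m),\qquad Y_k^m=Y_0^m\circ T^k,\qquad \|Y_0^m\|_+=\limsup_{n\to\infty}\frac1{\sqrt n}\Bigl\|\sum_{j=1}^nY_j^m\Bigr\|_2\in[0,\infty].$$ By a stationary martingale we mean a martingale $(M_n)_{n\ge0}$ with respect to $(\mathcal F_n)_{n\ge0}$ of the form $M_n=\sum_{i=0}^{n-1}D_0\circ T^i$ with $D_0\in L^2(P)$. Then: (i) $\|Y_0^m\|_+\to0$ as $m\to\infty$ if and only if there exists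 a stationary martingale $(M_n)$ with $\mathbb E\bigl((S_n-M_n)^2\bigr)/n\to0$ as $n\to\infty$. (ii) Such a martingale is unique (up to almost sure equality) if it exists. (iii) If $\|Y_0^m\|_+\to0$ as $m\to\infty$, then the conditional central limit theorem holds: there is an integrable $T$-invariant function $\eta\ge0$ with $\bigl\|\mathbb E_0(S_n^2)/n-\eta\bigr\|_1\to0$ such that, for every continuous $f:\mathbb R\to\mathbb R$ for which $|f(x)|/(1+x^2)$ is bounded and every integer $k\ge0$, $$\Bigl\|\mathbb E_k\bigl(f(S_n/\sqrt n)\bigr)-\int_{-\infty}^{\infty}f(x\sqrt\eta)\,g(x)\,dx\Bigr\|_1\longrightarrow0\qquad(n\to\infty),$$ where $g$ is the standard normal density. -/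

import Mathlib

open MeasureTheory ProbabilityTheory Filter Topology
open scoped ENNReal

noncomputable section

namespace StationaryCLT

variable {Ω : Type*}

/-- The non-decreasing filtration `ℱ_k = T^{-k}(F₀)`, where `T` is a bijective bimeasurable map and
`F₀ ⊆ T^{-1}(F₀)`. Only non-negative indices `k` are needed. -/
def shiftFiltration {F₀ mΩ : MeasurableSpace Ω} (T : Ω ≃ᵐ Ω) (hF₀ : F₀ ≤ mΩ)
    (hT : F₀ ≤ F₀.comap T) : Filtration ℕ mΩ where
  seq k := F₀.comap (T^[k])
  mono' := by
    refine monotone_nat_of_le_succ fun k => ?_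
    change F₀.comap (T^[k]) ≤ F₀.comap (T^[k + 1])
    rw [Function.iterate_succ', ← MeasurableSpace.comap_comp]
    exact MeasurableSpace.comap_mono hT
  le' k := by
    have h : @Measurable Ω Ω mΩ mΩ (T^[k]) := T.measurable.iterate k
    exact (MeasurableSpace.comap_mono hF₀).trans h.comap_le

/-- `∑_{i=0}^{n-1} Z ∘ T^i`. With `Z = X₀` this is the partial sum `S_n = X_0 + ⋯ + X_{n-1}` of the
stationary sequence `X_i = X₀ ∘ T^i`. -/
def partialSum (T : Ω → Ω) (Z : Ω → ℝ) (n : ℕ) : Ω → ℝ :=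
  fun ω => ∑ i ∈ Finset.range n, Z (T^[i] ω)

/-- `Y_0^m = (1/m) 𝔼(X_1 + ⋯ + X_m | ℱ_0)`, where `X_i = X₀ ∘ T^i`. -/
def averagedProjection {mΩ : MeasurableSpace Ω} (μ : Measure Ω) (T : Ω → Ω) (ℱ : Filtration ℕ mΩ)
    (X₀ : Ω → ℝ) (m : ℕ) : Ω → ℝ :=
  fun ω => (1 / (m : ℝ)) * (μ[fun ω' => ∑ i ∈ Finset.Icc 1 m, X₀ (T^[i] ω') | ℱ 0]) ω

/-- `‖Z‖₊ = limsup_n n^{-1/2} ‖∑_{j=1}^n Z ∘ T^j‖₂`, with values in `[0, ∞]`. -/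
def plusSeminorm {mΩ : MeasurableSpace Ω} (μ : Measure Ω) (T : Ω → Ω) (Z : Ω → ℝ) : ℝ≥0∞ :=
  limsup (fun n : ℕ => ENNReal.ofReal (1 / √(n : ℝ)) *
    eLpNorm (fun ω => ∑ j ∈ Finset.Icc 1 n, Z (T^[j] ω)) 2 μ) atTop

/-- `M` is a square-integrable martingale for `ℱ`, `M_n = ∑_{i=0}^{n-1} D_i` almost surely, with
stationary differences `D_i = D₀ ∘ T^i`. -/
structure IsStationaryMartingale {mΩ : MeasurableSpace Ω} (μ : Measure Ω) (T : Ω → Ω)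
    (ℱ : Filtration ℕ mΩ) (M : ℕ → Ω → ℝ) : Prop where
  martingale : Martingale M ℱ μ
  stationary : ∃ D₀ : Ω → ℝ, MemLp D₀ 2 μ ∧ ∀ n, M n =ᵐ[μ] partialSum T D₀ n

/-- `𝔼((S_n - M_n)²) / n → 0`. -/
def MartingaleApprox {mΩ : MeasurableSpace Ω} (μ : Measure Ω) (S M : ℕ → Ω → ℝ) : Prop :=
  Tendsto (fun n : ℕ => (∫ ω, (S n ω - M n ω) ^ 2 ∂μ) / (n : ℝ)) atTop (𝓝 0)

/-- The conditional central limit theorem for `S_n`: the sequence `𝔼(S_n² | ℱ_0) / n` has an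
`L¹` limit `η ≥ 0` that is `T`-invariant, and for every continuous `f` of at most quadratic growth
and every `k ≥ 0`, `‖𝔼(f(S_n / √n) | ℱ_k) - ∫ f(x √η) g(x) dx‖₁ → 0`, where `g` is the standard
normal density. -/
def ConditionalCLT {mΩ : MeasurableSpace Ω} (μ : Measure Ω) (T : Ω → Ω) (ℱ : Filtration ℕ mΩ)
    (S : ℕ → Ω → ℝ) : Prop :=
  ∃ η : Ω → ℝ, Measurable η ∧ (∀ ω, 0 ≤ η ω) ∧ (∀ ω, η (T ω) = η ω) ∧ Integrable η μ ∧
    Tendsto (fun n : ℕ =>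
      eLpNorm (fun ω => (μ[fun ω' => (S n ω') ^ 2 | ℱ 0]) ω / (n : ℝ) - η ω) 1 μ) atTop (𝓝 0) ∧
    ∀ f : ℝ → ℝ, Continuous f → (∃ C : ℝ, ∀ x, |f x| / (1 + x ^ 2) ≤ C) → ∀ k : ℕ,
      Tendsto (fun n : ℕ =>
        eLpNorm (fun ω => (μ[fun ω' => f (S n ω' / √(n : ℝ)) | ℱ k]) ω
          - ∫ x, f (x * √(η ω)) ∂(gaussianReal 0 1)) 1 μ) atTop (𝓝 0)

end StationaryCLT

end

/-! Existence and uniqueness of the martingale are Hilbert space geometry. On `L²`, composition with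
`T` is an isometry `U` and the conditional expectations are projections `P k` with `U P_k = P_{k+1}
U`. Averaging the predictions of the first `m` partial sums gives `θ = (1/m) ∑_{i=1}^m P_0 S_i`,
which solves the approximate Poisson equation `θ - P_0 U θ = x - Y^m`. Hence `x = Y^m + D^m + (θ - U
θ)`, where `D^m = U θ - P_0 U θ` is a martingale difference. The coboundary `θ - U θ` has
plus-seminorm zero, so `‖x - D^m‖₊ = ‖Y^m‖₊` (`orbitSeminorm_sub_meanInnovation`).

On martingale differences the plus-seminorm is the Hilbert norm (`orbitSeminorm_of_difference`). If
`‖Y^m‖₊ → 0`, then `D^m` is therefore Cauchy, and its limit generates the approximating martingale;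
uniqueness follows in the same way. Conversely, if `d` generates an approximating martingale,
decomposing `S_n - M_n` orthogonally into its innovations (`sum_norm_sq_innovation`) shows `D^m → d`
in norm, and so `‖Y^m‖₊ = ‖x - D^m‖₊ → 0`.

For the limit theorem, `S_n` may be replaced by `M_n`, because `(S_n - M_n)/√n → 0` in `L²`. The
variance `η` is the `L¹` ergodic limit of the averages of `D²`; it is invariant and `ℱ_0`-measurable
up to null sets. Cosines are handled by telescoping `exp(-(n-j) t²η/(2n)) cos(t M_j/√n + φ)` in `j`
(`abs_cos_telescope_le`). The first order terms form a martingale transform, whose conditional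
expectation is negligible. The second order terms contain `D_j² - η`, a bounded coboundary up to a
small `L¹` error (`exists_bounded_coboundary`), which is removed by summation by parts. Third order
terms vanish by dominated convergence.

Second moments converge by expanding `M_n²`. Cosines yield trigonometric polynomials, these
approximate compactly supported functions with an error controlled by a small multiple of `x²`, and
truncation then reaches all continuous functions of quadratic growth
(`HasConditionalLimit.of_isQuadraticallyBounded`). -/

noncomputable section

namespace StationaryCLT

/-! ### Martingale approximation for an isometry with a shifted family of projections. -/

section Hilbert

variable {H : Type*} [NormedAddCommGroup H] [InnerProductSpace ℝ H]

lemma ennreal_limsup_add_le {u v : ℕ → ℝ≥0∞} :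
    limsup (fun n => u n + v n) atTop ≤ limsup u atTop + limsup v atTop := by
  refine ENNReal.le_of_forall_pos_le_add fun ε hε hlt => ?_
  have hu : limsup u atTop ≠ ⊤ := fun h => by simp [h] at hlt
  have hv : limsup v atTop ≠ ⊤ := fun h => by simp [h] at hlt
  have hε' : ((ε : ℝ≥0∞) / 2) ≠ 0 := (ENNReal.half_pos (by exact_mod_cast hε.ne')).ne'
  have h1 := eventually_lt_of_limsup_lt (ENNReal.lt_add_right hu hε')
  have h2 := eventually_lt_of_limsup_lt (ENNReal.lt_add_right hv hε')
  refine limsup_le_of_le (by isBoundedDefault) ?_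
  filter_upwards [h1, h2] with n hn1 hn2
  calc u n + v n ≤ (limsup u atTop + ε / 2) + (limsup v atTop + ε / 2) := add_le_add hn1.le hn2.le
    _ = limsup u atTop + limsup v atTop + (ε / 2 + ε / 2) := by ring
    _ = _ := by rw [ENNReal.add_halves]

/-- An isometry `U` of a Hilbert space together with an increasing sequence of orthogonal
projections `P k` that it shifts. -/
structure IsShiftSystem (U : H →L[ℝ] H) (P : ℕ → H →L[ℝ] H) : Prop where
  norm_map : ∀ x, ‖U x‖ = ‖x‖
  proj_proj_of_le : ∀ {j k}, j ≤ k → ∀ x, P j (P k x) = P j x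
  proj_proj_of_ge : ∀ {j k}, j ≤ k → ∀ x, P k (P j x) = P j x
  symm : ∀ k x y, inner ℝ (P k x) y = inner ℝ x (P k y)
  map_proj : ∀ k x, U (P k x) = P (k + 1) (U x)

/-- The operator `1 + U + ⋯ + U^(n-1)`. -/
def orbitSum (U : H →L[ℝ] H) (n : ℕ) : H →L[ℝ] H := ∑ i ∈ Finset.range n, U ^ i

/-- `limsup_n n^{-1/2} ‖x + U x + ⋯ + U^(n-1) x‖`. -/
def orbitSeminorm (U : H →L[ℝ] H) (x : H) : ℝ≥0∞ :=
  limsup (fun n : ℕ => ENNReal.ofReal (‖orbitSum U n x‖ / √n)) atTop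

variable {U : H →L[ℝ] H} {P : ℕ → H →L[ℝ] H}

lemma orbitSum_zero : orbitSum U 0 = 0 := by simp [orbitSum]

lemma orbitSum_succ (n : ℕ) (x : H) :
    orbitSum U (n + 1) x = orbitSum U n x + (U ^ n) x := by
  simp [orbitSum, Finset.sum_range_succ]

lemma orbitSum_succ' (n : ℕ) (x : H) :
    orbitSum U (n + 1) x = x + U (orbitSum U n x) := by
  induction n with
  | zero => simp [orbitSum]
  | succ n ih =>
    rw [orbitSum_succ, ih, pow_succ', mul_apply_eq_comp, add_assoc, ← map_add, ← orbitSum_succ, ih]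

lemma orbitSum_sub_map (n : ℕ) (x : H) :
    orbitSum U n x - U (orbitSum U n x) = x - (U ^ n) x := by
  have h1 := orbitSum_succ (U := U) n x
  have h2 := orbitSum_succ' (U := U) n x
  rw [h1] at h2
  rw [sub_eq_sub_iff_add_eq_add, h2]

lemma orbitSum_map (n : ℕ) (x : H) : orbitSum U n (U x) = U (orbitSum U n x) := by
  induction n with
  | zero => simp [orbitSum]
  | succ n ih =>
    rw [orbitSum_succ, ih, orbitSum_succ, map_add]
    congr 1
    rw [← mul_apply_eq_comp, ← mul_apply_eq_comp, ← pow_succ, ← pow_succ']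

lemma orbitSeminorm_add_le (x y : H) :
    orbitSeminorm U (x + y) ≤ orbitSeminorm U x + orbitSeminorm U y := by
  refine le_trans (limsup_le_limsup (Eventually.of_forall fun n => ?_)) ennreal_limsup_add_le
  rw [← ENNReal.ofReal_add (by positivity) (by positivity), ← add_div]
  simp only [map_add]
  gcongr
  exact norm_add_le _ _

lemma orbitSeminorm_neg (x : H) : orbitSeminorm U (-x) = orbitSeminorm U x := by
  simp [orbitSeminorm]

lemma orbitSeminorm_eq_zero_iff (x : H) :
    orbitSeminorm U x = 0 ↔ Tendsto (fun n : ℕ => ‖orbitSum U n x‖ ^ 2 / n) atTop (𝓝 0) := by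
  have hsq : ∀ n : ℕ, ‖orbitSum U n x‖ ^ 2 / n = (‖orbitSum U n x‖ / √n) ^ 2 := fun n => by
    rw [div_pow, Real.sq_sqrt n.cast_nonneg]
  simp_rw [hsq]
  constructor
  · intro h
    have h1 : Tendsto (fun n : ℕ => ENNReal.ofReal (‖orbitSum U n x‖ / √n)) atTop (𝓝 0) :=
      tendsto_of_le_liminf_of_limsup_le zero_le (le_of_eq h)
    have h2 := (ENNReal.tendsto_toReal ENNReal.zero_ne_top).comp h1
    have h3 : Tendsto (fun n : ℕ => ‖orbitSum U n x‖ / √n) atTop (𝓝 0) := by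
      refine h2.congr fun n => ?_
      simp only [Function.comp]
      rw [ENNReal.toReal_ofReal (by positivity)]
    simpa using h3.pow 2
  · intro h
    have h3 : Tendsto (fun n : ℕ => ‖orbitSum U n x‖ / √n) atTop (𝓝 0) := by
      have := h.sqrt
      simp only [Real.sqrt_zero] at this
      refine this.congr fun n => Real.sqrt_sq (by positivity)
    have := ENNReal.tendsto_ofReal h3
    rw [ENNReal.ofReal_zero] at this
    exact this.limsup_eq

namespace IsShiftSystem

lemma norm_pow_map (h : IsShiftSystem U P) (n : ℕ) (x : H) : ‖(U ^ n) x‖ = ‖x‖ := by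
  induction n with
  | zero => simp
  | succ n ih => rw [pow_succ', mul_apply_eq_comp, h.norm_map, ih]

lemma pow_map_proj (h : IsShiftSystem U P) (n k : ℕ) (x : H) :
    (U ^ n) (P k x) = P (k + n) ((U ^ n) x) := by
  induction n with
  | zero => simp
  | succ n ih =>
    rw [pow_succ', mul_apply_eq_comp, ih, h.map_proj, mul_apply_eq_comp]
    rfl

lemma inner_eq_zero (h : IsShiftSystem U P) {k : ℕ} {x y : H} (hx : P k x = x) (hy : P k y = 0) :
    inner ℝ x y = 0 := by
  rw [← hx, h.symm, hy, inner_zero_right]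

lemma norm_proj_le (h : IsShiftSystem U P) (k : ℕ) (x : H) : ‖x - P k x‖ ≤ ‖x‖ := by
  have h1 : inner ℝ (P k x) (x - P k x) = 0 :=
    h.inner_eq_zero (h.proj_proj_of_le le_rfl x) (by rw [map_sub, h.proj_proj_of_le le_rfl, sub_self])
  have h2 := norm_add_sq_eq_norm_sq_add_norm_sq_real h1
  rw [add_sub_cancel] at h2
  nlinarith [norm_nonneg x, norm_nonneg (x - P k x), norm_nonneg (P k x)]

/-- The orbit sum telescopes to `x - U^n x`, of norm at most `2‖x‖` uniformly in `n`. -/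
lemma orbitSeminorm_coboundary (h : IsShiftSystem U P) (x : H) :
    orbitSeminorm U (x - U x) = 0 := by
  rw [orbitSeminorm_eq_zero_iff]
  have h1 : Tendsto (fun n : ℕ => (2 * ‖x‖) ^ 2 / (n : ℝ)) atTop (𝓝 0) :=
    tendsto_const_div_atTop_nhds_zero_nat _
  refine squeeze_zero (fun n => by positivity) (fun n => ?_) h1
  gcongr
  rw [map_sub, orbitSum_map, orbitSum_sub_map]
  calc _ ≤ ‖x‖ + ‖(U ^ n) x‖ := norm_sub_le _ _
    _ = _ := by rw [h.norm_pow_map]; ring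

lemma proj_orbitSum (h : IsShiftSystem U P) {d : H} (h1 : P 1 d = d) (n : ℕ) :
    P n (orbitSum U n d) = orbitSum U n d := by
  induction n with
  | zero => simp [orbitSum]
  | succ n ih =>
    rw [orbitSum_succ, map_add, add_comm n 1, ← h.pow_map_proj, h1]
    congr 1
    conv_lhs => rw [← ih, h.proj_proj_of_ge (by omega)]
    exact ih

lemma norm_sq_orbitSum (h : IsShiftSystem U P) {d : H} (h1 : P 1 d = d) (h0 : P 0 d = 0) (n : ℕ) :
    ‖orbitSum U n d‖ ^ 2 = n * ‖d‖ ^ 2 := by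
  induction n with
  | zero => simp [orbitSum]
  | succ n ih =>
    have h2 : inner ℝ (orbitSum U n d) ((U ^ n) d) = 0 := by
      refine h.inner_eq_zero (h.proj_orbitSum h1 n) ?_
      have := h.pow_map_proj n 0 d
      rw [h0, map_zero, zero_add] at this
      exact this.symm
    have h3 := norm_add_sq_eq_norm_sq_add_norm_sq_real h2
    rw [orbitSum_succ, sq, h3, ← sq, ih, h.norm_pow_map]
    push_cast
    ring

/-- The translates of `d` are orthogonal, so the normalised norms are constant from `n = 1` on. This
is what turns smallness in the seminorm into norm convergence, and it also forces uniqueness. -/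
lemma orbitSeminorm_of_difference (h : IsShiftSystem U P) {d : H} (h1 : P 1 d = d)
    (h0 : P 0 d = 0) : orbitSeminorm U d = ‖d‖ₑ := by
  refine Tendsto.limsup_eq (tendsto_const_nhds.congr' ?_)
  filter_upwards [eventually_gt_atTop 0] with n hn
  have h2 : ‖orbitSum U n d‖ = √n * ‖d‖ := by
    rw [← Real.sqrt_sq (norm_nonneg (orbitSum U n d)), h.norm_sq_orbitSum h1 h0,
      Real.sqrt_mul n.cast_nonneg, Real.sqrt_sq (norm_nonneg _)]
  rw [h2, mul_div_cancel_left₀ _ (by positivity), ofReal_norm]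

lemma proj_zero_orbitSum (h : IsShiftSystem U P) {d : H} (h0 : P 0 d = 0) (n : ℕ) :
    P 0 (orbitSum U n d) = 0 := by
  induction n with
  | zero => simp [orbitSum]
  | succ n ih =>
    rw [orbitSum_succ, map_add, ih, zero_add, ← h.proj_proj_of_le (Nat.zero_le n)]
    have := h.pow_map_proj n 0 d
    rw [h0, map_zero, zero_add] at this
    rw [← this, map_zero]

/-- The innovation at time `1` of the translated partial sum. -/
def innovation (U : H →L[ℝ] H) (P : ℕ → H →L[ℝ] H) (x : H) : H := P 1 (U x) - P 0 (U x)

/-- This is Pythagoras for the part of `S_n - M_n` orthogonal to the range of `P 0`: each additional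
step splits off one innovation, and the remainder is the image under `U` of the previous vector. -/
lemma sum_norm_sq_innovation (h : IsShiftSystem U P) {x d : H} (hx : P 0 x = x) (h1 : P 1 d = d)
    (h0 : P 0 d = 0) (n : ℕ) :
    ∑ j ∈ Finset.range n, ‖innovation U P (orbitSum U j x) - d‖ ^ 2 =
      ‖(orbitSum U n x - orbitSum U n d) - P 0 (orbitSum U n x - orbitSum U n d)‖ ^ 2 := by
  induction n with
  | zero => simp [orbitSum]
  | succ n ih =>
    set z := orbitSum U n x - orbitSum U n d with hz
    have hz' : orbitSum U (n + 1) x - orbitSum U (n + 1) d = x - d + U z := by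
      rw [orbitSum_succ', orbitSum_succ', hz, map_sub]; abel
    have hx1 : P 1 x = x := by rw [← hx, h.proj_proj_of_ge zero_le_one]
    have hUd : P 1 (U (orbitSum U n d)) = 0 := by
      rw [← h.map_proj, h.proj_zero_orbitSum h0, map_zero]
    have hUd0 : P 0 (U (orbitSum U n d)) = 0 := by
      rw [← h.proj_proj_of_le zero_le_one, hUd, map_zero]
    set w := x - d + U z with hw
    have e1 : P 1 w - P 0 w = innovation U P (orbitSum U n x) - d := by
      simp only [hw, hz, map_add, map_sub, hx1, hx, h1, h0, hUd, hUd0, innovation]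
      abel
    have e2 : w - P 1 w = U (z - P 0 z) := by
      rw [map_sub, h.map_proj, hw, map_add, map_sub (P 1), hx1, h1, zero_add]
      abel
    -- The innovation at time 1 lies in the range of `P 1`, the later part in its kernel.
    have e3 : inner ℝ (P 1 w - P 0 w) (w - P 1 w) = 0 := by
      refine h.inner_eq_zero (k := 1) ?_ ?_
      · rw [map_sub, h.proj_proj_of_le le_rfl, h.proj_proj_of_ge zero_le_one]
      · rw [map_sub, h.proj_proj_of_le le_rfl, sub_self]
    have e4 := norm_add_sq_eq_norm_sq_add_norm_sq_real e3
    rw [Finset.sum_range_succ, ih, hz', ← e1]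
    have e5 : w - P 0 w = (P 1 w - P 0 w) + (w - P 1 w) := by abel
    rw [e5, sq ‖P 1 w - P 0 w + (w - P 1 w)‖, e4, e2, h.norm_map]
    ring

/-- The averaged innovations of the partial sums. -/
def meanInnovation (U : H →L[ℝ] H) (P : ℕ → H →L[ℝ] H) (x : H) (m : ℕ) : H :=
  (1 / (m : ℝ)) • ∑ i ∈ Finset.range m, innovation U P (orbitSum U (i + 1) x)

lemma proj_one_innovation (h : IsShiftSystem U P) (x : H) :
    P 1 (innovation U P x) = innovation U P x := by
  rw [innovation, map_sub, h.proj_proj_of_le le_rfl, h.proj_proj_of_ge zero_le_one]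

lemma proj_zero_innovation (h : IsShiftSystem U P) (x : H) :
    P 0 (innovation U P x) = 0 := by
  rw [innovation, map_sub, h.proj_proj_of_le le_rfl, h.proj_proj_of_le zero_le_one, sub_self]

lemma proj_one_meanInnovation (h : IsShiftSystem U P) (x : H) (m : ℕ) :
    P 1 (meanInnovation U P x m) = meanInnovation U P x m := by
  simp only [meanInnovation, map_smul, map_sum, h.proj_one_innovation]

lemma proj_zero_meanInnovation (h : IsShiftSystem U P) (x : H) (m : ℕ) :
    P 0 (meanInnovation U P x m) = 0 := by
  simp only [meanInnovation, map_smul, map_sum, h.proj_zero_innovation, Finset.sum_const_zero,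
    smul_zero]

/-- By Cauchy–Schwarz, the average of the innovations is as close to `d` as their mean square
distance, which `sum_norm_sq_innovation` bounds by the approximation error at time `m + 1`. The
factor 2 absorbs the passage from `1/m` to `1/(m+1)`. -/
lemma norm_sq_meanInnovation_sub_le (h : IsShiftSystem U P) {x d : H} (hx : P 0 x = x)
    (h1 : P 1 d = d) (h0 : P 0 d = 0) {m : ℕ} (hm : 0 < m) :
    ‖meanInnovation U P x m - d‖ ^ 2 ≤
      2 * (‖orbitSum U (m + 1) x - orbitSum U (m + 1) d‖ ^ 2 / ((m + 1 : ℕ) : ℝ)) := by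
  have hm' : (0 : ℝ) < m := by exact_mod_cast hm
  have hm1 : (1 : ℝ) ≤ m := by exact_mod_cast hm
  have e1 : meanInnovation U P x m - d =
      (1 / (m : ℝ)) • ∑ i ∈ Finset.range m, (innovation U P (orbitSum U (i + 1) x) - d) := by
    rw [Finset.sum_sub_distrib, smul_sub, meanInnovation, Finset.sum_const, Finset.card_range,
      ← Nat.cast_smul_eq_nsmul ℝ, smul_smul, one_div, inv_mul_cancel₀ hm'.ne', one_smul]
  have e2 : ‖∑ i ∈ Finset.range m, (innovation U P (orbitSum U (i + 1) x) - d)‖ ^ 2 ≤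
      m * ∑ i ∈ Finset.range m, ‖innovation U P (orbitSum U (i + 1) x) - d‖ ^ 2 := by
    calc _ ≤ (∑ i ∈ Finset.range m, ‖innovation U P (orbitSum U (i + 1) x) - d‖) ^ 2 := by
          gcongr; exact norm_sum_le _ _
      _ ≤ _ := by simpa using sq_sum_le_card_mul_sum_sq (s := Finset.range m)
                    (f := fun i => ‖innovation U P (orbitSum U (i + 1) x) - d‖)
  have e3 : ∑ i ∈ Finset.range m, ‖innovation U P (orbitSum U (i + 1) x) - d‖ ^ 2 ≤
      ‖orbitSum U (m + 1) x - orbitSum U (m + 1) d‖ ^ 2 := by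
    calc _ ≤ ∑ i ∈ Finset.range (m + 1), ‖innovation U P (orbitSum U i x) - d‖ ^ 2 := by
          rw [Finset.sum_range_succ']; simp
      _ ≤ _ := by
          rw [h.sum_norm_sq_innovation hx h1 h0]
          gcongr
          exact h.norm_proj_le _ _
  rw [e1, norm_smul, mul_pow, Real.norm_of_nonneg (by positivity)]
  set B := ‖orbitSum U (m + 1) x - orbitSum U (m + 1) d‖ ^ 2
  have hB : 0 ≤ B := by positivity
  calc _ ≤ (1 / (m : ℝ)) ^ 2 * (m * B) := by gcongr; exact e2.trans (by gcongr)
    _ = B / m := by field_simp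
    _ ≤ 2 * (B / ((m + 1 : ℕ) : ℝ)) := by
      rw [← mul_div_assoc, div_le_div_iff₀ hm' (by positivity)]
      push_cast
      nlinarith

/-- The average over `1 ≤ i ≤ m` of the predictions at time `0` of `U^i x`. -/
def meanPrediction (U : H →L[ℝ] H) (P : ℕ → H →L[ℝ] H) (x : H) (m : ℕ) : H :=
  (1 / (m : ℝ)) • P 0 (∑ i ∈ Finset.Icc 1 m, (U ^ i) x)

/-- The two vectors differ by the coboundary `θ - U θ`, which the seminorm does not see. -/
lemma orbitSeminorm_sub_meanInnovation (h : IsShiftSystem U P) {x : H} (hx : P 0 x = x) {m : ℕ}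
    (hm : 0 < m) :
    orbitSeminorm U (x - meanInnovation U P x m) ≤ orbitSeminorm U (meanPrediction U P x m) ∧
    orbitSeminorm U (meanPrediction U P x m) ≤ orbitSeminorm U (x - meanInnovation U P x m) := by
  have hm' : (m : ℝ) ≠ 0 := by exact_mod_cast hm.ne'
  set θ := (1 / (m : ℝ)) • ∑ i ∈ Finset.range m, P 0 (orbitSum U (i + 1) x) with hθ
  have e1 : meanInnovation U P x m = U θ - P 0 (U θ) := by
    simp only [meanInnovation, hθ, map_smul, map_sum, innovation, h.map_proj,
      h.proj_proj_of_le zero_le_one, zero_add, Finset.sum_sub_distrib, smul_sub]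
  -- The approximate Poisson equation: `S_i - U S_i` telescopes to `x - U^i x` before projecting and
  -- averaging.
  have e2 : θ - P 0 (U θ) = x - meanPrediction U P x m := by
    have e3 : ∀ i, P 0 (orbitSum U (i + 1) x) - P 0 (U (orbitSum U (i + 1) x)) =
        x - P 0 ((U ^ (i + 1)) x) := fun i => by
      rw [← map_sub, orbitSum_sub_map, map_sub, hx]
    simp only [hθ, map_smul, map_sum, h.map_proj, h.proj_proj_of_le zero_le_one, zero_add,
      meanPrediction]
    rw [← smul_sub, ← Finset.sum_sub_distrib, Finset.sum_congr rfl fun i _ => e3 i,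
      Finset.sum_sub_distrib, smul_sub, Finset.sum_const, Finset.card_range,
      ← Nat.cast_smul_eq_nsmul ℝ, smul_smul, one_div, inv_mul_cancel₀ hm', one_smul]
    congr 2
    rw [Finset.range_eq_Ico, Finset.sum_Ico_add' (fun i => P 0 ((U ^ i) x)) 0 m 1]
    rfl
  have e4 : x - meanInnovation U P x m = meanPrediction U P x m + (θ - U θ) := by
    rw [e1]
    have : x = meanPrediction U P x m + (θ - P 0 (U θ)) := by rw [e2]; abel
    nth_rw 1 [this]
    abel
  have e5 : meanPrediction U P x m = (x - meanInnovation U P x m) + -(θ - U θ) := by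
    rw [e4]; abel
  constructor
  · rw [e4]
    refine (orbitSeminorm_add_le _ _).trans ?_
    rw [h.orbitSeminorm_coboundary, add_zero]
  · rw [e5]
    refine (orbitSeminorm_add_le _ _).trans ?_
    rw [orbitSeminorm_neg, h.orbitSeminorm_coboundary, add_zero]

/-- Martingale approximation in a Hilbert space. -/
theorem tendsto_meanPrediction_iff [CompleteSpace H] (h : IsShiftSystem U P) {x : H}
    (hx : P 0 x = x) :
    Tendsto (fun m => orbitSeminorm U (meanPrediction U P x m)) atTop (𝓝 0) ↔
      ∃ d, P 1 d = d ∧ P 0 d = 0 ∧ orbitSeminorm U (x - d) = 0 := by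
  set D := meanInnovation U P x with hD
  have hD1 := h.proj_one_meanInnovation x
  have hD0 := h.proj_zero_meanInnovation x
  constructor
  · intro hY
    -- The shift to `m + 1` excludes the degenerate average at `m = 0`.
    have hcauchy : CauchySeq fun m => D (m + 1) := by
      rw [EMetric.cauchySeq_iff]
      intro ε hε
      have := (hY.eventually (gt_mem_nhds (ENNReal.half_pos hε.ne'))).and (eventually_gt_atTop 0)
      obtain ⟨N, hN⟩ := eventually_atTop.1 this
      refine ⟨N, fun m hm n hn => ?_⟩
      obtain ⟨hm1, hm2⟩ := hN (m + 1) (by omega)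
      obtain ⟨hn1, hn2⟩ := hN (n + 1) (by omega)
      have e : D (m + 1) - D (n + 1) = (x - D (n + 1)) + -(x - D (m + 1)) := by abel
      calc edist (D (m + 1)) (D (n + 1)) = orbitSeminorm U (D (m + 1) - D (n + 1)) := by
            rw [h.orbitSeminorm_of_difference, edist_eq_enorm_sub]
            · rw [map_sub, hD1, hD1]
            · rw [map_sub, hD0, hD0, sub_zero]
        _ ≤ orbitSeminorm U (x - D (n + 1)) + orbitSeminorm U (x - D (m + 1)) := by
            rw [e]; refine (orbitSeminorm_add_le _ _).trans ?_; rw [orbitSeminorm_neg]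
        _ ≤ _ := add_le_add (h.orbitSeminorm_sub_meanInnovation hx hn2).1
            (h.orbitSeminorm_sub_meanInnovation hx hm2).1
        _ < ε / 2 + ε / 2 := ENNReal.add_lt_add hn1 hm1
        _ = ε := ENNReal.add_halves ε
    obtain ⟨d, hd⟩ := cauchySeq_tendsto_of_complete hcauchy
    have hd1 : P 1 d = d := by
      refine tendsto_nhds_unique (((P 1).continuous.tendsto d).comp hd) ?_
      simpa only [Function.comp_def, hD, hD1] using hd
    have hd0 : P 0 d = 0 := by
      refine tendsto_nhds_unique (((P 0).continuous.tendsto d).comp hd) ?_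
      simpa only [Function.comp_def, hD, hD0] using tendsto_const_nhds
    refine ⟨d, hd1, hd0, ?_⟩
    have hlim : Tendsto (fun m => orbitSeminorm U (meanPrediction U P x (m + 1)) +
        edist (D (m + 1)) d) atTop (𝓝 0) := by
      have := ((tendsto_add_atTop_iff_nat 1).2 hY).add (tendsto_iff_edist_tendsto_0.1 hd)
      simpa using this
    refine le_antisymm (ge_of_tendsto' hlim fun m => ?_) zero_le
    have e : x - d = (x - D (m + 1)) + (D (m + 1) - d) := by abel
    rw [e]
    refine (orbitSeminorm_add_le _ _).trans (add_le_add
      (h.orbitSeminorm_sub_meanInnovation hx m.succ_pos).1 (le_of_eq ?_))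
    rw [h.orbitSeminorm_of_difference, edist_eq_enorm_sub]
    · rw [map_sub, hD1, hd1]
    · rw [map_sub, hD0, hd0, sub_zero]
  · rintro ⟨d, hd1, hd0, hd⟩
    -- The averaged innovations recover any given approximating difference in norm; the triangle
    -- inequality for the seminorm then finishes.
    have hDd : Tendsto (fun m => ‖D m - d‖ ^ 2) atTop (𝓝 0) := by
      have h2 := (orbitSeminorm_eq_zero_iff _).1 hd
      have h3 := ((tendsto_add_atTop_iff_nat 1).2 h2).const_mul 2
      rw [mul_zero] at h3
      refine squeeze_zero' (Eventually.of_forall fun m => by positivity) ?_ h3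
      filter_upwards [eventually_gt_atTop 0] with m hm
      simpa only [map_sub] using h.norm_sq_meanInnovation_sub_le hx hd1 hd0 hm
    have hDd' : Tendsto (fun m => ‖D m - d‖ₑ) atTop (𝓝 0) := by
      have h4 := ENNReal.tendsto_ofReal hDd.sqrt
      simpa only [Real.sqrt_zero, ENNReal.ofReal_zero, Real.sqrt_sq (norm_nonneg _), ofReal_norm]
        using h4
    refine tendsto_of_tendsto_of_tendsto_of_le_of_le' tendsto_const_nhds hDd'
      (Eventually.of_forall fun _ => zero_le) ?_
    filter_upwards [eventually_gt_atTop 0] with m hm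
    refine (h.orbitSeminorm_sub_meanInnovation hx hm).2.trans ?_
    have e : x - D m = (x - d) + -(D m - d) := by abel
    rw [← hD, e]
    refine (orbitSeminorm_add_le _ _).trans ?_
    rw [hd, zero_add, orbitSeminorm_neg, h.orbitSeminorm_of_difference]
    · rw [map_sub, hD1, hd1]
    · rw [map_sub, hD0, hd0, sub_zero]

theorem difference_unique (h : IsShiftSystem U P) {x d d' : H} (h1 : P 1 d = d) (h0 : P 0 d = 0)
    (hd : orbitSeminorm U (x - d) = 0) (h1' : P 1 d' = d') (h0' : P 0 d' = 0)
    (hd' : orbitSeminorm U (x - d') = 0) : d = d' := by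
  have e : d - d' = (x - d') + -(x - d) := by abel
  have h2 : orbitSeminorm U (d - d') ≤ 0 := by
    rw [e]
    refine (orbitSeminorm_add_le _ _).trans ?_
    rw [orbitSeminorm_neg, hd, hd', add_zero]
  rw [h.orbitSeminorm_of_difference (by rw [map_sub, h1, h1']) (by rw [map_sub, h0, h0', sub_zero])]
    at h2
  simpa [sub_eq_zero] using h2

end IsShiftSystem

end Hilbert

/-! ### Realisation of the Hilbert space statement on `L²` of the probability space. -/

section Transfer

set_option linter.unusedSectionVars false

variable {Ω : Type*} {mΩ : MeasurableSpace Ω} {μ : Measure Ω} [IsProbabilityMeasure μ]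
  {T : Ω ≃ᵐ Ω} {ℱ : Filtration ℕ mΩ}

lemma shiftFiltration_zero {F₀ : MeasurableSpace Ω} (hF₀ : F₀ ≤ mΩ) (hT : F₀ ≤ F₀.comap T) :
    shiftFiltration T hF₀ hT 0 = F₀ := by
  change F₀.comap (T^[0]) = F₀
  rw [Function.iterate_zero, MeasurableSpace.comap_id]

lemma shiftFiltration_succ {F₀ : MeasurableSpace Ω} (hF₀ : F₀ ≤ mΩ) (hT : F₀ ≤ F₀.comap T)
    (k : ℕ) : shiftFiltration T hF₀ hT (k + 1) = (shiftFiltration T hF₀ hT k).comap T := by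
  change F₀.comap (T^[k + 1]) = (F₀.comap (T^[k])).comap T
  rw [Function.iterate_succ, ← MeasurableSpace.comap_comp]

/-- Conditional expectations are equivariant under measure preserving equivalences. -/
lemma condExp_comp_equiv {m mΩ : MeasurableSpace Ω} {μ : Measure Ω} [IsProbabilityMeasure μ]
    {T : Ω ≃ᵐ Ω} (hTμ : MeasurePreserving T μ μ) (hm : m ≤ mΩ) {g : Ω → ℝ} (hg : Integrable g μ) :
    μ[g ∘ T | m.comap T] =ᵐ[μ] μ[g | m] ∘ T := by
  have hm' : m.comap T ≤ mΩ := (MeasurableSpace.comap_mono hm).trans T.measurable.comap_le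
  have hce : Integrable (μ[g | m] ∘ T) μ :=
    (hTμ.integrable_comp_emb T.measurableEmbedding).2 integrable_condExp
  refine (ae_eq_condExp_of_forall_setIntegral_eq hm'
    ((hTμ.integrable_comp_emb T.measurableEmbedding).2 hg) (fun s _ _ => hce.integrableOn)
    (fun s hs _ => ?_) ?_).symm
  · obtain ⟨t, ht, rfl⟩ := hs
    simp only [Function.comp_apply]
    rw [hTμ.setIntegral_preimage_emb T.measurableEmbedding,
      hTμ.setIntegral_preimage_emb T.measurableEmbedding, setIntegral_condExp hm hg ht]
  · exact (stronglyMeasurable_condExp.comp_measurable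
      (comap_measurable (m := m) T)).aestronglyMeasurable

lemma partialSum_succ (T : Ω → Ω) (Z : Ω → ℝ) (n : ℕ) :
    partialSum T Z (n + 1) = partialSum T Z n + Z ∘ T^[n] := by
  ext ω
  simp [partialSum, Finset.sum_range_succ]

lemma partialSum_zero (T : Ω → Ω) (Z : Ω → ℝ) : partialSum T Z 0 = 0 := by
  ext ω
  simp [partialSum]

lemma sum_Icc_comp_iterate (T : Ω → Ω) (Z : Ω → ℝ) (n : ℕ) :
    (fun ω => ∑ j ∈ Finset.Icc 1 n, Z (T^[j] ω)) = partialSum T Z n ∘ T := by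
  ext ω
  simp only [partialSum, Function.comp_apply, ← Function.iterate_succ_apply]
  rw [Finset.range_eq_Ico, Finset.sum_Ico_add' (fun i => Z (T^[i] ω)) 0 n 1]
  rfl

lemma memLp_comp_iterate (hTμ : MeasurePreserving T μ μ) {p : ℝ≥0∞} {Z : Ω → ℝ}
    (hZ : MemLp Z p μ) (n : ℕ) : MemLp (Z ∘ (T : Ω → Ω)^[n]) p μ :=
  hZ.comp_measurePreserving (hTμ.iterate n)

lemma memLp_partialSum (hTμ : MeasurePreserving T μ μ) {p : ℝ≥0∞} {Z : Ω → ℝ}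
    (hZ : MemLp Z p μ) (n : ℕ) : MemLp (partialSum T Z n) p μ := by
  induction n with
  | zero => rw [partialSum_zero]; exact MemLp.zero
  | succ n ih => rw [partialSum_succ]; exact ih.add (memLp_comp_iterate hTμ hZ n)

/-- Composition with a measure preserving map, on `L²`. -/
def koopman (hTμ : MeasurePreserving T μ μ) : Lp ℝ 2 μ →L[ℝ] Lp ℝ 2 μ :=
  (Lp.compMeasurePreservingₗᵢ ℝ T hTμ).toContinuousLinearMap

/-- Conditional expectation, on `L²`. -/
def condProj (μ : Measure Ω) (ℱ : Filtration ℕ mΩ) (k : ℕ) :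
    Lp ℝ 2 μ →L[ℝ] Lp ℝ 2 μ :=
  (lpMeas ℝ ℝ (ℱ k) 2 μ).subtypeL ∘L condExpL2 ℝ ℝ (ℱ.le k)

lemma koopman_toLp (hTμ : MeasurePreserving T μ μ) {g : Ω → ℝ} (hg : MemLp g 2 μ) :
    koopman hTμ (hg.toLp g) = (hg.comp_measurePreserving hTμ).toLp (g ∘ T) := rfl

lemma memLp_two_condExp {m : MeasurableSpace Ω} {g : Ω → ℝ} (hg : MemLp g 2 μ) :
    MemLp (μ[g | m]) 2 μ :=
  MemLp.condExp one_le_two hg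

lemma condProj_toLp {g : Ω → ℝ} (hg : MemLp g 2 μ) (k : ℕ) :
    condProj μ ℱ k (hg.toLp g) = (memLp_two_condExp hg).toLp (μ[g | ℱ k]) := by
  refine Lp.ext ?_
  exact (hg.condExpL2_ae_eq_condExp (𝕜 := ℝ) (ℱ.le k)).trans (MemLp.coeFn_toLp _).symm

lemma koopman_pow_toLp (hTμ : MeasurePreserving T μ μ) {g : Ω → ℝ} (hg : MemLp g 2 μ) (n : ℕ) :
    (koopman hTμ ^ n) (hg.toLp g) =
      (memLp_comp_iterate hTμ hg n).toLp (g ∘ (T : Ω → Ω)^[n]) := by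
  induction n with
  | zero => rfl
  | succ n ih => rw [pow_succ', mul_apply_eq_comp, ih]; rfl

lemma orbitSum_toLp (hTμ : MeasurePreserving T μ μ) {g : Ω → ℝ} (hg : MemLp g 2 μ) (n : ℕ) :
    orbitSum (koopman hTμ) n (hg.toLp g) =
      (memLp_partialSum hTμ hg n).toLp (partialSum T g n) := by
  induction n with
  | zero =>
    rw [orbitSum_zero]
    have h0 : partialSum T g 0 =ᵐ[μ] (0 : Ω → ℝ) := by rw [partialSum_zero]
    rw [MemLp.toLp_congr (memLp_partialSum hTμ hg 0) MemLp.zero h0, MemLp.toLp_zero]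
    rfl
  | succ n ih =>
    rw [orbitSum_succ, ih, koopman_pow_toLp, ← MemLp.toLp_add]
    exact MemLp.toLp_congr _ _ (by rw [partialSum_succ])

lemma isShiftSystem (hTμ : MeasurePreserving T μ μ) (hℱ : ∀ k, ℱ (k + 1) = (ℱ k).comap T) :
    IsShiftSystem (koopman hTμ) (condProj μ ℱ) where
  norm_map x := (Lp.compMeasurePreservingₗᵢ ℝ T hTμ).norm_map x
  proj_proj_of_le {j k} hjk x := by
    rw [← Lp.toLp_coeFn x (Lp.memLp x), condProj_toLp, condProj_toLp, condProj_toLp]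
    exact MemLp.toLp_congr _ _ (condExp_condExp_of_le (ℱ.mono hjk) (ℱ.le k))
  proj_proj_of_ge {j k} hjk x := by
    rw [← Lp.toLp_coeFn x (Lp.memLp x), condProj_toLp, condProj_toLp]
    refine MemLp.toLp_congr _ _ (Eq.eventuallyEq ?_)
    exact condExp_of_stronglyMeasurable (ℱ.le k)
      (stronglyMeasurable_condExp.mono (ℱ.mono hjk)) integrable_condExp
  symm k x y := inner_condExpL2_left_eq_right (ℱ.le k)
  map_proj k x := by
    rw [← Lp.toLp_coeFn x (Lp.memLp x), condProj_toLp, koopman_toLp, koopman_toLp, condProj_toLp]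
    refine MemLp.toLp_congr _ _ ?_
    rw [hℱ k]
    exact (condExp_comp_equiv hTμ (ℱ.le k) ((Lp.memLp x).integrable one_le_two)).symm

lemma norm_toLp_sq {g : Ω → ℝ} (hg : MemLp g 2 μ) : ‖hg.toLp g‖ ^ 2 = ∫ ω, g ω ^ 2 ∂μ := by
  rw [← real_inner_self_eq_norm_sq, L2.inner_def]
  refine integral_congr_ae ?_
  filter_upwards [hg.coeFn_toLp] with ω hω
  simp [hω, sq]

/-- Summing over `1, …, n` instead of `0, …, n - 1` only composes the sum with `T`, which preserves
the norm. -/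
lemma plusSeminorm_eq_orbitSeminorm (hTμ : MeasurePreserving T μ μ) {Z : Ω → ℝ}
    (hZ : MemLp Z 2 μ) :
    plusSeminorm μ T Z = orbitSeminorm (koopman hTμ) (hZ.toLp Z) := by
  unfold plusSeminorm orbitSeminorm
  congr 1
  ext n
  rw [sum_Icc_comp_iterate, eLpNorm_comp_measurePreserving
    (memLp_partialSum hTμ hZ n).aestronglyMeasurable hTμ, orbitSum_toLp, Lp.norm_toLp,
    div_eq_mul_one_div (ENNReal.toReal _), mul_comm, ENNReal.ofReal_mul ENNReal.toReal_nonneg,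
    ENNReal.ofReal_toReal (memLp_partialSum hTμ hZ n).eLpNorm_ne_top]

lemma martingaleApprox_iff_orbitSeminorm (hTμ : MeasurePreserving T μ μ) {Z D : Ω → ℝ}
    (hZ : MemLp Z 2 μ) (hD : MemLp D 2 μ) {M : ℕ → Ω → ℝ} (hM : ∀ n, M n =ᵐ[μ] partialSum T D n) :
    MartingaleApprox μ (partialSum T Z) M ↔
      orbitSeminorm (koopman hTμ) (hZ.toLp Z - hD.toLp D) = 0 := by
  rw [orbitSeminorm_eq_zero_iff, MartingaleApprox]
  refine tendsto_congr fun n => ?_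
  rw [map_sub, orbitSum_toLp, orbitSum_toLp, ← MemLp.toLp_sub, norm_toLp_sq]
  congr 1
  refine integral_congr_ae ?_
  filter_upwards [hM n] with ω hω
  simp [hω]

lemma memLp_averagedProjection (hTμ : MeasurePreserving T μ μ) {X : Ω → ℝ} (hX : MemLp X 2 μ)
    (m : ℕ) : MemLp (averagedProjection μ T ℱ X m) 2 μ := by
  refine MemLp.const_mul ?_ _
  refine memLp_two_condExp ?_
  rw [sum_Icc_comp_iterate]
  exact (memLp_partialSum hTμ hX m).comp_measurePreserving hTμ

lemma toLp_averagedProjection (hTμ : MeasurePreserving T μ μ) {X : Ω → ℝ} (hX : MemLp X 2 μ)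
    (m : ℕ) : (memLp_averagedProjection (ℱ := ℱ) hTμ hX m).toLp (averagedProjection μ T ℱ X m) =
      IsShiftSystem.meanPrediction (koopman hTμ) (condProj μ ℱ) (hX.toLp X) m := by
  have h1 : ∑ i ∈ Finset.Icc 1 m, (koopman hTμ ^ i) (hX.toLp X) =
      ((memLp_partialSum hTμ hX m).comp_measurePreserving hTμ).toLp (partialSum T X m ∘ T) := by
    rw [← koopman_toLp hTμ (memLp_partialSum hTμ hX m), ← orbitSum_toLp hTμ hX, orbitSum, sum_apply,
      map_sum]
    simp_rw [← mul_apply_eq_comp, ← pow_succ']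
    rw [Finset.range_eq_Ico,
      Finset.sum_Ico_add' (fun i => (koopman hTμ ^ i) (hX.toLp X)) 0 m 1]
    rfl
  rw [IsShiftSystem.meanPrediction, h1, condProj_toLp, ← MemLp.toLp_const_smul]
  refine MemLp.toLp_congr _ _ (Eq.eventuallyEq ?_)
  ext ω
  simp only [averagedProjection, sum_Icc_comp_iterate, Pi.smul_apply, smul_eq_mul]

/-- `D` generates the martingale `partialSum T D`. -/
structure IsMartingaleDifference (μ : Measure Ω) (ℱ : Filtration ℕ mΩ) (D : Ω → ℝ) : Prop where
  stronglyMeasurable : StronglyMeasurable[ℱ 1] D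
  memLp : MemLp D 2 μ
  condExp : μ[D | ℱ 0] =ᵐ[μ] 0

namespace IsMartingaleDifference

variable {D : Ω → ℝ}

lemma stronglyMeasurable_comp (hD : IsMartingaleDifference μ ℱ D)
    (hℱ : ∀ k, ℱ (k + 1) = (ℱ k).comap T) (n : ℕ) :
    StronglyMeasurable[ℱ (n + 1)] (D ∘ (T : Ω → Ω)^[n]) := by
  induction n with
  | zero => exact hD.stronglyMeasurable
  | succ n ih =>
    rw [hℱ (n + 1), Function.iterate_succ]
    exact ih.comp_measurable (comap_measurable (m := ℱ (n + 1)) T)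

lemma condExp_comp (hD : IsMartingaleDifference μ ℱ D) (hTμ : MeasurePreserving T μ μ)
    (hℱ : ∀ k, ℱ (k + 1) = (ℱ k).comap T) (n : ℕ) :
    μ[D ∘ (T : Ω → Ω)^[n] | ℱ n] =ᵐ[μ] 0 := by
  induction n with
  | zero => exact hD.condExp
  | succ n ih =>
    rw [hℱ n, Function.iterate_succ, ← Function.comp_assoc]
    refine (condExp_comp_equiv hTμ (ℱ.le n)
      ((memLp_comp_iterate hTμ hD.memLp n).integrable one_le_two)).trans ?_
    exact hTμ.quasiMeasurePreserving.ae_eq_comp ih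

lemma stronglyMeasurable_partialSum (hD : IsMartingaleDifference μ ℱ D)
    (hℱ : ∀ k, ℱ (k + 1) = (ℱ k).comap T) (n : ℕ) :
    StronglyMeasurable[ℱ n] (partialSum T D n) := by
  induction n with
  | zero => rw [partialSum_zero]; exact stronglyMeasurable_zero
  | succ n ih =>
    rw [partialSum_succ]
    exact (ih.mono (ℱ.mono n.le_succ)).add (hD.stronglyMeasurable_comp hℱ n)

lemma isStationaryMartingale (hD : IsMartingaleDifference μ ℱ D) (hTμ : MeasurePreserving T μ μ)
    (hℱ : ∀ k, ℱ (k + 1) = (ℱ k).comap T) :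
    IsStationaryMartingale μ T ℱ (partialSum T D) where
  martingale := by
    refine martingale_of_condExp_sub_eq_zero_nat (hD.stronglyMeasurable_partialSum hℱ)
      (fun n => (memLp_partialSum hTμ hD.memLp n).integrable one_le_two) fun n => ?_
    rw [partialSum_succ, add_sub_cancel_left]
    exact hD.condExp_comp hTμ hℱ n
  stationary := ⟨D, hD.memLp, fun _ => EventuallyEq.rfl⟩

end IsMartingaleDifference

/-- An `L²` class fixed by the projection is only almost everywhere equal to an `ℱ 1`-measurable
function. Choosing such a version makes the partial sums genuinely adapted. -/
lemma exists_isMartingaleDifference {d : Lp ℝ 2 μ} (h1 : condProj μ ℱ 1 d = d)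
    (h0 : condProj μ ℱ 0 d = 0) :
    ∃ D, ∃ hD : IsMartingaleDifference μ ℱ D, hD.memLp.toLp D = d := by
  have hd : AEStronglyMeasurable[ℱ 1] d μ := by
    have : AEStronglyMeasurable[ℱ 1] (condProj μ ℱ 1 d : Ω → ℝ) μ :=
      aestronglyMeasurable_condExpL2 (ℱ.le 1) d
    rwa [h1] at this
  have hD2 : MemLp (hd.mk d) 2 μ := (memLp_congr_ae hd.ae_eq_mk).1 (Lp.memLp d)
  have heq : hD2.toLp (hd.mk d) = d := by
    refine Lp.ext ((MemLp.coeFn_toLp _).trans ?_)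
    exact hd.ae_eq_mk.symm
  refine ⟨hd.mk d, ⟨hd.stronglyMeasurable_mk, hD2, ?_⟩, heq⟩
  rw [← heq, condProj_toLp] at h0
  have := (MemLp.coeFn_toLp (memLp_two_condExp (m := ℱ 0) hD2)).symm
  rw [h0] at this
  exact this.trans (Lp.coeFn_zero _ _ _)

/-- Since `M 1 = D` and `M 0 = 0` almost surely, the martingale property between times 0 and 1 is
exactly the pair of projection identities. -/
lemma IsStationaryMartingale.exists_difference {M : ℕ → Ω → ℝ}
    (hM : IsStationaryMartingale μ T ℱ M) :
    ∃ D, ∃ hD : MemLp D 2 μ, (∀ n, M n =ᵐ[μ] partialSum T D n) ∧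
      condProj μ ℱ 1 (hD.toLp D) = hD.toLp D ∧ condProj μ ℱ 0 (hD.toLp D) = 0 := by
  obtain ⟨D, hD, hMD⟩ := hM.stationary
  have hM1 : M 1 =ᵐ[μ] D := by
    refine (hMD 1).trans (Eq.eventuallyEq ?_)
    ext ω
    simp [partialSum]
  have hM0 : M 0 =ᵐ[μ] 0 := by
    simpa only [partialSum_zero] using hMD 0
  refine ⟨D, hD, hMD, ?_, ?_⟩
  · rw [condProj_toLp]
    refine MemLp.toLp_congr _ _ ?_
    exact (condExp_congr_ae hM1.symm).trans ((hM.martingale.condExp_ae_eq le_rfl).trans hM1)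
  · rw [condProj_toLp]
    rw [← MemLp.toLp_zero (MemLp.zero (ε := ℝ) (p := 2) (μ := μ))]
    refine MemLp.toLp_congr _ _ ?_
    exact (condExp_congr_ae hM1.symm).trans ((hM.martingale.condExp_ae_eq zero_le_one).trans hM0)

/-- Existence of an approximating martingale, together with a regular version of its differences. -/
theorem tendsto_plusSeminorm_iff (hTμ : MeasurePreserving T μ μ)
    (hℱ : ∀ k, ℱ (k + 1) = (ℱ k).comap T) {X : Ω → ℝ} (hX : StronglyMeasurable[ℱ 0] X)
    (hX2 : MemLp X 2 μ) :
    Tendsto (fun m => plusSeminorm μ T (averagedProjection μ T ℱ X m)) atTop (𝓝 0) ↔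
      ∃ D, IsMartingaleDifference μ ℱ D ∧ MartingaleApprox μ (partialSum T X) (partialSum T D) := by
  have hx : condProj μ ℱ 0 (hX2.toLp X) = hX2.toLp X := by
    rw [condProj_toLp]
    exact MemLp.toLp_congr _ _ (Eq.eventuallyEq
      (condExp_of_stronglyMeasurable (ℱ.le 0) hX (hX2.integrable one_le_two)))
  have h := (isShiftSystem hTμ hℱ).tendsto_meanPrediction_iff hx
  have h2 : ∀ m, plusSeminorm μ T (averagedProjection μ T ℱ X m) =
      orbitSeminorm (koopman hTμ)
        (IsShiftSystem.meanPrediction (koopman hTμ) (condProj μ ℱ) (hX2.toLp X) m) := fun m => by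
    rw [plusSeminorm_eq_orbitSeminorm hTμ (memLp_averagedProjection hTμ hX2 m),
      toLp_averagedProjection]
  simp_rw [h2]
  rw [h]
  constructor
  · rintro ⟨d, h1, h0, hd⟩
    obtain ⟨D, hD, rfl⟩ := exists_isMartingaleDifference h1 h0
    exact ⟨D, hD, (martingaleApprox_iff_orbitSeminorm hTμ hX2 hD.memLp
      fun _ => EventuallyEq.rfl).2 hd⟩
  · rintro ⟨D, hD, hDX⟩
    obtain ⟨D', hD', hMD, h1, h0⟩ := (hD.isStationaryMartingale hTμ hℱ).exists_difference
    exact ⟨_, h1, h0, (martingaleApprox_iff_orbitSeminorm hTμ hX2 hD' hMD).1 hDX⟩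

theorem exists_isMartingaleDifference_iff (hTμ : MeasurePreserving T μ μ)
    (hℱ : ∀ k, ℱ (k + 1) = (ℱ k).comap T) {X : Ω → ℝ} (hX2 : MemLp X 2 μ) :
    (∃ D, IsMartingaleDifference μ ℱ D ∧ MartingaleApprox μ (partialSum T X) (partialSum T D)) ↔
      ∃ M, IsStationaryMartingale μ T ℱ M ∧ MartingaleApprox μ (partialSum T X) M := by
  constructor
  · rintro ⟨D, hD, hDX⟩
    exact ⟨_, hD.isStationaryMartingale hTμ hℱ, hDX⟩
  · rintro ⟨M, hM, hMX⟩
    obtain ⟨D', hD', hMD, h1, h0⟩ := hM.exists_difference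
    rw [martingaleApprox_iff_orbitSeminorm hTμ hX2 hD' hMD] at hMX
    obtain ⟨D, hD, heq⟩ := exists_isMartingaleDifference h1 h0
    rw [← heq] at hMX
    exact ⟨D, hD, (martingaleApprox_iff_orbitSeminorm hTμ hX2 hD.memLp
      fun _ => EventuallyEq.rfl).2 hMX⟩

theorem stationaryMartingale_unique (hTμ : MeasurePreserving T μ μ)
    (hℱ : ∀ k, ℱ (k + 1) = (ℱ k).comap T) {X : Ω → ℝ} (hX2 : MemLp X 2 μ) {M M' : ℕ → Ω → ℝ}
    (hM : IsStationaryMartingale μ T ℱ M) (hMX : MartingaleApprox μ (partialSum T X) M)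
    (hM' : IsStationaryMartingale μ T ℱ M') (hMX' : MartingaleApprox μ (partialSum T X) M')
    (n : ℕ) : M n =ᵐ[μ] M' n := by
  obtain ⟨D, hD, hMD, h1, h0⟩ := hM.exists_difference
  obtain ⟨D', hD', hMD', h1', h0'⟩ := hM'.exists_difference
  rw [martingaleApprox_iff_orbitSeminorm hTμ hX2 hD hMD] at hMX
  rw [martingaleApprox_iff_orbitSeminorm hTμ hX2 hD' hMD'] at hMX'
  have heq := (isShiftSystem hTμ hℱ).difference_unique h1 h0 hMX h1' h0' hMX'
  refine (hMD n).trans (EventuallyEq.trans ?_ (hMD' n).symm)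
  have h2 := congrArg (orbitSum (koopman hTμ) n) heq
  rw [orbitSum_toLp, orbitSum_toLp] at h2
  exact (MemLp.toLp_eq_toLp_iff _ _).1 h2

end Transfer

/-! ### The mean ergodic theorem in `L¹` with an everywhere invariant limit. -/

section Ergodic

set_option linter.unusedSectionVars false

variable {Ω : Type*} {mΩ : MeasurableSpace Ω} {μ : Measure Ω} [IsProbabilityMeasure μ]
  {T : Ω ≃ᵐ Ω}

lemma tendsto_eLpNorm_one_of_dominated {F : ℕ → Ω → ℝ} {b : Ω → ℝ}
    (hF : ∀ n, AEStronglyMeasurable (F n) μ) (hb : Integrable b μ)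
    (hFb : ∀ n, ∀ᵐ ω ∂μ, |F n ω| ≤ b ω)
    (hlim : ∀ᵐ ω ∂μ, Tendsto (fun n => F n ω) atTop (𝓝 0)) :
    Tendsto (fun n => eLpNorm (F n) 1 μ) atTop (𝓝 0) := by
  simp_rw [eLpNorm_one_eq_lintegral_enorm]
  have h := tendsto_lintegral_of_dominated_convergence' (μ := μ) (F := fun n ω => ‖F n ω‖ₑ)
    (f := fun _ => 0) (fun ω => ‖b ω‖ₑ) (fun n => (hF n).enorm) (fun n => ?_) hb.2.ne ?_
  · simpa using h
  · filter_upwards [hFb n] with ω hω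
    rw [enorm_le_iff_norm_le, Real.norm_eq_abs, Real.norm_eq_abs]
    exact hω.trans (le_abs_self _)
  · filter_upwards [hlim] with ω hω
    have := hω.enorm
    simpa using this

/-- The ergodic average of `g` at time `n`. -/
def ergodicAverage (T : Ω → Ω) (g : Ω → ℝ) (n : ℕ) : Ω → ℝ := fun ω => (n : ℝ)⁻¹ * partialSum T g n ω

lemma ergodicAverage_sub (T : Ω → Ω) (g g' : Ω → ℝ) (n : ℕ) :
    ergodicAverage T (g - g') n = ergodicAverage T g n - ergodicAverage T g' n := by
  ext ω
  simp [ergodicAverage, partialSum, mul_sub]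

lemma memLp_ergodicAverage (hTμ : MeasurePreserving T μ μ) {p : ℝ≥0∞} {g : Ω → ℝ}
    (hg : MemLp g p μ) (n : ℕ) : MemLp (ergodicAverage T g n) p μ :=
  (memLp_partialSum hTμ hg n).const_mul _

lemma eLpNorm_comp_iterate (hTμ : MeasurePreserving T μ μ) {p : ℝ≥0∞} {g : Ω → ℝ}
    (hg : AEStronglyMeasurable g μ) (n : ℕ) :
    eLpNorm (g ∘ (T : Ω → Ω)^[n]) p μ = eLpNorm g p μ :=
  eLpNorm_comp_measurePreserving hg (hTμ.iterate n)

lemma eLpNorm_partialSum_le (hTμ : MeasurePreserving T μ μ) {g : Ω → ℝ} (hg : MemLp g 1 μ)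
    (n : ℕ) : eLpNorm (partialSum T g n) 1 μ ≤ n * eLpNorm g 1 μ := by
  induction n with
  | zero => simp [partialSum_zero]
  | succ n ih =>
    rw [partialSum_succ]
    refine (eLpNorm_add_le (memLp_partialSum hTμ hg n).1 (memLp_comp_iterate hTμ hg n).1
      le_rfl).trans ?_
    rw [eLpNorm_comp_iterate hTμ hg.1]
    push_cast
    rw [add_mul, one_mul]
    gcongr

lemma eLpNorm_inv_mul_le {f : Ω → ℝ} {c : ℝ≥0∞} (n : ℕ) (h : eLpNorm f 1 μ ≤ n * c) :
    eLpNorm (fun ω => (n : ℝ)⁻¹ * f ω) 1 μ ≤ c := by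
  have h1 : (fun ω => (n : ℝ)⁻¹ * f ω) = (n : ℝ)⁻¹ • f := rfl
  rw [h1, eLpNorm_const_smul]
  rcases Nat.eq_zero_or_pos n with rfl | hn
  · simp
  · calc _ ≤ ‖(n : ℝ)⁻¹‖ₑ * (n * c) := by gcongr
      _ = c := by
        have hn' : (n : ℝ) ≠ 0 := by exact_mod_cast hn.ne'
        rw [enorm_inv hn', ← mul_assoc]
        have : ‖(n : ℝ)‖ₑ = (n : ℝ≥0∞) := by simp
        rw [this, ENNReal.inv_mul_cancel (by exact_mod_cast hn.ne') (by simp), one_mul]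

lemma eLpNorm_ergodicAverage_le (hTμ : MeasurePreserving T μ μ) {g : Ω → ℝ} (hg : MemLp g 1 μ)
    (n : ℕ) : eLpNorm (ergodicAverage T g n) 1 μ ≤ eLpNorm g 1 μ :=
  eLpNorm_inv_mul_le n (eLpNorm_partialSum_le hTμ hg n)

/-- Von Neumann's theorem for the Koopman isometry gives the Cauchy property in `L²`, and the `L¹`
norm is dominated by the `L²` norm on a probability space. -/
lemma cauchy_ergodicAverage_of_memLp_two (hTμ : MeasurePreserving T μ μ) {g : Ω → ℝ}
    (hg : MemLp g 2 μ) {ε : ℝ≥0∞} (hε : 0 < ε) :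
    ∃ N, ∀ m ≥ N, ∀ n ≥ N, eLpNorm (ergodicAverage T g m - ergodicAverage T g n) 1 μ < ε := by
  have h1 := (koopman hTμ).tendsto_birkhoffAverage_orthogonalProjection
    ((koopman hTμ).opNorm_le_bound zero_le_one fun x => by
      rw [one_mul]; exact ((Lp.compMeasurePreservingₗᵢ ℝ T hTμ).norm_map x).le) (hg.toLp g)
  have h2 := EMetric.cauchySeq_iff.1 h1.cauchySeq ε hε
  obtain ⟨N, hN⟩ := h2
  refine ⟨N, fun m hm n hn => lt_of_le_of_lt ?_ (hN m hm n hn)⟩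
  have h3 : ∀ n, birkhoffAverage ℝ (koopman hTμ) _root_.id n (hg.toLp g) =
      (memLp_ergodicAverage hTμ hg n).toLp (ergodicAverage T g n) := fun n => by
    have : birkhoffSum (koopman hTμ) _root_.id n (hg.toLp g) =
        orbitSum (koopman hTμ) n (hg.toLp g) := by
      simp [birkhoffSum, orbitSum, sum_apply]
    rw [birkhoffAverage, this, orbitSum_toLp, ← MemLp.toLp_const_smul]
    rfl
  rw [h3, h3, Lp.edist_toLp_toLp]
  exact eLpNorm_le_eLpNorm_of_exponent_le one_le_two
    ((memLp_ergodicAverage hTμ hg m).sub (memLp_ergodicAverage hTμ hg n)).1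

lemma tendsto_eLpNorm_sub_min {g : Ω → ℝ} (hg : Integrable g μ) (h0 : ∀ ω, 0 ≤ g ω) :
    Tendsto (fun K : ℕ => eLpNorm (g - fun ω => min (g ω) K) 1 μ) atTop (𝓝 0) := by
  refine tendsto_eLpNorm_one_of_dominated (b := g)
    (fun K => hg.1.sub (hg.1.inf aestronglyMeasurable_const)) hg
    (fun K => ae_of_all _ fun ω => ?_) (ae_of_all _ fun ω => ?_)
  · have : 0 ≤ min (g ω) K := le_min (h0 ω) K.cast_nonneg
    rw [Pi.sub_apply, abs_of_nonneg (sub_nonneg.2 (min_le_left _ _))]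
    linarith
  · refine tendsto_const_nhds.congr' ?_
    filter_upwards [eventually_ge_atTop ⌈g ω⌉₊] with K hK
    rw [Pi.sub_apply, min_eq_left (Nat.ceil_le.1 hK), sub_self]

lemma memLp_min {g : Ω → ℝ} (hg : Integrable g μ) (h0 : ∀ ω, 0 ≤ g ω) (K : ℕ) (p : ℝ≥0∞) :
    MemLp (fun ω => min (g ω) K) p μ := by
  refine MemLp.of_bound (hg.1.inf aestronglyMeasurable_const) K (ae_of_all _ fun ω => ?_)
  rw [Real.norm_of_nonneg (le_min (h0 ω) K.cast_nonneg)]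
  exact min_le_right _ _

/-- Truncation `min g K` places the function in `L²`. The averaging operators contract `L¹`, so the
truncation error stays small uniformly in time. -/
lemma exists_tendsto_ergodicAverage (hTμ : MeasurePreserving T μ μ) {g : Ω → ℝ}
    (hg : Integrable g μ) (h0 : ∀ ω, 0 ≤ g ω) :
    ∃ l : Ω → ℝ, Measurable l ∧ Integrable l μ ∧
      Tendsto (fun n => eLpNorm (ergodicAverage T g n - l) 1 μ) atTop (𝓝 0) := by
  have hg1 : MemLp g 1 μ := memLp_one_iff_integrable.2 hg
  have hA := memLp_ergodicAverage hTμ hg1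
  have hc : CauchySeq fun n => (hA n).toLp (ergodicAverage T g n) := by
    rw [EMetric.cauchySeq_iff]
    intro ε hε
    have hε3 : 0 < ε / 3 := ENNReal.div_pos hε.ne' (by simp)
    obtain ⟨K, hK⟩ := ((tendsto_eLpNorm_sub_min hg h0).eventually (gt_mem_nhds hε3)).exists
    set gK : Ω → ℝ := fun ω => min (g ω) K with hgK
    have hgK1 : MemLp gK 1 μ := memLp_min hg h0 K 1
    obtain ⟨N, hN⟩ := cauchy_ergodicAverage_of_memLp_two hTμ (memLp_min hg h0 K 2) hε3
    refine ⟨N, fun m hm n hn => ?_⟩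
    have hB := memLp_ergodicAverage hTμ hgK1
    have hC := memLp_ergodicAverage hTμ (hg1.sub hgK1)
    rw [Lp.edist_toLp_toLp]
    have e : ergodicAverage T g m - ergodicAverage T g n =
        ergodicAverage T (g - gK) m + (ergodicAverage T gK m - ergodicAverage T gK n)
          - ergodicAverage T (g - gK) n := by
      rw [ergodicAverage_sub, ergodicAverage_sub]; abel
    rw [e]
    calc _ ≤ eLpNorm (ergodicAverage T (g - gK) m +
            (ergodicAverage T gK m - ergodicAverage T gK n)) 1 μ +
            eLpNorm (ergodicAverage T (g - gK) n) 1 μ :=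
          eLpNorm_sub_le ((hC m).1.add ((hB m).1.sub (hB n).1)) (hC n).1 le_rfl
      _ ≤ eLpNorm (ergodicAverage T (g - gK) m) 1 μ +
            eLpNorm (ergodicAverage T gK m - ergodicAverage T gK n) 1 μ +
            eLpNorm (ergodicAverage T (g - gK) n) 1 μ := by
          gcongr
          exact eLpNorm_add_le (hC m).1 ((hB m).1.sub (hB n).1) le_rfl
      _ < ε / 3 + ε / 3 + ε / 3 := by
          refine ENNReal.add_lt_add (ENNReal.add_lt_add ?_ (hN m hm n hn)) ?_
          · exact (eLpNorm_ergodicAverage_le hTμ (hg1.sub hgK1) m).trans_lt hK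
          · exact (eLpNorm_ergodicAverage_le hTμ (hg1.sub hgK1) n).trans_lt hK
      _ = ε := ENNReal.add_thirds ε
  obtain ⟨l, hl⟩ := cauchySeq_tendsto_of_complete hc
  refine ⟨l, (Lp.stronglyMeasurable l).measurable, memLp_one_iff_integrable.1 (Lp.memLp l), ?_⟩
  rw [tendsto_iff_edist_tendsto_0] at hl
  refine hl.congr fun n => ?_
  nth_rw 1 [← Lp.toLp_coeFn l (Lp.memLp l)]
  rw [Lp.edist_toLp_toLp]

lemma ergodicAverage_comp_sub (T : Ω → Ω) (g : Ω → ℝ) (n : ℕ) :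
    ergodicAverage T g n ∘ T - ergodicAverage T g n =
      fun ω => (n : ℝ)⁻¹ * (g ∘ T^[n] - g) ω := by
  ext ω
  simp only [ergodicAverage, partialSum, Function.comp_apply, Pi.sub_apply, ← mul_sub,
    ← Function.iterate_succ_apply]
  have h1 := Finset.sum_range_succ (fun i => g (T^[i] ω)) n
  have h2 := Finset.sum_range_succ' (fun i => g (T^[i] ω)) n
  simp only [Function.iterate_zero, id] at h2
  congr 1
  linarith

/-- Shifting an average changes it only by the boundary terms `(g ∘ T^n - g)/n`, of `L¹` norm at
most `2‖g‖₁/n`. -/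
lemma ae_eq_of_tendsto_ergodicAverage (hTμ : MeasurePreserving T μ μ) {g l : Ω → ℝ}
    (hg : Integrable g μ) (hl : Integrable l μ)
    (h : Tendsto (fun n => eLpNorm (ergodicAverage T g n - l) 1 μ) atTop (𝓝 0)) :
    l ∘ T =ᵐ[μ] l := by
  have hg1 : MemLp g 1 μ := memLp_one_iff_integrable.2 hg
  have hA := memLp_ergodicAverage hTμ hg1
  have hlT : AEStronglyMeasurable (l ∘ T) μ := hl.1.comp_measurePreserving hTμ
  have h1 : Tendsto (fun n : ℕ => eLpNorm (fun ω => (n : ℝ)⁻¹ * (g ∘ (T : Ω → Ω)^[n] - g) ω) 1 μ)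
      atTop (𝓝 0) := by
    have hb : ∀ n : ℕ, eLpNorm (fun ω => (n : ℝ)⁻¹ * (g ∘ (T : Ω → Ω)^[n] - g) ω) 1 μ ≤
        ENNReal.ofReal ((n : ℝ)⁻¹) * (2 * eLpNorm g 1 μ) := fun n => by
      have e : (fun ω => (n : ℝ)⁻¹ * (g ∘ (T : Ω → Ω)^[n] - g) ω) =
          (n : ℝ)⁻¹ • (g ∘ (T : Ω → Ω)^[n] - g) := rfl
      rw [e, eLpNorm_const_smul, Real.enorm_of_nonneg (by positivity)]
      gcongr
      refine (eLpNorm_sub_le (memLp_comp_iterate hTμ hg1 n).1 hg.1 le_rfl).trans ?_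
      rw [eLpNorm_comp_iterate hTμ hg.1, two_mul]
    have hz : Tendsto (fun n : ℕ => ENNReal.ofReal ((n : ℝ)⁻¹) * (2 * eLpNorm g 1 μ)) atTop
        (𝓝 0) := by
      have := ENNReal.Tendsto.mul_const (b := 2 * eLpNorm g 1 μ)
        (ENNReal.tendsto_ofReal tendsto_inv_atTop_nhds_zero_nat)
        (Or.inr (ENNReal.mul_ne_top (by simp) hg1.eLpNorm_ne_top))
      simpa using this
    exact tendsto_of_tendsto_of_tendsto_of_le_of_le tendsto_const_nhds hz (fun _ => zero_le) hb
  have h2 : Tendsto (fun n : ℕ => eLpNorm (ergodicAverage T g n - l) 1 μ +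
      eLpNorm (fun ω => (n : ℝ)⁻¹ * (g ∘ (T : Ω → Ω)^[n] - g) ω) 1 μ +
      eLpNorm (ergodicAverage T g n - l) 1 μ) atTop (𝓝 0) := by
    simpa using (h.add h1).add h
  have h3 : eLpNorm (l ∘ T - l) 1 μ = 0 := by
    refine le_antisymm (ge_of_tendsto' h2 fun n => ?_) zero_le
    have e : l ∘ T - l = (ergodicAverage T g n - l)
        + (ergodicAverage T g n ∘ T - ergodicAverage T g n)
        - (ergodicAverage T g n - l) ∘ T := by
      ext ω; simp
    have hB := (hA n).comp_measurePreserving hTμ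
    rw [e, ← ergodicAverage_comp_sub]
    refine (eLpNorm_sub_le (((hA n).1.sub hl.1).add (hB.1.sub (hA n).1))
      (((hA n).1.sub hl.1).comp_measurePreserving hTμ) le_rfl).trans ?_
    rw [eLpNorm_comp_measurePreserving ((hA n).1.sub hl.1) hTμ]
    gcongr
    exact eLpNorm_add_le ((hA n).1.sub hl.1) (hB.1.sub (hA n).1) le_rfl
  rw [eLpNorm_eq_zero_iff (hlT.sub hl.1) one_ne_zero] at h3
  filter_upwards [h3] with ω hω
  simpa [sub_eq_zero] using hω

/-- An almost everywhere invariant function has a nonnegative invariant modification of its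
positive part. -/
lemma exists_invariant_modification (hTμ : MeasurePreserving T μ μ) {l : Ω → ℝ}
    (hl : Measurable l) (hinv : l ∘ T =ᵐ[μ] l) :
    ∃ η : Ω → ℝ, Measurable η ∧ (∀ ω, 0 ≤ η ω) ∧ (∀ ω, η (T ω) = η ω) ∧
      η =ᵐ[μ] fun ω => max (l ω) 0 := by
  -- A limsup along the orbit ignores its first term, hence is invariant at every point. Taking it
  -- in `ℝ≥0∞` avoids boundedness conditions.
  refine ⟨fun ω => (limsup (fun n : ℕ => ENNReal.ofReal (l ((T : Ω → Ω)^[n] ω))) atTop).toReal,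
    ?_, fun ω => ENNReal.toReal_nonneg, fun ω => ?_, ?_⟩
  · exact (Measurable.limsup fun n =>
      (hl.comp (T.measurable.iterate n)).ennreal_ofReal).ennreal_toReal
  · simp only [← Function.iterate_succ_apply]
    rw [limsup_nat_add (fun n : ℕ => ENNReal.ofReal (l ((T : Ω → Ω)^[n] ω))) 1]
  · have h1 : ∀ n : ℕ, l ∘ (T : Ω → Ω)^[n] =ᵐ[μ] l := fun n => by
      induction n with
      | zero => rfl
      | succ n ih =>
        rw [Function.iterate_succ, ← Function.comp_assoc]
        exact (hTμ.quasiMeasurePreserving.ae_eq_comp ih).trans hinv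
    filter_upwards [ae_all_iff.2 h1] with ω hω
    simp only [Function.comp_apply] at hω
    simp only [hω, limsup_const]
    exact ENNReal.toReal_ofReal'

/-- The mean ergodic theorem in `L¹`, with an everywhere invariant limit. -/
theorem exists_invariant_limit (hTμ : MeasurePreserving T μ μ) {g : Ω → ℝ}
    (hg : Integrable g μ) (h0 : ∀ ω, 0 ≤ g ω) :
    ∃ η : Ω → ℝ, Measurable η ∧ (∀ ω, 0 ≤ η ω) ∧ (∀ ω, η (T ω) = η ω) ∧ Integrable η μ ∧
      Tendsto (fun n => eLpNorm (ergodicAverage T g n - η) 1 μ) atTop (𝓝 0) := by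
  obtain ⟨l, hlm, hli, hl⟩ := exists_tendsto_ergodicAverage hTμ hg h0
  obtain ⟨η, hηm, hη0, hηT, hηl⟩ :=
    exists_invariant_modification hTμ hlm (ae_eq_of_tendsto_ergodicAverage hTμ hg hli hl)
  refine ⟨η, hηm, hη0, hηT, hli.pos_part.congr hηl.symm, ?_⟩
  -- The averages are nonnegative, so replacing the limit by its positive part cannot increase the
  -- distance to them.
  refine tendsto_of_tendsto_of_tendsto_of_le_of_le tendsto_const_nhds hl (fun _ => zero_le)
    fun n => eLpNorm_mono_ae ?_
  filter_upwards [hηl] with ω hω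
  have hpos : 0 ≤ ergodicAverage T g n ω :=
    mul_nonneg (by positivity) (Finset.sum_nonneg fun i _ => h0 _)
  simp only [Pi.sub_apply, hω, Real.norm_eq_abs]
  calc _ = |max (ergodicAverage T g n ω) 0 - max (l ω) 0| := by rw [max_eq_left hpos]
    _ ≤ _ := abs_max_sub_max_le_abs _ _ _

end Ergodic

/-! ### The limit variance, its measurability, and conditional second moments. -/

section Variance

set_option linter.unusedSectionVars false

variable {Ω : Type*} {mΩ : MeasurableSpace Ω} {μ : Measure Ω} [IsProbabilityMeasure μ]
  {T : Ω ≃ᵐ Ω} {ℱ : Filtration ℕ mΩ} {D η : Ω → ℝ}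

lemma condExp_comp_iterate (hTμ : MeasurePreserving T μ μ)
    (hℱ : ∀ k, ℱ (k + 1) = (ℱ k).comap T) {g : Ω → ℝ} (hg : Integrable g μ) (n : ℕ) :
    μ[g ∘ (T : Ω → Ω)^[n] | ℱ n] =ᵐ[μ] μ[g | ℱ 0] ∘ (T : Ω → Ω)^[n] := by
  induction n with
  | zero => rfl
  | succ n ih =>
    rw [hℱ n, Function.iterate_succ, ← Function.comp_assoc]
    refine (condExp_comp_equiv hTμ (ℱ.le n) ((hTμ.iterate n).integrable_comp_of_integrable hg)).trans
      ?_
    exact hTμ.quasiMeasurePreserving.ae_eq_comp ih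

lemma comp_iterate_eq_of_invariant {T : Ω → Ω} (hη : ∀ ω, η (T ω) = η ω) (n : ℕ) :
    η ∘ T^[n] = η := by
  induction n with
  | zero => rfl
  | succ n ih => rw [Function.iterate_succ, ← Function.comp_assoc, ih]; exact funext hη

/-- Invariant limits of adapted ergodic averages are measurable at time `0`. -/
lemma aestronglyMeasurable_of_tendsto_ergodicAverage (hTμ : MeasurePreserving T μ μ)
    (hℱ : ∀ k, ℱ (k + 1) = (ℱ k).comap T) {g : Ω → ℝ} (hg : Integrable g μ)
    (hgm : ∀ n, StronglyMeasurable[ℱ n] (ergodicAverage T g n)) (hη : Integrable η μ)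
    (hηT : ∀ ω, η (T ω) = η ω)
    (hlim : Tendsto (fun n => eLpNorm (ergodicAverage T g n - η) 1 μ) atTop (𝓝 0)) :
    AEStronglyMeasurable[ℱ 0] η μ := by
  have hA : ∀ n, Integrable (ergodicAverage T g n) μ := fun n =>
    memLp_one_iff_integrable.1 (memLp_ergodicAverage hTμ (memLp_one_iff_integrable.2 hg) n)
  -- Invariance of `η` gives `𝔼_n η = (𝔼_0 η) ∘ T^n`, so the distance to the conditional expectation
  -- is the same at all times. At time `n` it is at most twice the distance to the `ℱ n`-measurable
  -- average.
  have h1 : ∀ n, eLpNorm (η - μ[η | ℱ 0]) 1 μ = eLpNorm (η - μ[η | ℱ n]) 1 μ := fun n => by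
    have h2 := condExp_comp_iterate hTμ hℱ hη n
    rw [comp_iterate_eq_of_invariant hηT n] at h2
    rw [← eLpNorm_comp_iterate hTμ (hη.sub integrable_condExp).1 n]
    refine eLpNorm_congr_ae ?_
    filter_upwards [h2] with ω hω
    have h3 := congrFun (comp_iterate_eq_of_invariant hηT n) ω
    simp only [Function.comp_apply] at h3 hω
    simp [hω, h3]
  have h0 : eLpNorm (η - μ[η | ℱ 0]) 1 μ = 0 := by
    have h4 : Tendsto (fun n => eLpNorm (ergodicAverage T g n - η) 1 μ +
        eLpNorm (ergodicAverage T g n - η) 1 μ) atTop (𝓝 0) := by simpa using hlim.add hlim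
    refine le_antisymm (ge_of_tendsto' h4 fun n => ?_) zero_le
    rw [h1 n]
    have e : η - μ[η | ℱ n] =ᵐ[μ] μ[ergodicAverage T g n - η | ℱ n] - (ergodicAverage T g n - η) := by
      filter_upwards [condExp_sub (hA n) hη (ℱ n)] with ω hω
      rw [condExp_of_stronglyMeasurable (ℱ.le n) (hgm n) (hA n)] at hω
      simp only [Pi.sub_apply] at hω ⊢
      rw [hω]; ring
    rw [eLpNorm_congr_ae e]
    refine (eLpNorm_sub_le integrable_condExp.1 ((hA n).sub hη).1 le_rfl).trans ?_
    gcongr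
    exact eLpNorm_condExp_le_eLpNorm _ le_rfl
  rw [eLpNorm_eq_zero_iff (hη.sub integrable_condExp).1 one_ne_zero] at h0
  refine ⟨μ[η | ℱ 0], stronglyMeasurable_condExp, ?_⟩
  filter_upwards [h0] with ω hω
  simpa [sub_eq_zero] using hω

/-- Each partial sum satisfies `S_j - S_j ∘ T = g - g ∘ T^j`; averaging over `j` solves the
cohomological equation up to the ergodic average. -/
lemma sub_comp_mean_partialSum (T : Ω → Ω) (g : Ω → ℝ) {n : ℕ} (hn : 0 < n) (ω : Ω) :
    (n : ℝ)⁻¹ * ∑ j ∈ Finset.range n, partialSum T g j ω -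
      (n : ℝ)⁻¹ * ∑ j ∈ Finset.range n, partialSum T g j (T ω) = g ω - ergodicAverage T g n ω := by
  have h1 : ∀ j, partialSum T g j ω - partialSum T g j (T ω) = g ω - g (T^[j] ω) := fun j => by
    have h1 := Finset.sum_range_succ (fun i => g (T^[i] ω)) j
    have h2 := Finset.sum_range_succ' (fun i => g (T^[i] ω)) j
    simp only [Function.iterate_zero, id] at h2
    simp only [partialSum, ← Function.iterate_succ_apply]
    linarith
  have hn' : (n : ℝ) ≠ 0 := by exact_mod_cast hn.ne'
  rw [← mul_sub, ← Finset.sum_sub_distrib, Finset.sum_congr rfl fun j _ => h1 j,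
    Finset.sum_sub_distrib, Finset.sum_const, Finset.card_range, nsmul_eq_mul, mul_sub, ← mul_assoc,
    inv_mul_cancel₀ hn', one_mul]
  rfl

/-- A centred stationary sequence is a coboundary up to a small error. -/
lemma exists_bounded_coboundary (hTμ : MeasurePreserving T μ μ) {g : Ω → ℝ} (hgm : Measurable g)
    (hg : Integrable g μ) (h0 : ∀ ω, 0 ≤ g ω) (hη : Integrable η μ)
    (hlim : Tendsto (fun n => eLpNorm (ergodicAverage T g n - η) 1 μ) atTop (𝓝 0))
    {ε : ℝ≥0∞} (hε : 0 < ε) :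
    ∃ h : Ω → ℝ, ∃ K : ℝ, Measurable h ∧ (∀ ω, |h ω| ≤ K) ∧
      eLpNorm (g - η - (h - h ∘ T)) 1 μ < ε := by
  have hg1 : MemLp g 1 μ := memLp_one_iff_integrable.2 hg
  have hε3 : 0 < ε / 3 := ENNReal.div_pos hε.ne' (by simp)
  obtain ⟨K, hK⟩ := ((tendsto_eLpNorm_sub_min hg h0).eventually (gt_mem_nhds hε3)).exists
  set gK : Ω → ℝ := fun ω => min (g ω) K with hgK
  have hgK1 : MemLp gK 1 μ := memLp_min hg h0 K 1
  obtain ⟨n, hn1, hn⟩ := ((hlim.eventually (gt_mem_nhds hε3)).and (eventually_gt_atTop 0)).exists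
  have hgKm : Measurable gK := hgm.min measurable_const
  -- The transfer function is the mean of the partial sums of the truncated `gK`. Truncation makes
  -- it bounded; `n` is chosen so that the average of `g` is already close to `η`.
  refine ⟨fun ω => (n : ℝ)⁻¹ * ∑ j ∈ Finset.range n, partialSum T gK j ω,
    (n : ℝ)⁻¹ * ∑ j ∈ Finset.range n, ∑ _i ∈ Finset.range j, (K : ℝ), ?_, fun ω => ?_, ?_⟩
  · refine Measurable.const_mul (Finset.measurable_sum _ fun j _ => ?_) _
    exact Finset.measurable_sum _ fun i _ => hgKm.comp (T.measurable.iterate i)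
  · rw [abs_mul, abs_of_nonneg (by positivity : (0 : ℝ) ≤ (n : ℝ)⁻¹)]
    gcongr
    refine (Finset.abs_sum_le_sum_abs _ _).trans (Finset.sum_le_sum fun j _ => ?_)
    refine (Finset.abs_sum_le_sum_abs _ _).trans (Finset.sum_le_sum fun i _ => ?_)
    rw [abs_of_nonneg (le_min (h0 _) K.cast_nonneg)]
    exact min_le_right _ _
  · have hA := memLp_ergodicAverage hTμ hg1 n
    have hC := memLp_ergodicAverage hTμ (hg1.sub hgK1) n
    have e : (g - η - ((fun ω => (n : ℝ)⁻¹ * ∑ j ∈ Finset.range n, partialSum T gK j ω) -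
        (fun ω => (n : ℝ)⁻¹ * ∑ j ∈ Finset.range n, partialSum T gK j ω) ∘ T)) =
        (g - gK) - ergodicAverage T (g - gK) n + (ergodicAverage T g n - η) := by
      rw [ergodicAverage_sub]
      ext ω
      simp only [Pi.sub_apply, Pi.add_apply, Function.comp_apply]
      rw [sub_comp_mean_partialSum T gK hn ω]
      ring
    rw [e]
    calc _ ≤ eLpNorm (g - gK - ergodicAverage T (g - gK) n) 1 μ +
            eLpNorm (ergodicAverage T g n - η) 1 μ :=
          eLpNorm_add_le ((hg.1.sub hgK1.1).sub hC.1) (hA.1.sub hη.1) le_rfl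
      _ ≤ (eLpNorm (g - gK) 1 μ + eLpNorm (ergodicAverage T (g - gK) n) 1 μ) +
            eLpNorm (ergodicAverage T g n - η) 1 μ := by
          gcongr
          exact eLpNorm_sub_le (hg.1.sub hgK1.1) hC.1 le_rfl
      _ < ε / 3 + ε / 3 + ε / 3 := by
          refine ENNReal.add_lt_add (ENNReal.add_lt_add hK ?_) hn1
          exact (eLpNorm_ergodicAverage_le hTμ (hg1.sub hgK1) n).trans_lt hK
      _ = ε := ENNReal.add_thirds ε

/-- `η` is the limit of the ergodic averages of the squared martingale differences. -/
structure IsLimitVariance (μ : Measure Ω) (T : Ω ≃ᵐ Ω) (ℱ : Filtration ℕ mΩ) (D η : Ω → ℝ) :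
    Prop where
  measurable : Measurable η
  nonneg : ∀ ω, 0 ≤ η ω
  invariant : ∀ ω, η (T ω) = η ω
  integrable : Integrable η μ
  tendsto : Tendsto (fun n => eLpNorm (ergodicAverage T (fun ω => D ω ^ 2) n - η) 1 μ) atTop (𝓝 0)
  aestronglyMeasurable : AEStronglyMeasurable[ℱ 0] η μ

theorem IsMartingaleDifference.exists_isLimitVariance (hD : IsMartingaleDifference μ ℱ D)
    (hTμ : MeasurePreserving T μ μ) (hℱ : ∀ k, ℱ (k + 1) = (ℱ k).comap T) :
    ∃ η, IsLimitVariance μ T ℱ D η := by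
  obtain ⟨η, h1, h2, h3, h4, h5⟩ := exists_invariant_limit hTμ hD.memLp.integrable_sq
    fun ω => sq_nonneg (D ω)
  refine ⟨η, h1, h2, h3, h4, h5, aestronglyMeasurable_of_tendsto_ergodicAverage hTμ hℱ
    hD.memLp.integrable_sq (fun n => ?_) h4 h3 h5⟩
  have h6 : StronglyMeasurable[ℱ n] (partialSum T (fun ω => D ω ^ 2) n) := by
    induction n with
    | zero => rw [partialSum_zero]; exact stronglyMeasurable_zero
    | succ n ih =>
      rw [partialSum_succ]
      exact (ih.mono (ℱ.mono n.le_succ)).add ((hD.stronglyMeasurable_comp hℱ n).pow 2)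
  exact h6.const_mul _

/-- The factor `V` is pulled out at time `j`, where the difference has conditional mean zero; the
tower property brings this down to time `k`. -/
lemma IsMartingaleDifference.condExp_mul_comp (hD : IsMartingaleDifference μ ℱ D)
    (hTμ : MeasurePreserving T μ μ) (hℱ : ∀ k, ℱ (k + 1) = (ℱ k).comap T) {j k : ℕ} (hkj : k ≤ j)
    {V : Ω → ℝ} (hV : AEStronglyMeasurable[ℱ j] V μ)
    (hVD : Integrable (V * D ∘ (T : Ω → Ω)^[j]) μ) :
    μ[V * D ∘ (T : Ω → Ω)^[j] | ℱ k] =ᵐ[μ] 0 := by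
  have h1 : μ[V * D ∘ (T : Ω → Ω)^[j] | ℱ j] =ᵐ[μ] 0 := by
    refine (condExp_mul_of_aestronglyMeasurable_left hV hVD
      ((memLp_comp_iterate hTμ hD.memLp j).integrable one_le_two)).trans ?_
    filter_upwards [hD.condExp_comp hTμ hℱ j] with ω hω
    simp [hω]
  refine (condExp_condExp_of_le (ℱ.mono hkj) (ℱ.le j)).symm.trans ?_
  refine (condExp_congr_ae h1).trans (Eq.eventuallyEq ?_)
  exact condExp_zero

/-- A martingale transform has a small conditional expectation. -/
lemma IsMartingaleDifference.eLpNorm_condExp_sum_le (hD : IsMartingaleDifference μ ℱ D)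
    (hTμ : MeasurePreserving T μ μ) (hℱ : ∀ k, ℱ (k + 1) = (ℱ k).comap T) {V : ℕ → Ω → ℝ}
    (hV : ∀ j, AEStronglyMeasurable[ℱ j] (V j) μ)
    (hVD : ∀ j, Integrable (V j * D ∘ (T : Ω → Ω)^[j]) μ) (n k : ℕ) :
    eLpNorm (μ[∑ j ∈ Finset.range n, V j * D ∘ (T : Ω → Ω)^[j] | ℱ k]) 1 μ ≤
      ∑ j ∈ Finset.range k, eLpNorm (V j * D ∘ (T : Ω → Ω)^[j]) 1 μ := by
  rw [eLpNorm_congr_ae (condExp_finsetSum (fun j _ => hVD j) (ℱ k))]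
  refine (eLpNorm_sum_le (fun j _ => integrable_condExp.1) le_rfl).trans ?_
  -- Only the terms with `j < k` survive conditioning on `ℱ k`, so the bound does not grow with `n`.
  have h1 : ∀ j, eLpNorm (μ[V j * D ∘ (T : Ω → Ω)^[j] | ℱ k]) 1 μ ≤
      if j < k then eLpNorm (V j * D ∘ (T : Ω → Ω)^[j]) 1 μ else 0 := fun j => by
    split_ifs with hj
    · exact eLpNorm_condExp_le_eLpNorm _ le_rfl
    · rw [eLpNorm_congr_ae (hD.condExp_mul_comp hTμ hℱ (not_lt.1 hj) (hV j) (hVD j)), eLpNorm_zero]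
  refine (Finset.sum_le_sum fun j _ => h1 j).trans ?_
  rw [← Finset.sum_filter]
  refine Finset.sum_le_sum_of_subset fun j hj => ?_
  simp only [Finset.mem_filter, Finset.mem_range] at hj ⊢
  exact hj.2

lemma sq_partialSum (T : Ω → Ω) (D : Ω → ℝ) (n : ℕ) :
    (fun ω => partialSum T D n ω ^ 2) = partialSum T (fun ω => D ω ^ 2) n +
      (2 : ℝ) • ∑ j ∈ Finset.range n, partialSum T D j * D ∘ T^[j] := by
  induction n with
  | zero => ext ω; simp [partialSum]
  | succ n ih =>
    ext ω
    have h := congrFun ih ω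
    rw [Finset.sum_range_succ, partialSum_succ, partialSum_succ]
    simp only [Pi.add_apply, Pi.smul_apply, Finset.sum_apply, Pi.mul_apply, Function.comp_apply,
      smul_eq_mul] at h ⊢
    linear_combination h

/-- Convergence of the conditional second moments of a stationary martingale. -/
theorem IsMartingaleDifference.tendsto_condExp_sq (hD : IsMartingaleDifference μ ℱ D)
    (hTμ : MeasurePreserving T μ μ) (hℱ : ∀ k, ℱ (k + 1) = (ℱ k).comap T)
    (hη : IsLimitVariance μ T ℱ D η) (k : ℕ) :
    Tendsto (fun n : ℕ => eLpNorm
      (μ[fun ω => (partialSum T D n ω / √n) ^ 2 | ℱ k] - η) 1 μ) atTop (𝓝 0) := by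
  have hM := memLp_partialSum hTμ hD.memLp
  have hVD : ∀ j, Integrable (partialSum T D j * D ∘ (T : Ω → Ω)^[j]) μ := fun j =>
    (hM j).integrable_mul (memLp_comp_iterate hTμ hD.memLp j)
  have hV : ∀ j, AEStronglyMeasurable[ℱ j] (partialSum T D j) μ := fun j =>
    (hD.stronglyMeasurable_partialSum hℱ j).aestronglyMeasurable
  set N : ℕ → Ω → ℝ := fun n => ∑ j ∈ Finset.range n, partialSum T D j * D ∘ (T : Ω → Ω)^[j] with hN
  have hNi : ∀ n, Integrable (N n) μ := fun n => integrable_finsetSum' _ fun j _ => hVD j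
  have hA : ∀ n, Integrable (ergodicAverage T (fun ω => D ω ^ 2) n) μ := fun n =>
    memLp_one_iff_integrable.1 (memLp_ergodicAverage hTμ
      (memLp_one_iff_integrable.2 hD.memLp.integrable_sq) n)
  set C := ∑ j ∈ Finset.range k, eLpNorm (partialSum T D j * D ∘ (T : Ω → Ω)^[j]) 1 μ with hC
  have hCtop : C ≠ ⊤ := by
    refine ENNReal.sum_ne_top.2 fun j _ => ?_
    exact (memLp_one_iff_integrable.2 (hVD j)).eLpNorm_ne_top
  -- The diagonal of the square is the ergodic average of `D²`. The off-diagonal part is a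
  -- martingale transform, whose conditional expectation is bounded by `C` before division by `n`.
  have hbound : ∀ n : ℕ, eLpNorm (μ[fun ω => (partialSum T D n ω / √n) ^ 2 | ℱ k] - η) 1 μ ≤
      eLpNorm (ergodicAverage T (fun ω => D ω ^ 2) n - η) 1 μ +
        ENNReal.ofReal (2 * (n : ℝ)⁻¹) * C := fun n => by
    have e1 : (fun ω => (partialSum T D n ω / √n) ^ 2) =
        ergodicAverage T (fun ω => D ω ^ 2) n + (2 * (n : ℝ)⁻¹) • N n := by
      ext ω
      have := congrFun (sq_partialSum T D n) ω
      simp only [Pi.add_apply, Pi.smul_apply, smul_eq_mul] at this ⊢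
      rw [div_pow, Real.sq_sqrt n.cast_nonneg, this, ergodicAverage]
      ring
    have e2 : μ[fun ω => (partialSum T D n ω / √n) ^ 2 | ℱ k] - η =ᵐ[μ]
        μ[ergodicAverage T (fun ω => D ω ^ 2) n - η | ℱ k] + (2 * (n : ℝ)⁻¹) • μ[N n | ℱ k] := by
      rw [e1]
      filter_upwards [condExp_add (hA n) ((hNi n).smul (2 * (n : ℝ)⁻¹)) (ℱ k),
        condExp_smul (μ := μ) (2 * (n : ℝ)⁻¹) (N n) (ℱ k),
        condExp_sub (hA n) hη.integrable (ℱ k),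
        condExp_of_aestronglyMeasurable' (ℱ.le k)
          (hη.aestronglyMeasurable.mono (ℱ.mono (Nat.zero_le k))) hη.integrable] with ω h1 h2 h3 h4
      simp only [Pi.add_apply, Pi.sub_apply] at h1 h2 h3 ⊢
      rw [h1, h2, h3, h4]
      ring
    rw [eLpNorm_congr_ae e2]
    refine (eLpNorm_add_le integrable_condExp.1 (integrable_condExp.1.const_smul _) le_rfl).trans ?_
    rw [eLpNorm_const_smul, Real.enorm_of_nonneg (by positivity)]
    gcongr
    · exact eLpNorm_condExp_le_eLpNorm _ le_rfl
    · exact hD.eLpNorm_condExp_sum_le hTμ hℱ hV hVD n k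
  have hz : Tendsto (fun n : ℕ => eLpNorm (ergodicAverage T (fun ω => D ω ^ 2) n - η) 1 μ +
        ENNReal.ofReal (2 * (n : ℝ)⁻¹) * C) atTop (𝓝 0) := by
    have h1 := ENNReal.Tendsto.mul_const (b := C)
      (ENNReal.tendsto_ofReal ((tendsto_inv_atTop_nhds_zero_nat (𝕜 := ℝ)).const_mul 2))
      (Or.inr hCtop)
    simpa using hη.tendsto.add h1
  exact tendsto_of_tendsto_of_tendsto_of_le_of_le tendsto_const_nhds hz (fun _ => zero_le) hbound

end Variance

/-! ### Deterministic Taylor estimates and the telescoping of cosines. -/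

section Taylor

/-- Both bounds are needed: the quadratic one supplies domination when only second moments exist,
the cubic one supplies pointwise decay. -/
lemma abs_cos_sub_taylor_le (y : ℝ) :
    |Real.cos y - 1 + y ^ 2 / 2| ≤ min (y ^ 2) (|y| ^ 3) := by
  have h1 := Real.one_sub_sq_div_two_le_cos (x := y)
  have h2 := Real.cos_le_one y
  rw [abs_of_nonneg (by linarith), le_min_iff]
  refine ⟨by nlinarith [sq_nonneg y], ?_⟩
  rcases le_or_gt |y| 1 with hy | hy
  · have h3 := (abs_le.1 (Real.cos_bound hy)).2
    have h4 : |y| ^ 4 ≤ |y| ^ 3 := pow_le_pow_of_le_one (abs_nonneg y) hy (by norm_num)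
    nlinarith [pow_nonneg (abs_nonneg y) 3]
  · have h4 : |y| ^ 2 ≤ |y| ^ 3 := pow_le_pow_right₀ hy.le (by norm_num)
    rw [sq_abs] at h4
    nlinarith [sq_nonneg y]

lemma abs_sin_sub_taylor_le (y : ℝ) : |Real.sin y - y| ≤ 2 * min (y ^ 2) (|y| ^ 3) := by
  rw [mul_min_of_nonneg _ _ zero_le_two, le_min_iff]
  rcases le_or_gt |y| 1 with hy | hy
  · have h3 := Real.sin_bound hy
    have h4 : |y| ^ 5 ≤ |y| ^ 3 := pow_le_pow_of_le_one (abs_nonneg y) hy (by norm_num)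
    have h5 : |y| ^ 3 ≤ |y| ^ 2 := pow_le_pow_of_le_one (abs_nonneg y) hy (by norm_num)
    have h6 : |Real.sin y - y| ≤ |Real.sin y - (y - y ^ 3 / 6)| + |y| ^ 3 / 6 := by
      have : Real.sin y - y = (Real.sin y - (y - y ^ 3 / 6)) + -(y ^ 3 / 6) := by ring
      rw [this]
      refine (abs_add_le _ _).trans ?_
      rw [abs_neg, abs_div, abs_pow, abs_of_pos (by norm_num : (0 : ℝ) < 6)]
    have h7 : 0 ≤ |y| ^ 3 := by positivity
    rw [sq_abs] at h5
    exact ⟨by linarith, by linarith⟩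
  · have h3 : |Real.sin y - y| ≤ 2 * |y| := by
      have h4 : |Real.sin y| ≤ |y| := Real.abs_sin_le_abs
      calc _ ≤ |Real.sin y| + |y| := abs_sub _ _
        _ ≤ _ := by linarith
    have h4 : |y| ^ 1 ≤ |y| ^ 2 := pow_le_pow_right₀ hy.le (by norm_num)
    have h5 : |y| ^ 1 ≤ |y| ^ 3 := pow_le_pow_right₀ hy.le (by norm_num)
    rw [sq_abs] at h4
    rw [pow_one] at h4 h5
    exact ⟨by linarith, by linarith⟩

/-- Bound for the remainder in the second order expansion of a cosine. -/
def taylorError (y : ℝ) : ℝ := 3 * min (y ^ 2) (|y| ^ 3)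

lemma continuous_taylorError : Continuous taylorError := by
  unfold taylorError; fun_prop

lemma taylorError_nonneg (y : ℝ) : 0 ≤ taylorError y := by
  unfold taylorError; positivity

lemma abs_cos_add_sub_taylor_le (a y : ℝ) :
    |Real.cos (a + y) - Real.cos a + y * Real.sin a + y ^ 2 / 2 * Real.cos a| ≤ taylorError y := by
  have e : Real.cos (a + y) - Real.cos a + y * Real.sin a + y ^ 2 / 2 * Real.cos a =
      Real.cos a * (Real.cos y - 1 + y ^ 2 / 2) - Real.sin a * (Real.sin y - y) := by
    rw [Real.cos_add]; ring
  rw [e]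
  refine (abs_sub _ _).trans ?_
  rw [abs_mul, abs_mul, taylorError]
  have h1 := mul_le_mul (Real.abs_cos_le_one a) (abs_cos_sub_taylor_le y) (abs_nonneg _) zero_le_one
  have h2 := mul_le_mul (Real.abs_sin_le_one a) (abs_sin_sub_taylor_le y) (abs_nonneg _) zero_le_one
  linarith

/-- The remainder in the first order expansion of `exp (-s)`. -/
def expError (s : ℝ) : ℝ := Real.exp (-s) - 1 + s

lemma continuous_expError : Continuous expError := by
  unfold expError; fun_prop

lemma expError_nonneg (s : ℝ) : 0 ≤ expError s := by
  have := Real.add_one_le_exp (-s)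
  unfold expError; linarith

lemma expError_le {s : ℝ} (hs : 0 ≤ s) : expError s ≤ s := by
  have : Real.exp (-s) ≤ 1 := Real.exp_le_one_iff.2 (by linarith)
  unfold expError; linarith

lemma expError_le_sq {s : ℝ} (hs : 0 ≤ s) : expError s ≤ s ^ 2 := by
  rcases le_or_gt s 1 with h | h
  · have := (abs_le.1 (Real.abs_exp_sub_one_sub_id_le (x := -s) (by rwa [abs_neg, abs_of_nonneg hs]))).2
    unfold expError; nlinarith
  · exact (expError_le hs).trans (by nlinarith)

/-- Summation by parts. -/
lemma abs_sum_mul_sub_le {V h δ : ℕ → ℝ} {K : ℝ} (hV : ∀ j, |V j| ≤ 1)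
    (hδ : ∀ j, |V (j + 1) - V j| ≤ δ j) (hh : ∀ j, |h j| ≤ K) (n : ℕ) :
    |∑ j ∈ Finset.range n, V j * (h j - h (j + 1))| ≤ K * (2 + ∑ j ∈ Finset.range n, δ j) := by
  have hK : 0 ≤ K := (abs_nonneg _).trans (hh 0)
  have e : ∑ j ∈ Finset.range n, V j * (h j - h (j + 1)) =
      V 0 * h 0 - V n * h n + ∑ j ∈ Finset.range n, (V (j + 1) - V j) * h (j + 1) := by
    induction n with
    | zero => simp
    | succ n ih => rw [Finset.sum_range_succ, ih, Finset.sum_range_succ]; ring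
  have hb : ∀ j, |V j * h j| ≤ K := fun j => by
    rw [abs_mul]
    calc _ ≤ 1 * K := mul_le_mul (hV j) (hh j) (abs_nonneg _) zero_le_one
      _ = K := one_mul K
  rw [e]
  calc _ ≤ |V 0 * h 0 - V n * h n| + |∑ j ∈ Finset.range n, (V (j + 1) - V j) * h (j + 1)| :=
        abs_add_le _ _
    _ ≤ (K + K) + ∑ j ∈ Finset.range n, δ j * K := by
        refine add_le_add ((abs_sub _ _).trans (add_le_add (hb 0) (hb n))) ?_
        refine (Finset.abs_sum_le_sum_abs _ _).trans (Finset.sum_le_sum fun j _ => ?_)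
        rw [abs_mul]
        exact mul_le_mul (hδ j) (hh _) (abs_nonneg _) ((abs_nonneg _).trans (hδ j))
    _ = _ := by rw [← Finset.sum_mul]; ring

/-- Telescoping expansion of `cos (a n) - cos (a 0) * exp (-n s)`. -/
lemma abs_cos_telescope_le {a d h e : ℕ → ℝ} {s c K : ℝ} (hs : 0 ≤ s) (hc : 0 ≤ c)
    (hh : ∀ j, |h j| ≤ K)
    (hd : ∀ j, (a (j + 1) - a j) ^ 2 / 2 - s = c * (h j - h (j + 1) + e j))
    (hda : ∀ j, a (j + 1) - a j = d j) (n : ℕ) :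
    |Real.cos (a n) - Real.cos (a 0) * Real.exp (-(s * n)) +
        ∑ j ∈ Finset.range n, Real.exp (-(s * (n - (j + 1) : ℕ))) * Real.sin (a j) * d j| ≤
      c * (K * (2 + ∑ j ∈ Finset.range n, (|d j| + s)) + ∑ j ∈ Finset.range n, |e j|) +
        ∑ j ∈ Finset.range n, (taylorError (d j) + expError s) := by
  -- The weight compensates the expected decay of the cosine in the remaining `n - j` steps. Natural
  -- subtraction is truncated, so `G j = 1` for `j ≥ n` and the increment bound holds for all `j`.
  set G : ℕ → ℝ := fun j => Real.exp (-(s * (n - j : ℕ))) with hG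
  have hG0 : ∀ j, 0 ≤ G j := fun j => (Real.exp_pos _).le
  have hG1 : ∀ j, G j ≤ 1 := fun j => Real.exp_le_one_iff.2 (by
    have : 0 ≤ s * (n - j : ℕ) := by positivity
    linarith)
  have hGstep : ∀ j, j < n → G j = G (j + 1) * Real.exp (-s) := fun j hj => by
    simp only [hG]
    rw [← Real.exp_add]
    congr 1
    have : ((n - j : ℕ) : ℝ) = ((n - (j + 1) : ℕ) : ℝ) + 1 := by
      exact_mod_cast (by omega : n - j = n - (j + 1) + 1)
    rw [this]; ring
  have hGd : ∀ j, |G (j + 1) - G j| ≤ s := fun j => by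
    rcases lt_or_ge j n with hj | hj
    · rw [hGstep j hj]
      have h1 := Real.add_one_le_exp (-s)
      have h2 : Real.exp (-s) ≤ 1 := Real.exp_le_one_iff.2 (by linarith)
      have h3 := hG0 (j + 1)
      have h4 := hG1 (j + 1)
      rw [abs_of_nonneg (by nlinarith)]
      nlinarith
    · have h1 : n - j = 0 := by omega
      have h2 : n - (j + 1) = 0 := by omega
      simp [hG, h1, h2, hs]
  set V : ℕ → ℝ := fun j => G (j + 1) * Real.cos (a j) with hV
  have hV1 : ∀ j, |V j| ≤ 1 := fun j => by
    rw [abs_mul, abs_of_nonneg (hG0 _)]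
    calc _ ≤ 1 * 1 := mul_le_mul (hG1 _) (Real.abs_cos_le_one _) (abs_nonneg _) zero_le_one
      _ = 1 := one_mul 1
  have hcos : ∀ x y : ℝ, |Real.cos x - Real.cos y| ≤ |x - y| := Real.abs_cos_sub_cos_le
  have hVd : ∀ j, |V (j + 1) - V j| ≤ |d j| + s := fun j => by
    have e1 : V (j + 1) - V j = G (j + 2) * (Real.cos (a (j + 1)) - Real.cos (a j)) +
        (G (j + 2) - G (j + 1)) * Real.cos (a j) := by simp only [hV]; ring
    rw [e1]
    refine (abs_add_le _ _).trans (add_le_add ?_ ?_)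
    · rw [abs_mul, abs_of_nonneg (hG0 _), ← hda]
      calc _ ≤ 1 * |a (j + 1) - a j| :=
            mul_le_mul (hG1 _) (hcos _ _) (abs_nonneg _) zero_le_one
        _ = _ := one_mul _
    · rw [abs_mul]
      calc _ ≤ s * 1 := mul_le_mul (hGd _) (Real.abs_cos_le_one _) (abs_nonneg _) hs
        _ = s := mul_one s
  set ρ : ℕ → ℝ := fun j => Real.cos (a j + d j) - Real.cos (a j) + d j * Real.sin (a j) +
    d j ^ 2 / 2 * Real.cos (a j) with hρ
  have htel : Real.cos (a n) - Real.cos (a 0) * Real.exp (-(s * n)) =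
      ∑ j ∈ Finset.range n, (Real.cos (a (j + 1)) * G (j + 1) - Real.cos (a j) * G j) := by
    rw [Finset.sum_range_sub (fun j => Real.cos (a j) * G j)]
    simp [hG]
  -- The drift `d²/2` of the cosine is matched against the drift `s` of the exponential weight.
  -- Their difference is the coboundary plus `e`, by `hd`; only Taylor remainders are left.
  have hterm : ∀ j ∈ Finset.range n, Real.cos (a (j + 1)) * G (j + 1) - Real.cos (a j) * G j =
      -(G (j + 1) * Real.sin (a j) * d j) - c * (V j * (h j - h (j + 1))) - c * (V j * e j) +
        G (j + 1) * (ρ j - Real.cos (a j) * expError s) := fun j hj => by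
    have h1 : a (j + 1) = a j + d j := by rw [← hda]; ring
    have h2 := hd j
    rw [hda] at h2
    have h3 : c * (V j * (h j - h (j + 1))) + c * (V j * e j) = V j * (d j ^ 2 / 2 - s) := by
      rw [h2]; ring
    rw [hGstep j (Finset.mem_range.1 hj), h1]
    simp only [hρ, expError]
    simp only [hV] at h3 ⊢
    linear_combination h3
  have hfinal : Real.cos (a n) - Real.cos (a 0) * Real.exp (-(s * n)) +
        ∑ j ∈ Finset.range n, G (j + 1) * Real.sin (a j) * d j =
      -(c * ∑ j ∈ Finset.range n, V j * (h j - h (j + 1))) - c * ∑ j ∈ Finset.range n, V j * e j +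
        ∑ j ∈ Finset.range n, G (j + 1) * (ρ j - Real.cos (a j) * expError s) := by
    rw [htel, Finset.sum_congr rfl hterm, Finset.sum_add_distrib, Finset.sum_sub_distrib,
      Finset.sum_sub_distrib, Finset.sum_neg_distrib, Finset.mul_sum, Finset.mul_sum]
    ring
  have hb1 := abs_sum_mul_sub_le hV1 hVd hh n
  have hb2 : |∑ j ∈ Finset.range n, V j * e j| ≤ ∑ j ∈ Finset.range n, |e j| := by
    refine (Finset.abs_sum_le_sum_abs _ _).trans (Finset.sum_le_sum fun j _ => ?_)
    rw [abs_mul]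
    exact mul_le_of_le_one_left (abs_nonneg _) (hV1 j)
  have hb3 : |∑ j ∈ Finset.range n, G (j + 1) * (ρ j - Real.cos (a j) * expError s)| ≤
      ∑ j ∈ Finset.range n, (taylorError (d j) + expError s) := by
    refine (Finset.abs_sum_le_sum_abs _ _).trans (Finset.sum_le_sum fun j _ => ?_)
    rw [abs_mul, abs_of_nonneg (hG0 _)]
    refine (mul_le_of_le_one_left (abs_nonneg _) (hG1 _)).trans ((abs_sub _ _).trans ?_)
    refine add_le_add (abs_cos_add_sub_taylor_le _ _) ?_
    rw [abs_mul, abs_of_nonneg (expError_nonneg s)]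
    exact mul_le_of_le_one_left (expError_nonneg s) (Real.abs_cos_le_one _)
  change |Real.cos (a n) - Real.cos (a 0) * Real.exp (-(s * n)) +
        ∑ j ∈ Finset.range n, G (j + 1) * Real.sin (a j) * d j| ≤ _
  rw [hfinal]
  calc _ ≤ |-(c * ∑ j ∈ Finset.range n, V j * (h j - h (j + 1))) -
          c * ∑ j ∈ Finset.range n, V j * e j| + _ := abs_add_le _ _
    _ ≤ (|-(c * ∑ j ∈ Finset.range n, V j * (h j - h (j + 1)))| +
          |c * ∑ j ∈ Finset.range n, V j * e j|) + _ := by gcongr; exact abs_sub _ _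
    _ ≤ _ := by
      rw [abs_neg, abs_mul, abs_mul, abs_of_nonneg hc, mul_add]
      gcongr

end Taylor

/-! ### Conditional convergence of cosines for stationary martingales. -/

section Cosine

set_option linter.unusedSectionVars false

variable {Ω : Type*} {mΩ : MeasurableSpace Ω} {μ : Measure Ω} [IsProbabilityMeasure μ]
  {T : Ω ≃ᵐ Ω} {ℱ : Filtration ℕ mΩ} {D η : Ω → ℝ}

lemma ennreal_tendsto_zero_of_forall_real {u : ℕ → ℝ≥0∞}
    (h : ∀ δ : ℝ, 0 < δ → ∀ᶠ n in atTop, u n ≤ ENNReal.ofReal δ) : Tendsto u atTop (𝓝 0) := by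
  rw [ENNReal.tendsto_nhds_zero]
  intro ε hε
  have h1 : min ε 1 ≠ ⊤ := (min_le_right _ _).trans_lt ENNReal.one_lt_top |>.ne
  have h2 : 0 < min ε 1 := lt_min hε one_pos
  filter_upwards [h (min ε 1).toReal (ENNReal.toReal_pos h2.ne' h1)] with n hn
  rw [ENNReal.ofReal_toReal h1] at hn
  exact hn.trans (min_le_left _ _)

lemma eLpNorm_one_le_ofReal_integral {X B : Ω → ℝ} (hB : Integrable B μ)
    (h : ∀ ω, |X ω| ≤ B ω) : eLpNorm X 1 μ ≤ ENNReal.ofReal (∫ ω, B ω ∂μ) := by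
  rw [eLpNorm_one_eq_lintegral_enorm,
    ofReal_integral_eq_lintegral_ofReal hB (ae_of_all _ fun ω => (abs_nonneg _).trans (h ω))]
  refine lintegral_mono fun ω => ?_
  rw [← ofReal_norm, Real.norm_eq_abs]
  exact ENNReal.ofReal_le_ofReal (h ω)

lemma eLpNorm_one_eq_ofReal_integral {X : Ω → ℝ} (hX : Integrable X μ) :
    eLpNorm X 1 μ = ENNReal.ofReal (∫ ω, |X ω| ∂μ) := by
  rw [eLpNorm_one_eq_lintegral_enorm,
    ofReal_integral_eq_lintegral_ofReal hX.abs (ae_of_all _ fun ω => abs_nonneg _)]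
  refine lintegral_congr fun ω => ?_
  rw [← ofReal_norm, Real.norm_eq_abs]

lemma integrable_partialSum (hTμ : MeasurePreserving T μ μ) {Z : Ω → ℝ} (hZ : Integrable Z μ)
    (n : ℕ) : Integrable (partialSum T Z n) μ :=
  memLp_one_iff_integrable.1 (memLp_partialSum hTμ (memLp_one_iff_integrable.2 hZ) n)

lemma integral_partialSum (hTμ : MeasurePreserving T μ μ) {Z : Ω → ℝ} (hZ : Integrable Z μ)
    (n : ℕ) : ∫ ω, partialSum T Z n ω ∂μ = n * ∫ ω, Z ω ∂μ := by
  induction n with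
  | zero => simp [partialSum]
  | succ n ih =>
    have h1 : ∫ ω, (Z ∘ (T : Ω → Ω)^[n]) ω ∂μ = ∫ ω, Z ω ∂μ := by
      have h2 := integral_map (hTμ.iterate n).measurable.aemeasurable
        (f := Z) (by rw [(hTμ.iterate n).map_eq]; exact hZ.1)
      rw [(hTμ.iterate n).map_eq] at h2
      exact h2.symm
    rw [partialSum_succ, integral_add' (integrable_partialSum hTμ hZ n)
      ((hTμ.iterate n).integrable_comp_of_integrable hZ), ih, h1]
    push_cast
    ring

lemma integrable_taylorError {Z : Ω → ℝ} (hZ : MemLp Z 2 μ) :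
    Integrable (fun ω => taylorError (Z ω)) μ := by
  refine (hZ.integrable_sq.const_mul 3).mono' (continuous_taylorError.comp_aestronglyMeasurable hZ.1)
    (ae_of_all _ fun ω => ?_)
  rw [Real.norm_of_nonneg (taylorError_nonneg _), taylorError]
  gcongr
  exact min_le_left _ _

lemma integrable_expError {Z : Ω → ℝ} (hZ : Integrable Z μ) (h0 : ∀ ω, 0 ≤ Z ω) :
    Integrable (fun ω => expError (Z ω)) μ := by
  refine hZ.mono' (continuous_expError.comp_aestronglyMeasurable hZ.1) (ae_of_all _ fun ω => ?_)
  rw [Real.norm_of_nonneg (expError_nonneg _)]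
  exact expError_le (h0 ω)

/-- Dominated convergence replaces a Lindeberg condition: the quadratic bound dominates by `3 t²
D²`, and the cubic bound gives pointwise decay of order `n^{-1/2}`. -/
lemma tendsto_integral_taylorError {D : Ω → ℝ} (hD : MemLp D 2 μ) (t : ℝ) :
    Tendsto (fun n : ℕ => (n : ℝ) * ∫ ω, taylorError (t / √n * D ω) ∂μ) atTop (𝓝 0) := by
  have h := tendsto_integral_of_dominated_convergence (μ := μ)
    (F := fun (n : ℕ) ω => (n : ℝ) * taylorError (t / √n * D ω)) (f := fun _ => (0 : ℝ))
    (fun ω => 3 * t ^ 2 * D ω ^ 2)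
    (fun n => ((integrable_taylorError (hD.const_mul _)).const_mul _).1)
    (hD.integrable_sq.const_mul _) (fun n => ae_of_all _ fun ω => ?_) (ae_of_all _ fun ω => ?_)
  · simpa [integral_const_mul] using h
  · rw [Real.norm_of_nonneg (mul_nonneg n.cast_nonneg (taylorError_nonneg _)), taylorError]
    rcases Nat.eq_zero_or_pos n with rfl | hn
    · simp; positivity
    · have hn' : (0 : ℝ) < n := by exact_mod_cast hn
      calc _ ≤ (n : ℝ) * (3 * (t / √n * D ω) ^ 2) := by gcongr; exact min_le_left _ _
        _ = _ := by rw [mul_pow, div_pow, Real.sq_sqrt hn'.le]; field_simp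
  · have h1 : Tendsto (fun n : ℕ => 3 * |t * D ω| ^ 3 / √n) atTop (𝓝 0) :=
      Tendsto.const_div_atTop
        (Real.tendsto_sqrt_atTop.comp tendsto_natCast_atTop_atTop) _
    refine squeeze_zero (fun n => mul_nonneg n.cast_nonneg (taylorError_nonneg _)) (fun n => ?_) h1
    rcases Nat.eq_zero_or_pos n with rfl | hn
    · simp
    · have hn' : (0 : ℝ) < n := by exact_mod_cast hn
      have hs : 0 < √(n : ℝ) := Real.sqrt_pos.2 hn'
      rw [taylorError]
      calc _ ≤ (n : ℝ) * (3 * |t / √n * D ω| ^ 3) := by gcongr; exact min_le_right _ _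
        _ = (√n) ^ 2 * (3 * |t / √n * D ω| ^ 3) := by rw [Real.sq_sqrt hn'.le]
        _ = _ := by
          have : t / √n * D ω = t * D ω / √n := by ring
          rw [this, abs_div, abs_of_pos hs, div_pow]
          field_simp

lemma tendsto_integral_expError {η : Ω → ℝ} (hη : Integrable η μ) (h0 : ∀ ω, 0 ≤ η ω) (t : ℝ) :
    Tendsto (fun n : ℕ => (n : ℝ) * ∫ ω, expError (t ^ 2 / (2 * n) * η ω) ∂μ) atTop (𝓝 0) := by
  have hs : ∀ (n : ℕ) ω, 0 ≤ t ^ 2 / (2 * n) * η ω := fun n ω => by have := h0 ω; positivity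
  have h := tendsto_integral_of_dominated_convergence (μ := μ)
    (F := fun (n : ℕ) ω => (n : ℝ) * expError (t ^ 2 / (2 * n) * η ω)) (f := fun _ => (0 : ℝ))
    (fun ω => t ^ 2 / 2 * η ω)
    (fun n => ((integrable_expError (hη.const_mul _) (hs n)).const_mul _).1)
    (hη.const_mul _) (fun n => ae_of_all _ fun ω => ?_) (ae_of_all _ fun ω => ?_)
  · simpa [integral_const_mul] using h
  · rw [Real.norm_of_nonneg (mul_nonneg n.cast_nonneg (expError_nonneg _))]
    rcases Nat.eq_zero_or_pos n with rfl | hn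
    · have := h0 ω
      simp only [Nat.cast_zero, zero_mul]; positivity
    · have hn' : (0 : ℝ) < n := by exact_mod_cast hn
      calc _ ≤ (n : ℝ) * (t ^ 2 / (2 * n) * η ω) := by gcongr; exact expError_le (hs n ω)
        _ = _ := by field_simp
  · have h1 : Tendsto (fun n : ℕ => (t ^ 2 / 2 * η ω) ^ 2 / (n : ℝ)) atTop (𝓝 0) :=
      tendsto_const_div_atTop_nhds_zero_nat _
    refine squeeze_zero (fun n => mul_nonneg n.cast_nonneg (expError_nonneg _)) (fun n => ?_) h1
    rcases Nat.eq_zero_or_pos n with rfl | hn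
    · simp
    · have hn' : (0 : ℝ) < n := by exact_mod_cast hn
      calc _ ≤ (n : ℝ) * (t ^ 2 / (2 * n) * η ω) ^ 2 := by gcongr; exact expError_le_sq (hs n ω)
        _ = _ := by field_simp

/-- Conditional cosine transforms of a stationary martingale: the bound at time `n`. -/
lemma IsMartingaleDifference.eLpNorm_condExp_cos_sub_le (hD : IsMartingaleDifference μ ℱ D)
    (hTμ : MeasurePreserving T μ μ) (hℱ : ∀ k, ℱ (k + 1) = (ℱ k).comap T)
    (hη : IsLimitVariance μ T ℱ D η) {h : Ω → ℝ} {K : ℝ} (hhm : Measurable h)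
    (hhK : ∀ ω, |h ω| ≤ K) (t φ : ℝ) (k : ℕ) {n : ℕ} (hn : 0 < n) :
    eLpNorm (μ[fun ω => Real.cos (t * (partialSum T D n ω / √n) + φ) | ℱ k] -
        fun ω => Real.cos φ * Real.exp (-(t ^ 2 * η ω / 2))) 1 μ ≤
      ENNReal.ofReal (t ^ 2 * K / n + t ^ 2 / 2 * (K * (|t| / √n * ∫ ω, |D ω| ∂μ +
          t ^ 2 / (2 * n) * ∫ ω, η ω ∂μ) + ∫ ω, |D ω ^ 2 - η ω - (h ω - h (T ω))| ∂μ) +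
        (n * ∫ ω, taylorError (t / √n * D ω) ∂μ + n * ∫ ω, expError (t ^ 2 / (2 * n) * η ω) ∂μ)) +
      ENNReal.ofReal (k * (|t| / √n * ∫ ω, |D ω| ∂μ)) := by
  have hn' : (0 : ℝ) < n := by exact_mod_cast hn
  have hs' : 0 < √(n : ℝ) := Real.sqrt_pos.2 hn'
  have hD1 : Integrable D μ := hD.memLp.integrable one_le_two
  set e : Ω → ℝ := fun ω => D ω ^ 2 - η ω - (h ω - h (T ω)) with he
  set c : ℝ := t ^ 2 / (2 * n) with hc
  have hc0 : 0 ≤ c := by positivity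
  set s : Ω → ℝ := fun ω => c * η ω with hs
  have hs0 : ∀ ω, 0 ≤ s ω := fun ω => mul_nonneg hc0 (hη.nonneg ω)
  set Y : Ω → ℝ := fun ω => t / √n * D ω with hY
  have hhb : ∀ f : Ω → Ω, Measurable f → Integrable (fun ω => h (f ω)) μ := fun f hf =>
    Integrable.of_bound (hhm.comp hf).aestronglyMeasurable K (ae_of_all _ fun ω => hhK _)
  have hei : Integrable e μ := (hD.memLp.integrable_sq.sub hη.integrable).sub
    ((hhb _ measurable_id).sub (hhb _ T.measurable))
  have hsi : Integrable s μ := hη.integrable.const_mul c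
  have hYi : Integrable Y μ := hD1.const_mul _
  have hY2 : MemLp Y 2 μ := hD.memLp.const_mul _
  have hsT : ∀ (j : ℕ) ω, s ((T : Ω → Ω)^[j] ω) = s ω := fun j ω => by
    have := congrFun (comp_iterate_eq_of_invariant hη.invariant j) ω
    simp only [Function.comp_apply] at this
    simp only [hs, this]
  set a : ℕ → Ω → ℝ := fun j ω => t * (partialSum T D j ω / √n) + φ with ha
  set V : ℕ → Ω → ℝ := fun j ω =>
    Real.exp (-(s ω * (n - (j + 1) : ℕ))) * Real.sin (a j ω) * (t / √n) with hV
  set N : Ω → ℝ := ∑ j ∈ Finset.range n, V j * D ∘ (T : Ω → Ω)^[j] with hN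
  -- The coefficients are predictable although they involve the limit `η`, because `η` is already
  -- measurable at time 0.
  have hVm : ∀ j, AEStronglyMeasurable[ℱ j] (V j) μ := fun j => by
    have h1 : AEStronglyMeasurable[ℱ j] η μ :=
      hη.aestronglyMeasurable.mono (ℱ.mono (Nat.zero_le j))
    have h2 : AEStronglyMeasurable[ℱ j] (partialSum T D j) μ :=
      (hD.stronglyMeasurable_partialSum hℱ j).aestronglyMeasurable
    have h3 : Continuous fun x : ℝ => Real.exp (-(c * x * (n - (j + 1) : ℕ))) := by fun_prop
    have h4 : Continuous fun x : ℝ => Real.sin (t * (x / √n) + φ) := by fun_prop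
    exact ((h3.comp_aestronglyMeasurable h1).mul (h4.comp_aestronglyMeasurable h2)).mul_const _
  have hVb : ∀ j ω, |V j ω| ≤ |t| / √n := fun j ω => by
    simp only [hV]
    rw [abs_mul, abs_mul, Real.abs_exp, abs_div, abs_of_pos hs']
    have h1 : Real.exp (-(s ω * (n - (j + 1) : ℕ))) ≤ 1 := Real.exp_le_one_iff.2 (by
      have := mul_nonneg (hs0 ω) (Nat.cast_nonneg (α := ℝ) (n - (j + 1)))
      linarith)
    have h2 := mul_le_mul h1 (Real.abs_sin_le_one (a j ω)) (abs_nonneg _) zero_le_one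
    rw [mul_one] at h2
    exact mul_le_of_le_one_left (by positivity) h2
  have hDj : ∀ j, Integrable (D ∘ (T : Ω → Ω)^[j]) μ := fun j =>
    (hTμ.iterate j).integrable_comp_of_integrable hD1
  have hVD : ∀ j, Integrable (V j * D ∘ (T : Ω → Ω)^[j]) μ := fun j =>
    (hDj j).bdd_mul ((hVm j).mono (ℱ.le j)) (ae_of_all _ fun ω => hVb j ω)
  have hNi : Integrable N μ := integrable_finsetSum' _ fun j _ => hVD j
  set Z : Ω → ℝ := fun ω =>
    c * (K * (|Y ω| + s ω) + |e ω|) + (taylorError (Y ω) + expError (s ω)) with hZ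
  have hZi : Integrable Z μ :=
    ((((hYi.abs.add hsi).const_mul K).add hei.abs).const_mul c).add
      ((integrable_taylorError hY2).add (integrable_expError hsi hs0))
  -- The pointwise bound is a boundary constant from summation by parts plus a stationary sum, whose
  -- integral is `n ∫ Z`.
  set B : Ω → ℝ := fun ω => 2 * c * K + partialSum T Z n ω with hB
  have hBi : Integrable B μ := (integrable_const _).add (integrable_partialSum hTμ hZi n)
  set F : Ω → ℝ := fun ω => Real.cos (a n ω) with hF
  set L : Ω → ℝ := fun ω => Real.cos φ * Real.exp (-(t ^ 2 * η ω / 2)) with hL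
  have hFi : Integrable F μ := by
    have h4 : Continuous fun x : ℝ => Real.cos (t * (x / √n) + φ) := by fun_prop
    exact Integrable.of_bound (h4.comp_aestronglyMeasurable
      (integrable_partialSum hTμ hD1 n).1) 1 (ae_of_all _ fun ω => Real.abs_cos_le_one _)
  have hLc : Continuous fun x : ℝ => Real.cos φ * Real.exp (-(t ^ 2 * x / 2)) := by fun_prop
  have hLi : Integrable L μ := by
    refine Integrable.of_bound (hLc.comp_aestronglyMeasurable hη.integrable.1) 1
      (ae_of_all _ fun ω => ?_)
    rw [Real.norm_eq_abs, abs_mul, Real.abs_exp]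
    have h1 : Real.exp (-(t ^ 2 * η ω / 2)) ≤ 1 := Real.exp_le_one_iff.2 (by
      have := mul_nonneg (sq_nonneg t) (hη.nonneg ω)
      linarith)
    exact mul_le_one₀ (Real.abs_cos_le_one _) (Real.exp_pos _).le h1
  have hLm : AEStronglyMeasurable[ℱ k] L μ := hLc.comp_aestronglyMeasurable
    (hη.aestronglyMeasurable.mono (ℱ.mono (Nat.zero_le k)))
  have hpt : ∀ ω, |(F - L + N) ω| ≤ B ω := fun ω => by
    have h1 := abs_cos_telescope_le (a := fun j => a j ω) (d := fun j => Y ((T : Ω → Ω)^[j] ω))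
      (h := fun j => h ((T : Ω → Ω)^[j] ω)) (e := fun j => e ((T : Ω → Ω)^[j] ω)) (s := s ω)
      (c := c) (K := K) (hs0 ω) hc0 (fun j => hhK _) (fun j => ?_) (fun j => ?_) n
    · have e1 : a 0 ω = φ := by simp [ha, partialSum]
      have e2 : s ω * n = t ^ 2 * η ω / 2 := by simp only [hs, hc]; field_simp
      have e3 : N ω = ∑ j ∈ Finset.range n, Real.exp (-(s ω * (n - (j + 1) : ℕ))) *
          Real.sin (a j ω) * Y ((T : Ω → Ω)^[j] ω) := by
        simp only [hN, Finset.sum_apply, Pi.mul_apply, Function.comp_apply, hV, hY]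
        exact Finset.sum_congr rfl fun j _ => by ring
      have e4 : B ω = c * (K * (2 + ∑ j ∈ Finset.range n, (|Y ((T : Ω → Ω)^[j] ω)| + s ω)) +
          ∑ j ∈ Finset.range n, |e ((T : Ω → Ω)^[j] ω)|) +
          ∑ j ∈ Finset.range n, (taylorError (Y ((T : Ω → Ω)^[j] ω)) + expError (s ω)) := by
        simp only [hB, partialSum, hZ, hsT]
        rw [Finset.sum_add_distrib, ← Finset.mul_sum, Finset.sum_add_distrib, ← Finset.mul_sum]
        ring
      rw [e1, e2] at h1
      rw [e4, Pi.add_apply, e3]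
      exact h1
    · have e5 : a (j + 1) ω - a j ω = Y ((T : Ω → Ω)^[j] ω) := by
        simp only [ha, hY, partialSum, Finset.sum_range_succ]; ring
      have e6 := hsT j ω
      simp only [hs] at e6 ⊢
      simp only [e5, hY, he, Function.iterate_succ_apply']
      have e7 : (t / √n * D ((T : Ω → Ω)^[j] ω)) ^ 2 / 2 = c * D ((T : Ω → Ω)^[j] ω) ^ 2 := by
        rw [mul_pow, div_pow, Real.sq_sqrt hn'.le, hc]; field_simp
      rw [e7, ← e6]
      ring
    · simp only [ha, hY, partialSum, Finset.sum_range_succ]; ring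
  -- Adding the transform `N` makes the difference pointwise small; the conditional expectation of
  -- `N` itself is estimated separately.
  have hdecomp : μ[F | ℱ k] - L =ᵐ[μ] μ[F - L + N | ℱ k] - μ[N | ℱ k] := by
    filter_upwards [condExp_add (hFi.sub hLi) hNi (ℱ k), condExp_sub hFi hLi (ℱ k),
      condExp_of_aestronglyMeasurable' (ℱ.le k) hLm hLi] with ω h1 h2 h3
    simp only [Pi.add_apply, Pi.sub_apply] at h1 h2 ⊢
    rw [h1, h2, h3]; ring
  have hint : ∫ ω, B ω ∂μ = t ^ 2 * K / n + t ^ 2 / 2 * (K * (|t| / √n * ∫ ω, |D ω| ∂μ +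
          t ^ 2 / (2 * n) * ∫ ω, η ω ∂μ) + ∫ ω, |e ω| ∂μ) +
        (n * ∫ ω, taylorError (Y ω) ∂μ + n * ∫ ω, expError (s ω) ∂μ) := by
    have i1 : ∫ ω, B ω ∂μ = 2 * c * K + n * ∫ ω, Z ω ∂μ := by
      rw [hB, integral_add (integrable_const _) (integrable_partialSum hTμ hZi n),
        integral_partialSum hTμ hZi]
      simp
    have i2 : ∫ ω, Z ω ∂μ = c * (K * (∫ ω, |Y ω| ∂μ + ∫ ω, s ω ∂μ) + ∫ ω, |e ω| ∂μ) +
        (∫ ω, taylorError (Y ω) ∂μ + ∫ ω, expError (s ω) ∂μ) := by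
      have j1 : Integrable (fun ω => |Y ω| + s ω) μ := hYi.abs.add hsi
      have j2 : Integrable (fun ω => K * (|Y ω| + s ω) + |e ω|) μ := (j1.const_mul K).add hei.abs
      have j3 : Integrable (fun ω => taylorError (Y ω) + expError (s ω)) μ :=
        (integrable_taylorError hY2).add (integrable_expError hsi hs0)
      rw [hZ, integral_add (j2.const_mul c) j3, integral_const_mul,
        integral_add (j1.const_mul K) hei.abs, integral_const_mul, integral_add hYi.abs hsi,
        integral_add (integrable_taylorError hY2) (integrable_expError hsi hs0)]
    have i3 : ∫ ω, |Y ω| ∂μ = |t| / √n * ∫ ω, |D ω| ∂μ := by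
      simp only [hY, abs_mul, abs_div, abs_of_pos hs']
      rw [integral_const_mul]
    have i4 : ∫ ω, s ω ∂μ = c * ∫ ω, η ω ∂μ := by simp only [hs]; rw [integral_const_mul]
    rw [i1, i2, i3, i4]
    simp only [hc]
    field_simp
    ring
  have hNb : eLpNorm (μ[N | ℱ k]) 1 μ ≤ ENNReal.ofReal (k * (|t| / √n * ∫ ω, |D ω| ∂μ)) := by
    refine (hD.eLpNorm_condExp_sum_le hTμ hℱ hVm hVD n k).trans ?_
    have h1 : ∀ j ∈ Finset.range k, eLpNorm (V j * D ∘ (T : Ω → Ω)^[j]) 1 μ ≤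
        ENNReal.ofReal (|t| / √n * ∫ ω, |D ω| ∂μ) := fun j _ => by
      calc _ ≤ eLpNorm ((|t| / √n) • (D ∘ (T : Ω → Ω)^[j])) 1 μ := by
            refine eLpNorm_mono fun ω => ?_
            simp only [Pi.mul_apply, Pi.smul_apply, smul_eq_mul, norm_mul, Real.norm_eq_abs]
            rw [abs_of_nonneg (by positivity : 0 ≤ |t| / √(n : ℝ))]
            gcongr
            exact hVb j ω
        _ = _ := by
            rw [eLpNorm_const_smul, eLpNorm_comp_iterate hTμ hD1.1,
              eLpNorm_one_eq_ofReal_integral hD1, Real.enorm_of_nonneg (by positivity),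
              ← ENNReal.ofReal_mul (by positivity)]
    refine (Finset.sum_le_sum h1).trans (le_of_eq ?_)
    rw [Finset.sum_const, Finset.card_range, nsmul_eq_mul, ENNReal.ofReal_mul k.cast_nonneg,
      ENNReal.ofReal_natCast]
  rw [← hint, eLpNorm_congr_ae hdecomp]
  refine (eLpNorm_sub_le integrable_condExp.1 integrable_condExp.1 le_rfl).trans
    (add_le_add ?_ hNb)
  exact (eLpNorm_condExp_le_eLpNorm _ le_rfl).trans (eLpNorm_one_le_ofReal_integral hBi hpt)

/-- Conditional central limit theorem for cosines of a stationary martingale. -/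
theorem IsMartingaleDifference.tendsto_condExp_cos (hD : IsMartingaleDifference μ ℱ D)
    (hTμ : MeasurePreserving T μ μ) (hℱ : ∀ k, ℱ (k + 1) = (ℱ k).comap T)
    (hη : IsLimitVariance μ T ℱ D η) (t φ : ℝ) (k : ℕ) :
    Tendsto (fun n : ℕ => eLpNorm
      (μ[fun ω => Real.cos (t * (partialSum T D n ω / √n) + φ) | ℱ k] -
        fun ω => Real.cos φ * Real.exp (-(t ^ 2 * η ω / 2))) 1 μ) atTop (𝓝 0) := by
  have hD1 : Integrable D μ := hD.memLp.integrable one_le_two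
  refine ennreal_tendsto_zero_of_forall_real fun δ hδ => ?_
  obtain ⟨h, K, hhm, hhK, he⟩ := exists_bounded_coboundary hTμ
    ((hD.stronglyMeasurable.mono (ℱ.le 1)).measurable.pow_const 2) hD.memLp.integrable_sq
    (fun ω => sq_nonneg (D ω)) hη.integrable hη.tendsto
    -- The coboundary error enters the limit with factor `t²/2`, so this tolerance leaves less than
    -- `δ`. Here `h` and `K` are fixed before `n` tends to infinity.
    (ε := ENNReal.ofReal (δ / (1 + t ^ 2))) (ENNReal.ofReal_pos.2 (by positivity))
  have hhb : ∀ f : Ω → Ω, Measurable f → Integrable (fun ω => h (f ω)) μ := fun f hf =>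
    Integrable.of_bound (hhm.comp hf).aestronglyMeasurable K (ae_of_all _ fun ω => hhK _)
  have hei : Integrable (fun ω => D ω ^ 2 - η ω - (h ω - h (T ω))) μ :=
    (hD.memLp.integrable_sq.sub hη.integrable).sub ((hhb _ measurable_id).sub (hhb _ T.measurable))
  set I := ∫ ω, |D ω ^ 2 - η ω - (h ω - h (T ω))| ∂μ with hI
  have hIδ : t ^ 2 / 2 * I < δ := by
    have h1 : I < δ / (1 + t ^ 2) := by
      have h2 : (fun ω => D ω ^ 2) - η - (h - h ∘ T) =
          fun ω => D ω ^ 2 - η ω - (h ω - h (T ω)) := rfl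
      rw [h2, eLpNorm_one_eq_ofReal_integral hei] at he
      exact (ENNReal.ofReal_lt_ofReal_iff (by positivity)).1 he
    have h4 : 0 ≤ I := integral_nonneg fun ω => abs_nonneg _
    have h5 : I * (1 + t ^ 2) < δ := (lt_div_iff₀ (by positivity)).1 h1
    nlinarith [sq_nonneg t]
  set x : ℕ → ℝ := fun n => (t ^ 2 * K / n + t ^ 2 / 2 * (K * (|t| / √n * ∫ ω, |D ω| ∂μ +
          t ^ 2 / (2 * n) * ∫ ω, η ω ∂μ) + I) +
        (n * ∫ ω, taylorError (t / √n * D ω) ∂μ + n * ∫ ω, expError (t ^ 2 / (2 * n) * η ω) ∂μ)) +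
      k * (|t| / √n * ∫ ω, |D ω| ∂μ) with hx
  have hsq : Tendsto (fun n : ℕ => |t| / √(n : ℝ)) atTop (𝓝 0) :=
    Tendsto.const_div_atTop (Real.tendsto_sqrt_atTop.comp tendsto_natCast_atTop_atTop) _
  have hlin : Tendsto (fun n : ℕ => t ^ 2 / (2 * (n : ℝ))) atTop (𝓝 0) := by
    have := (tendsto_const_div_atTop_nhds_zero_nat (t ^ 2)).mul_const (1 / 2 : ℝ)
    rw [zero_mul] at this
    refine this.congr fun n => ?_
    rw [div_mul_div_comm, mul_one, mul_comm]
  have hxlim : Tendsto x atTop (𝓝 (t ^ 2 / 2 * I)) := by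
    have h1 := tendsto_const_div_atTop_nhds_zero_nat (t ^ 2 * K)
    have h2 := hsq.mul_const (∫ ω, |D ω| ∂μ)
    have h3 := hlin.mul_const (∫ ω, η ω ∂μ)
    have h4 := (tendsto_integral_taylorError hD.memLp t).add
      (tendsto_integral_expError hη.integrable hη.nonneg t)
    have h5 := ((h1.add ((((h2.add h3).const_mul K).add_const I).const_mul (t ^ 2 / 2))).add h4).add
      (h2.const_mul (k : ℝ))
    have h6 : t ^ 2 / 2 * I = 0 + t ^ 2 / 2 * (K * (0 * ∫ ω, |D ω| ∂μ + 0 * ∫ ω, η ω ∂μ) + I) +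
        (0 + 0) + k * (0 * ∫ ω, |D ω| ∂μ) := by ring
    rw [h6]
    exact h5
  filter_upwards [hxlim.eventually (gt_mem_nhds hIδ), eventually_gt_atTop 0] with n hn hn0
  refine (hD.eLpNorm_condExp_cos_sub_le hTμ hℱ hη hhm hhK t φ k hn0).trans ?_
  have hK : 0 ≤ K := by
    obtain ⟨ω⟩ := nonempty_of_isProbabilityMeasure μ
    exact (abs_nonneg _).trans (hhK ω)
  have hID : 0 ≤ ∫ ω, |D ω| ∂μ := integral_nonneg fun ω => abs_nonneg _
  have hIη : 0 ≤ ∫ ω, η ω ∂μ := integral_nonneg hη.nonneg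
  have hIe : 0 ≤ I := integral_nonneg fun ω => abs_nonneg _
  have hIt : 0 ≤ ∫ ω, taylorError (t / √n * D ω) ∂μ := integral_nonneg fun ω => taylorError_nonneg _
  have hIx : 0 ≤ ∫ ω, expError (t ^ 2 / (2 * n) * η ω) ∂μ :=
    integral_nonneg fun ω => expError_nonneg _
  rw [← ENNReal.ofReal_add (by positivity) (by positivity)]
  exact ENNReal.ofReal_le_ofReal hn.le

end Cosine

/-! ### Gaussian means as functions of the variance. -/

section Gaussian

/-- The integral of `f` against the centred Gaussian distribution with variance `v`. -/
def gaussianMean (f : ℝ → ℝ) (v : ℝ) : ℝ := ∫ x, f (x * √v) ∂(gaussianReal 0 1)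

/-- Continuous functions of at most quadratic growth. -/
structure IsQuadraticallyBounded (f : ℝ → ℝ) : Prop where
  continuous : Continuous f
  bound : ∃ C, 0 ≤ C ∧ ∀ x, |f x| ≤ C * (1 + x ^ 2)

namespace IsQuadraticallyBounded

variable {f g : ℝ → ℝ}

lemma add (hf : IsQuadraticallyBounded f) (hg : IsQuadraticallyBounded g) :
    IsQuadraticallyBounded (fun x => f x + g x) := by
  obtain ⟨C, hC, hfC⟩ := hf.bound
  obtain ⟨C', hC', hgC⟩ := hg.bound
  refine ⟨hf.continuous.add hg.continuous, C + C', add_nonneg hC hC', fun x => ?_⟩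
  rw [add_mul]
  exact (abs_add_le _ _).trans (add_le_add (hfC x) (hgC x))

lemma const_mul (hf : IsQuadraticallyBounded f) (c : ℝ) :
    IsQuadraticallyBounded (fun x => c * f x) := by
  obtain ⟨C, hC, hfC⟩ := hf.bound
  refine ⟨hf.continuous.const_mul c, |c| * C, by positivity, fun x => ?_⟩
  rw [abs_mul, mul_assoc]
  gcongr
  exact hfC x

lemma of_bounded (hf : Continuous f) {C : ℝ} (hC : ∀ x, |f x| ≤ C) : IsQuadraticallyBounded f := by
  have h0 : 0 ≤ C := (abs_nonneg _).trans (hC 0)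
  refine ⟨hf, C, h0, fun x => (hC x).trans ?_⟩
  nlinarith [mul_nonneg h0 (sq_nonneg x)]

lemma sq : IsQuadraticallyBounded (fun x => x ^ 2) := by
  refine ⟨by fun_prop, 1, zero_le_one, fun x => ?_⟩
  rw [abs_of_nonneg (sq_nonneg x)]
  linarith

end IsQuadraticallyBounded

lemma integrable_sq_gaussian : Integrable (fun x : ℝ => x ^ 2) (gaussianReal 0 1) :=
  MemLp.integrable_sq (memLp_id_gaussianReal 2)

lemma integral_sq_gaussian : ∫ x, x ^ 2 ∂(gaussianReal 0 1) = 1 := by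
  have h := variance_fun_id_gaussianReal (μ := 0) (v := 1)
  rw [variance_eq_integral (by fun_prop)] at h
  simpa using h

variable {f g : ℝ → ℝ}

lemma IsQuadraticallyBounded.integrable_gaussian (hf : IsQuadraticallyBounded f) (v : ℝ) :
    Integrable (fun x => f (x * √v)) (gaussianReal 0 1) := by
  obtain ⟨C, hC, hfC⟩ := hf.bound
  have h1 : Integrable (fun x : ℝ => C * (1 + x ^ 2 * √v ^ 2)) (gaussianReal 0 1) :=
    ((integrable_const _).add (integrable_sq_gaussian.mul_const _)).const_mul _
  refine h1.mono' (hf.continuous.comp (by fun_prop)).aestronglyMeasurable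
    (ae_of_all _ fun x => ?_)
  rw [Real.norm_eq_abs, ← mul_pow]
  exact hfC _

lemma gaussianMean_add (hf : IsQuadraticallyBounded f) (hg : IsQuadraticallyBounded g) (v : ℝ) :
    gaussianMean (fun x => f x + g x) v = gaussianMean f v + gaussianMean g v :=
  integral_add (hf.integrable_gaussian v) (hg.integrable_gaussian v)

lemma gaussianMean_const_mul (f : ℝ → ℝ) (c v : ℝ) :
    gaussianMean (fun x => c * f x) v = c * gaussianMean f v :=
  integral_const_mul _ _

lemma gaussianMean_mono (hf : IsQuadraticallyBounded f) (hg : IsQuadraticallyBounded g)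
    (h : ∀ x, f x ≤ g x) (v : ℝ) : gaussianMean f v ≤ gaussianMean g v :=
  integral_mono (hf.integrable_gaussian v) (hg.integrable_gaussian v) fun _ => h _

lemma abs_gaussianMean_le (f : ℝ → ℝ) (v : ℝ) :
    |gaussianMean f v| ≤ gaussianMean (fun x => |f x|) v :=
  abs_integral_le_integral_abs

lemma gaussianMean_const (c v : ℝ) : gaussianMean (fun _ => c) v = c := by
  simp [gaussianMean]

lemma gaussianMean_sq {v : ℝ} (hv : 0 ≤ v) : gaussianMean (fun x => x ^ 2) v = v := by
  simp only [gaussianMean, mul_pow]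
  rw [integral_mul_const, integral_sq_gaussian, Real.sq_sqrt hv, one_mul]

/-- The cosine is the real part of `exp(iφ)` times a character, so the Gaussian characteristic
function at `t√v` gives its mean. -/
lemma gaussianMean_cos (t φ : ℝ) {v : ℝ} (hv : 0 ≤ v) :
    gaussianMean (fun x => Real.cos (t * x + φ)) v = Real.cos φ * Real.exp (-(t ^ 2 * v / 2)) := by
  have h1 := charFun_gaussianReal (μ := 0) (v := 1) (t * √v)
  rw [charFun_apply_real] at h1
  have hint : Integrable (fun x : ℝ => Complex.exp ((t * √v : ℝ) * x * Complex.I))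
      (gaussianReal 0 1) := by
    refine Integrable.of_bound (Continuous.aestronglyMeasurable (by fun_prop)) 1
      (ae_of_all _ fun x => ?_)
    rw [← Complex.ofReal_mul, Complex.norm_exp_ofReal_mul_I]
  have h2 : ∀ x : ℝ, Real.cos (t * (x * √v) + φ) =
      (Complex.exp (φ * Complex.I) * Complex.exp ((t * √v : ℝ) * x * Complex.I)).re := fun x => by
    rw [← Complex.exp_add, ← add_mul, ← Complex.ofReal_mul, ← Complex.ofReal_add,
      Complex.exp_ofReal_mul_I_re]
    congr 1
    ring
  have h3 : gaussianMean (fun x => Real.cos (t * x + φ)) v =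
      (∫ x : ℝ, Complex.exp (φ * Complex.I) * Complex.exp ((t * √v : ℝ) * x * Complex.I)
        ∂(gaussianReal 0 1)).re := by
    simp only [gaussianMean, h2]
    exact integral_re (hint.const_mul _)
  rw [h3, integral_const_mul, h1]
  have h4 : (((t * √v : ℝ) : ℂ) * ((0 : ℝ) : ℂ) * Complex.I -
      ((1 : NNReal) : ℂ) * ((t * √v : ℝ) : ℂ) ^ 2 / 2) = ((-(t ^ 2 * v / 2) : ℝ) : ℂ) := by
    have : (t * √v) ^ 2 = t ^ 2 * v := by rw [mul_pow, Real.sq_sqrt hv]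
    rw [← Complex.ofReal_pow, this]
    push_cast
    ring
  have h5 : Complex.exp (((t * √v : ℝ) : ℂ) * ((0 : ℝ) : ℂ) * Complex.I -
      ((1 : NNReal) : ℂ) * ((t * √v : ℝ) : ℂ) ^ 2 / 2) =
      ((Real.exp (-(t ^ 2 * v / 2)) : ℝ) : ℂ) := by
    rw [h4, Complex.ofReal_exp]
  rw [h5, Complex.re_mul_ofReal, Complex.exp_ofReal_mul_I_re]

lemma measurable_gaussianMean (hf : Continuous f) : Measurable (gaussianMean f) := by
  have h1 : StronglyMeasurable (Function.uncurry fun v x : ℝ => f (x * √v)) := by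
    refine Continuous.stronglyMeasurable ?_
    exact hf.comp (continuous_snd.mul (Real.continuous_sqrt.comp continuous_fst))
  exact (h1.integral_prod_right (ν := gaussianReal 0 1)).measurable

lemma IsQuadraticallyBounded.abs_gaussianMean_le (hf : IsQuadraticallyBounded f) :
    ∃ C, ∀ v, 0 ≤ v → |gaussianMean f v| ≤ C * (1 + v) := by
  obtain ⟨C, hC, hfC⟩ := hf.bound
  refine ⟨C, fun v hv => (StationaryCLT.abs_gaussianMean_le f v).trans ?_⟩
  have h1 : IsQuadraticallyBounded fun x => |f x| :=
    ⟨hf.continuous.abs, C, hC, fun x => by rw [abs_abs]; exact hfC x⟩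
  have h2 : IsQuadraticallyBounded fun _ : ℝ => (1 : ℝ) :=
    .of_bounded continuous_const (C := 1) (by simp)
  refine (gaussianMean_mono h1 ((h2.add .sq).const_mul C) hfC v).trans (le_of_eq ?_)
  rw [gaussianMean_const_mul, gaussianMean_add h2 .sq, gaussianMean_const, gaussianMean_sq hv]

end Gaussian

/-! ### Stability of conditional limits under linear combinations and approximation. -/

section Extension

/-- Conditional convergence of `f (W n)` to its mean under the Gaussian mixture of variance `η`. -/
structure HasConditionalLimit {Ω : Type*} (m : MeasurableSpace Ω) {mΩ : MeasurableSpace Ω}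
    (μ : Measure Ω) (W : ℕ → Ω → ℝ) (η : Ω → ℝ) (f : ℝ → ℝ) : Prop where
  bounded : IsQuadraticallyBounded f
  tendsto : Tendsto (fun n => eLpNorm (μ[fun ω => f (W n ω) | m] - fun ω => gaussianMean f (η ω)) 1 μ)
    atTop (𝓝 0)

set_option linter.unusedSectionVars false

variable {Ω : Type*} {m mΩ : MeasurableSpace Ω} {μ : Measure Ω} [IsProbabilityMeasure μ]
  {W : ℕ → Ω → ℝ} {η : Ω → ℝ} {f g : ℝ → ℝ}

lemma IsQuadraticallyBounded.integrable_comp (hf : IsQuadraticallyBounded f) {X : Ω → ℝ}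
    (hX : MemLp X 2 μ) : Integrable (fun ω => f (X ω)) μ := by
  obtain ⟨C, hC, hfC⟩ := hf.bound
  exact (((integrable_const 1).add hX.integrable_sq).const_mul C).mono'
    (hf.continuous.comp_aestronglyMeasurable hX.1) (ae_of_all _ fun ω => hfC _)

lemma IsQuadraticallyBounded.integrable_gaussianMean (hf : IsQuadraticallyBounded f)
    (hη : Integrable η μ) (hη0 : ∀ ω, 0 ≤ η ω) : Integrable (fun ω => gaussianMean f (η ω)) μ := by
  obtain ⟨C, hfC⟩ := hf.abs_gaussianMean_le
  exact (((integrable_const 1).add hη).const_mul C).mono'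
    ((measurable_gaussianMean hf.continuous).comp_aemeasurable hη.1.aemeasurable).aestronglyMeasurable
    (ae_of_all _ fun ω => hfC _ (hη0 ω))

namespace HasConditionalLimit

lemma add (hW : ∀ n, MemLp (W n) 2 μ) (hη : Integrable η μ) (hη0 : ∀ ω, 0 ≤ η ω)
    (hf : HasConditionalLimit m μ W η f) (hg : HasConditionalLimit m μ W η g) :
    HasConditionalLimit m μ W η (fun x => f x + g x) where
  bounded := hf.bounded.add hg.bounded
  tendsto := by
    have hlim := hf.tendsto.add hg.tendsto
    rw [add_zero] at hlim
    refine tendsto_of_tendsto_of_tendsto_of_le_of_le tendsto_const_nhds hlim (fun _ => zero_le)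
      fun n => ?_
    have e : μ[fun ω => f (W n ω) + g (W n ω) | m] - (fun ω => gaussianMean (fun x => f x + g x) (η ω))
        =ᵐ[μ] (μ[fun ω => f (W n ω) | m] - fun ω => gaussianMean f (η ω)) +
          (μ[fun ω => g (W n ω) | m] - fun ω => gaussianMean g (η ω)) := by
      filter_upwards [condExp_add (hf.bounded.integrable_comp (hW n))
        (hg.bounded.integrable_comp (hW n)) m] with ω h1
      change (μ[fun ω => f (W n ω) + g (W n ω) | m]) ω = _ at h1
      simp only [Pi.sub_apply, Pi.add_apply] at h1 ⊢
      rw [h1, gaussianMean_add hf.bounded hg.bounded]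
      ring
    simp only
    rw [eLpNorm_congr_ae e]
    exact eLpNorm_add_le
      (integrable_condExp.sub (hf.bounded.integrable_gaussianMean hη hη0)).1
      (integrable_condExp.sub (hg.bounded.integrable_gaussianMean hη hη0)).1 le_rfl

lemma const_mul (hf : HasConditionalLimit m μ W η f) (c : ℝ) :
    HasConditionalLimit m μ W η (fun x => c * f x) where
  bounded := hf.bounded.const_mul c
  tendsto := by
    have hlim := ENNReal.Tendsto.const_mul (a := ‖c‖ₑ) hf.tendsto (Or.inr (by simp))
    rw [mul_zero] at hlim
    refine hlim.congr fun n => ?_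
    have e : μ[fun ω => c * f (W n ω) | m] - (fun ω => gaussianMean (fun x => c * f x) (η ω))
        =ᵐ[μ] c • (μ[fun ω => f (W n ω) | m] - fun ω => gaussianMean f (η ω)) := by
      filter_upwards [condExp_smul (μ := μ) c (fun ω => f (W n ω)) m] with ω h1
      change (μ[fun ω => c * f (W n ω) | m]) ω = _ at h1
      simp only [Pi.sub_apply, Pi.smul_apply, smul_eq_mul] at h1 ⊢
      rw [h1, gaussianMean_const_mul]
      ring
    rw [eLpNorm_congr_ae e, eLpNorm_const_smul]

/-- A function that is approximated by functions with conditional limits has one, if the error is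
controlled by functions with small conditional limits. -/
lemma of_approx (hm : m ≤ mΩ) (hW : ∀ n, MemLp (W n) 2 μ) (hη : Integrable η μ)
    (hη0 : ∀ ω, 0 ≤ η ω) (hf : IsQuadraticallyBounded f)
    (happ : ∀ δ : ℝ, 0 < δ → ∃ g h, HasConditionalLimit m μ W η g ∧ HasConditionalLimit m μ W η h ∧
      (∀ x, |f x - g x| ≤ h x) ∧ ∫ ω, gaussianMean h (η ω) ∂μ ≤ δ) :
    HasConditionalLimit m μ W η f := by
  refine ⟨hf, ennreal_tendsto_zero_of_forall_real fun δ hδ => ?_⟩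
  obtain ⟨g, h, hg, hh, hfgh, hδh⟩ := happ (δ / 4) (by positivity)
  have hδ4 : 0 < ENNReal.ofReal (δ / 4) := ENNReal.ofReal_pos.2 (by positivity)
  have hLf := hf.integrable_gaussianMean hη hη0
  have hLg := hg.bounded.integrable_gaussianMean hη hη0
  have hLh := hh.bounded.integrable_gaussianMean hη hη0
  have hd : IsQuadraticallyBounded fun x => f x + (-1) * g x := hf.add (hg.bounded.const_mul (-1))
  have hLd := hd.integrable_gaussianMean hη hη0
  have hdh : ∀ x, |f x + (-1) * g x| ≤ h x := fun x => by
    have : f x + (-1) * g x = f x - g x := by ring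
    rw [this]; exact hfgh x
  filter_upwards [hg.tendsto.eventually (ge_mem_nhds hδ4),
    hh.tendsto.eventually (ge_mem_nhds hδ4)] with n hn1 hn2
  have hfn := hf.integrable_comp (hW n)
  have hgn := hg.bounded.integrable_comp (hW n)
  have hhn := hh.bounded.integrable_comp (hW n)
  have hdn := hd.integrable_comp (hW n)
  have e : μ[fun ω => f (W n ω) | m] - (fun ω => gaussianMean f (η ω)) =ᵐ[μ]
      (μ[fun ω => g (W n ω) | m] - fun ω => gaussianMean g (η ω)) +
        (μ[fun ω => f (W n ω) + (-1) * g (W n ω) | m] -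
          fun ω => gaussianMean (fun x => f x + (-1) * g x) (η ω)) := by
    filter_upwards [condExp_sub hfn hgn m] with ω h1
    have h2 : ((fun ω => f (W n ω)) - fun ω => g (W n ω)) =
        fun ω => f (W n ω) + (-1) * g (W n ω) := by ext ω; simp; ring
    rw [h2] at h1
    simp only [Pi.sub_apply, Pi.add_apply] at h1 ⊢
    rw [h1, gaussianMean_add hf (hg.bounded.const_mul (-1)), gaussianMean_const_mul]
    ring
  have hb1 : eLpNorm (fun ω => gaussianMean (fun x => f x + (-1) * g x) (η ω)) 1 μ ≤
      ENNReal.ofReal (δ / 4) := by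
    refine (eLpNorm_one_le_ofReal_integral hLh fun ω => ?_).trans (ENNReal.ofReal_le_ofReal hδh)
    refine (abs_gaussianMean_le _ _).trans (gaussianMean_mono ?_ hh.bounded hdh _)
    obtain ⟨C, hC, hdC⟩ := hd.bound
    exact ⟨hd.continuous.abs, C, hC, fun x => by rw [abs_abs]; exact hdC x⟩
  -- The error is at most the mean of `h (W n)`, which the conditional limit of `h` compares with
  -- the small integral of `gaussianMean h`. No separate uniform integrability argument is needed.
  have hb2 : eLpNorm (μ[fun ω => f (W n ω) + (-1) * g (W n ω) | m]) 1 μ ≤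
      ENNReal.ofReal (δ / 4) + ENNReal.ofReal (δ / 4) := by
    refine (eLpNorm_condExp_le_eLpNorm _ le_rfl).trans ?_
    refine (eLpNorm_one_le_ofReal_integral hhn fun ω => hdh _).trans ?_
    have hi : Integrable (μ[fun ω => h (W n ω) | m] - fun ω => gaussianMean h (η ω)) μ :=
      integrable_condExp.sub hLh
    have h3 : ∫ ω, h (W n ω) ∂μ ≤ ∫ ω, |(μ[fun ω => h (W n ω) | m] -
        fun ω => gaussianMean h (η ω)) ω| ∂μ + ∫ ω, gaussianMean h (η ω) ∂μ := by
      rw [← integral_condExp hm (f := fun ω => h (W n ω)), ← integral_add hi.abs hLh]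
      refine integral_mono integrable_condExp (hi.abs.add hLh) fun ω => ?_
      have := le_abs_self ((μ[fun ω => h (W n ω) | m] - fun ω => gaussianMean h (η ω)) ω)
      simp only [Pi.sub_apply] at this ⊢
      linarith
    refine (ENNReal.ofReal_le_ofReal h3).trans (ENNReal.ofReal_add_le.trans (add_le_add ?_
      (ENNReal.ofReal_le_ofReal hδh)))
    rw [← eLpNorm_one_eq_ofReal_integral hi]
    exact hn2
  rw [eLpNorm_congr_ae e]
  calc _ ≤ eLpNorm (μ[fun ω => g (W n ω) | m] - fun ω => gaussianMean g (η ω)) 1 μ +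
        eLpNorm (μ[fun ω => f (W n ω) + (-1) * g (W n ω) | m] -
          fun ω => gaussianMean (fun x => f x + (-1) * g x) (η ω)) 1 μ :=
        eLpNorm_add_le (integrable_condExp.sub hLg).1 (integrable_condExp.sub hLd).1 le_rfl
    _ ≤ ENNReal.ofReal (δ / 4) + ((ENNReal.ofReal (δ / 4) + ENNReal.ofReal (δ / 4)) +
        ENNReal.ofReal (δ / 4)) := by
        refine add_le_add hn1 ((eLpNorm_sub_le integrable_condExp.1 hLd.1 le_rfl).trans
          (add_le_add hb2 hb1))
    _ = ENNReal.ofReal δ := by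
        rw [← ENNReal.ofReal_add (by positivity) (by positivity),
          ← ENNReal.ofReal_add (by positivity) (by positivity),
          ← ENNReal.ofReal_add (by positivity) (by positivity)]
        congr 1; ring

lemma of_const (hcos : ∀ t φ : ℝ, HasConditionalLimit m μ W η fun x => Real.cos (t * x + φ))
    (c : ℝ) : HasConditionalLimit m μ W η fun _ => c := by
  simpa using (hcos 0 0).const_mul c

end HasConditionalLimit

end Extension

/-! ### From cosines and squares to all continuous functions of quadratic growth. -/

section Density

set_option linter.unusedSectionVars false

variable {Ω : Type*} {m mΩ : MeasurableSpace Ω} {μ : Measure Ω} [IsProbabilityMeasure μ]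
  {W : ℕ → Ω → ℝ} {η : Ω → ℝ} {f g : ℝ → ℝ}

namespace HasConditionalLimit

lemma of_trigonometric (hW : ∀ n, MemLp (W n) 2 μ) (hη : Integrable η μ) (hη0 : ∀ ω, 0 ≤ η ω)
    (hcos : ∀ t φ : ℝ, HasConditionalLimit m μ W η fun x => Real.cos (t * x + φ)) {L : ℝ}
    [Fact (0 < L)] {p : C(AddCircle L, ℂ)} (hp : p ∈ Submodule.span ℂ (Set.range (@fourier L))) :
    HasConditionalLimit m μ W η (fun x => (p (x : AddCircle L)).re) ∧
      HasConditionalLimit m μ W η (fun x => (p (x : AddCircle L)).im) := by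
  induction hp using Submodule.span_induction with
  | mem p hp =>
    obtain ⟨k, rfl⟩ := hp
    have e : ∀ x : ℝ, fourier k (x : AddCircle L) =
        Complex.exp (((2 * Real.pi * k / L * x : ℝ) : ℂ) * Complex.I) := fun x => by
      rw [fourier_coe_apply]
      congr 1
      push_cast
      ring
    simp only [e, Complex.exp_ofReal_mul_I_re, Complex.exp_ofReal_mul_I_im]
    refine ⟨by simpa using hcos (2 * Real.pi * k / L) 0, ?_⟩
    -- The free phase in the cosine hypothesis yields sines as well.
    have h := hcos (2 * Real.pi * k / L) (-(Real.pi / 2))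
    simpa only [← sub_eq_add_neg, Real.cos_sub_pi_div_two] using h
  | zero => simpa using of_const hcos 0
  | add p q _ _ hp hq =>
    simp only [ContinuousMap.add_apply, Complex.add_re, Complex.add_im]
    exact ⟨add hW hη hη0 hp.1 hq.1, add hW hη hη0 hp.2 hq.2⟩
  | smul c p _ hp =>
    simp only [ContinuousMap.smul_apply, smul_eq_mul, Complex.mul_re, Complex.mul_im]
    refine ⟨?_, add hW hη hη0 (hp.2.const_mul _) (hp.1.const_mul _)⟩
    simpa only [neg_mul, ← sub_eq_add_neg] using
      add hW hη hη0 (hp.1.const_mul c.re) (hp.2.const_mul (-c.im))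

/-- Approximation on a large interval by trigonometric polynomials. -/
lemma exists_trigonometric_approx {f : ℝ → ℝ} (hf : Continuous f) {R K A δ : ℝ} (hA : 0 < A)
    (hRA : R < A) (hfR : ∀ x, R ≤ |x| → f x = 0) (hK : ∀ x, |f x| ≤ K) (hδ : 0 < δ)
    [Fact (0 < 2 * A)] :
    ∃ p ∈ Submodule.span ℂ (Set.range (@fourier (2 * A))),
      ∀ x : ℝ, |f x - (p (x : AddCircle (2 * A))).re| ≤ δ + K / A ^ 2 * x ^ 2 := by
  have hK0 : 0 ≤ K := (abs_nonneg _).trans (hK 0)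
  have hends : (fun x => (f x : ℂ)) (-A) = (fun x => (f x : ℂ)) (-A + 2 * A) := by
    simp only
    rw [hfR (-A) (by rw [abs_neg, abs_of_pos hA]; exact hRA.le),
      hfR (-A + 2 * A) (by rw [abs_of_pos (by linarith)]; linarith)]
  set F : C(AddCircle (2 * A), ℂ) := ⟨AddCircle.liftIco (2 * A) (-A) (fun x => (f x : ℂ)),
    AddCircle.liftIco_continuous hends (Complex.continuous_ofReal.comp hf).continuousOn⟩ with hF
  -- Since `f` vanishes at both ends of `[-A, A]`, it descends to a continuous function on the
  -- circle, where trigonometric polynomials are uniformly dense.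
  have hmem : F ∈ (Submodule.span ℂ (Set.range (@fourier (2 * A)))).topologicalClosure := by
    rw [span_fourier_closure_eq_top]; trivial
  rw [← SetLike.mem_coe, Submodule.topologicalClosure_coe, Metric.mem_closure_iff] at hmem
  obtain ⟨p, hp, hpF⟩ := hmem δ hδ
  refine ⟨p, hp, fun x => ?_⟩
  have h1 : |(F (x : AddCircle (2 * A))).re - (p (x : AddCircle (2 * A))).re| ≤ δ := by
    rw [← Complex.sub_re]
    refine (Complex.abs_re_le_norm _).trans ?_
    rw [← dist_eq_norm]
    exact ((ContinuousMap.dist_apply_le_dist _).trans hpF.le)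
  have hFval : ∀ y ∈ Set.Ico (-A) (-A + 2 * A), F (y : AddCircle (2 * A)) = f y := fun y hy =>
    AddCircle.liftIco_coe_apply (f := fun x => (f x : ℂ)) hy
  rcases lt_or_ge |x| A with hx | hx
  · have hx' := abs_lt.1 hx
    rw [hFval x ⟨by linarith, by linarith⟩, Complex.ofReal_re] at h1
    exact h1.trans (le_add_of_nonneg_right (by positivity))
  -- Beyond `A` the function is zero while its periodic copy is not. That copy is bounded by `K`,
  -- hence by `K x²/A²`.
  · have h2 : |(F (x : AddCircle (2 * A))).re| ≤ K := by
      obtain ⟨y, hy, hyx⟩ : ∃ y ∈ Set.Ico (-A) (-A + 2 * A), (y : AddCircle (2 * A)) = x := by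
        have := (AddCircle.coe_image_Ico_eq (2 * A) (-A)).ge (Set.mem_univ (x : AddCircle (2 * A)))
        exact this
      rw [← hyx, hFval y hy, Complex.ofReal_re]
      exact hK y
    have h3 : K ≤ K / A ^ 2 * x ^ 2 := by
      have h4 : A ^ 2 ≤ x ^ 2 := by rw [← sq_abs x]; gcongr
      rw [div_mul_eq_mul_div, le_div_iff₀ (by positivity)]
      gcongr
    have e : f x - (p (x : AddCircle (2 * A))).re =
        ((F (x : AddCircle (2 * A))).re - (p (x : AddCircle (2 * A))).re) -
          (F (x : AddCircle (2 * A))).re := by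
      rw [hfR x (hRA.le.trans hx)]; ring
    rw [e]
    refine (abs_sub _ _).trans ?_
    linarith

/-- The error of trigonometric approximation is dominated by `δ/2 + (K/A²) x²`. This function has a
conditional limit by the second moment hypothesis, with mean `δ/2 + (K/A²) 𝔼η`, so a large period
suffices. -/
lemma of_eventually_zero (hm : m ≤ mΩ) (hW : ∀ n, MemLp (W n) 2 μ) (hη : Integrable η μ)
    (hη0 : ∀ ω, 0 ≤ η ω)
    (hcos : ∀ t φ : ℝ, HasConditionalLimit m μ W η fun x => Real.cos (t * x + φ))
    (hsq : HasConditionalLimit m μ W η fun x => x ^ 2) {f : ℝ → ℝ} (hf : Continuous f) {R K : ℝ}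
    (hfR : ∀ x, R ≤ |x| → f x = 0) (hK : ∀ x, |f x| ≤ K) : HasConditionalLimit m μ W η f := by
  refine of_approx hm hW hη hη0 (.of_bounded hf hK) fun δ hδ => ?_
  have hI : 0 ≤ ∫ ω, η ω ∂μ := integral_nonneg hη0
  have hlim : Tendsto (fun A : ℝ => K / A ^ 2 * ∫ ω, η ω ∂μ) atTop (𝓝 0) := by
    have h1 : Tendsto (fun A : ℝ => K / A ^ 2) atTop (𝓝 0) :=
      Tendsto.const_div_atTop (tendsto_pow_atTop two_ne_zero) K
    simpa using h1.mul_const (∫ ω, η ω ∂μ)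
  obtain ⟨A, ⟨hA1, hA0⟩, hAR⟩ := ((hlim.eventually (ge_mem_nhds (half_pos hδ))).and
    (eventually_gt_atTop 0)).and (eventually_gt_atTop R) |>.exists
  have : Fact (0 < 2 * A) := ⟨by linarith⟩
  obtain ⟨p, hp, hfp⟩ := exists_trigonometric_approx hf hA0 hAR hfR hK (half_pos hδ)
  refine ⟨_, fun x => δ / 2 + K / A ^ 2 * x ^ 2, (of_trigonometric hW hη hη0 hcos hp).1,
    add hW hη hη0 (of_const hcos _) (hsq.const_mul _), hfp, ?_⟩
  have e : ∀ ω, gaussianMean (fun x => δ / 2 + K / A ^ 2 * x ^ 2) (η ω) =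
      δ / 2 + K / A ^ 2 * η ω := fun ω => by
    rw [gaussianMean_add (.of_bounded continuous_const (C := |δ / 2|) fun _ => le_rfl)
      (IsQuadraticallyBounded.sq.const_mul _), gaussianMean_const, gaussianMean_const_mul,
      gaussianMean_sq (hη0 ω)]
  simp only [e]
  rw [integral_add (integrable_const _) (hη.const_mul _), integral_const_mul]
  simp
  linarith

end HasConditionalLimit

/-- A continuous cutoff, equal to `1` on `[-A, A]` and to `0` outside `[-A - 1, A + 1]`. -/
def cutoff (A x : ℝ) : ℝ := max 0 (min 1 (A + 1 - |x|))

lemma continuous_cutoff (A : ℝ) : Continuous (cutoff A) := by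
  unfold cutoff; fun_prop

lemma cutoff_nonneg (A x : ℝ) : 0 ≤ cutoff A x := le_max_left _ _

lemma cutoff_le_one (A x : ℝ) : cutoff A x ≤ 1 := max_le zero_le_one (min_le_left _ _)

lemma cutoff_eq_one {A x : ℝ} (h : |x| ≤ A) : cutoff A x = 1 := by
  rw [cutoff, min_eq_left (by linarith), max_eq_right zero_le_one]

lemma cutoff_eq_zero {A x : ℝ} (h : A + 1 ≤ |x|) : cutoff A x = 0 := by
  rw [cutoff, max_eq_left ((min_le_right _ _).trans (by linarith))]

/-- The truncation error of the quadratic weight. -/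
def tailWeight (A x : ℝ) : ℝ := (1 + x ^ 2) * (1 - cutoff A x)

lemma tailWeight_nonneg (A x : ℝ) : 0 ≤ tailWeight A x :=
  mul_nonneg (by positivity) (sub_nonneg.2 (cutoff_le_one A x))

lemma tailWeight_le (A x : ℝ) : tailWeight A x ≤ 1 + x ^ 2 :=
  mul_le_of_le_one_right (by positivity) (by linarith [cutoff_nonneg A x])

lemma continuous_tailWeight (A : ℝ) : Continuous (tailWeight A) := by
  have := continuous_cutoff A
  unfold tailWeight; fun_prop

lemma isQuadraticallyBounded_tailWeight (A : ℝ) : IsQuadraticallyBounded (tailWeight A) :=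
  ⟨continuous_tailWeight A, 1, zero_le_one, fun x => by
    rw [abs_of_nonneg (tailWeight_nonneg A x), one_mul]; exact tailWeight_le A x⟩

lemma tendsto_tailWeight (x : ℝ) : Tendsto (fun N : ℕ => tailWeight N x) atTop (𝓝 0) := by
  refine tendsto_const_nhds.congr' ?_
  filter_upwards [eventually_ge_atTop ⌈|x|⌉₊] with N hN
  rw [tailWeight, cutoff_eq_one (Nat.ceil_le.1 hN), sub_self, mul_zero]

lemma isQuadraticallyBounded_weight : IsQuadraticallyBounded fun x => 1 + x ^ 2 :=
  (IsQuadraticallyBounded.of_bounded (f := fun _ => (1 : ℝ)) continuous_const (C := 1)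
    (by simp)).add .sq

lemma gaussianMean_weight {v : ℝ} (hv : 0 ≤ v) : gaussianMean (fun x => 1 + x ^ 2) v = 1 + v := by
  rw [gaussianMean_add (.of_bounded continuous_const (C := 1) (by simp)) .sq, gaussianMean_const,
    gaussianMean_sq hv]

lemma tendsto_gaussianMean_tailWeight (v : ℝ) :
    Tendsto (fun N : ℕ => gaussianMean (tailWeight N) v) atTop (𝓝 0) := by
  have h := tendsto_integral_of_dominated_convergence (μ := gaussianReal 0 1)
    (F := fun (N : ℕ) x => tailWeight N (x * √v)) (f := fun _ => (0 : ℝ))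
    (fun x => 1 + (x * √v) ^ 2)
    (fun N => ((isQuadraticallyBounded_tailWeight N).integrable_gaussian v).1)
    (isQuadraticallyBounded_weight.integrable_gaussian v)
    (fun N => ae_of_all _ fun x => ?_) (ae_of_all _ fun x => tendsto_tailWeight _)
  · simpa [gaussianMean] using h
  · rw [Real.norm_of_nonneg (tailWeight_nonneg _ _)]
    exact tailWeight_le _ _

lemma tendsto_integral_gaussianMean_tailWeight (hη : Integrable η μ) (hη0 : ∀ ω, 0 ≤ η ω) :
    Tendsto (fun N : ℕ => ∫ ω, gaussianMean (tailWeight N) (η ω) ∂μ) atTop (𝓝 0) := by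
  have h := tendsto_integral_of_dominated_convergence (μ := μ)
    (F := fun (N : ℕ) ω => gaussianMean (tailWeight N) (η ω)) (f := fun _ => (0 : ℝ))
    (fun ω => 1 + η ω)
    (fun N => ((isQuadraticallyBounded_tailWeight N).integrable_gaussianMean hη hη0).1)
    ((integrable_const 1).add hη)
    (fun N => ae_of_all _ fun ω => ?_) (ae_of_all _ fun ω => tendsto_gaussianMean_tailWeight _)
  · simpa using h
  · have h0 : 0 ≤ gaussianMean (tailWeight N) (η ω) :=
      integral_nonneg fun x => tailWeight_nonneg _ _
    rw [Real.norm_of_nonneg h0, ← gaussianMean_weight (hη0 ω)]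
    exact gaussianMean_mono (isQuadraticallyBounded_tailWeight N) isQuadraticallyBounded_weight
      (tailWeight_le _) _

/-- Conditional convergence of cosines and of second moments gives conditional convergence of all
continuous functions of at most quadratic growth. -/
theorem HasConditionalLimit.of_isQuadraticallyBounded (hm : m ≤ mΩ) (hW : ∀ n, MemLp (W n) 2 μ)
    (hη : Integrable η μ) (hη0 : ∀ ω, 0 ≤ η ω)
    (hcos : ∀ t φ : ℝ, HasConditionalLimit m μ W η fun x => Real.cos (t * x + φ))
    (hsq : HasConditionalLimit m μ W η fun x => x ^ 2) (hf : IsQuadraticallyBounded f) :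
    HasConditionalLimit m μ W η f := by
  have htrunc : ∀ (N : ℕ) {g : ℝ → ℝ}, IsQuadraticallyBounded g →
      HasConditionalLimit m μ W η fun x => g x * cutoff N x := fun N g hg => by
    obtain ⟨C, hC, hgC⟩ := hg.bound
    refine of_eventually_zero hm hW hη hη0 hcos hsq (hg.continuous.mul (continuous_cutoff N))
      (R := N + 1) (K := C * (1 + (N + 1) ^ 2)) (fun x hx => by rw [cutoff_eq_zero hx, mul_zero])
      fun x => ?_
    rw [abs_mul, abs_of_nonneg (cutoff_nonneg _ _)]
    rcases le_or_gt ((N : ℝ) + 1) |x| with hx | hx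
    · rw [cutoff_eq_zero hx, mul_zero]; positivity
    · refine (mul_le_of_le_one_right (abs_nonneg _) (cutoff_le_one _ _)).trans ((hgC x).trans ?_)
      rw [← sq_abs x]
      gcongr
  have hweight : HasConditionalLimit m μ W η fun x => 1 + x ^ 2 :=
    add hW hη hη0 (of_const hcos 1) hsq
  -- The tail is the full weight minus a compactly supported function; both have limits. Convergence
  -- of second moments thus supplies the tightness required for quadratic growth.
  have htail : ∀ N : ℕ, HasConditionalLimit m μ W η (tailWeight N) := fun N => by
    have h := add hW hη hη0 hweight ((htrunc N isQuadraticallyBounded_weight).const_mul (-1))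
    have e : (fun x => 1 + x ^ 2 + -1 * ((1 + x ^ 2) * cutoff N x)) = tailWeight N := by
      ext x; rw [tailWeight]; ring
    rwa [e] at h
  obtain ⟨C, hC, hfC⟩ := hf.bound
  refine of_approx hm hW hη hη0 hf fun δ hδ => ?_
  have hlim := (tendsto_integral_gaussianMean_tailWeight hη hη0).const_mul C
  rw [mul_zero] at hlim
  obtain ⟨N, hN⟩ := (hlim.eventually (ge_mem_nhds hδ)).exists
  refine ⟨_, _, htrunc N hf, (htail N).const_mul C, fun x => ?_, ?_⟩
  · have e : f x - f x * cutoff N x = f x * (1 - cutoff N x) := by ring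
    rw [e, abs_mul, abs_of_nonneg (sub_nonneg.2 (cutoff_le_one _ _)), tailWeight, ← mul_assoc]
    exact mul_le_mul_of_nonneg_right (hfC x) (sub_nonneg.2 (cutoff_le_one _ _))
  · simp only [gaussianMean_const_mul]
    rwa [integral_const_mul]

end Density

/-! ### Transfer from the martingale to the partial sums. -/

section Conclusion

set_option linter.unusedSectionVars false

variable {Ω : Type*} {mΩ : MeasurableSpace Ω} {μ : Measure Ω} [IsProbabilityMeasure μ]
  {T : Ω ≃ᵐ Ω} {ℱ : Filtration ℕ mΩ} {X D η : Ω → ℝ}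

/-- Conditional expectation contracts `L¹`, so an `L¹`-negligible change of `f (W n)` preserves the
limit. It is applied only to cosines and squares, where the change is easy to bound. -/
lemma HasConditionalLimit.of_tendsto_sub {m : MeasurableSpace Ω} {W W' : ℕ → Ω → ℝ} {f : ℝ → ℝ}
    (hW : ∀ n, MemLp (W n) 2 μ) (hW' : ∀ n, MemLp (W' n) 2 μ) (hη : Integrable η μ)
    (hη0 : ∀ ω, 0 ≤ η ω) (hf : HasConditionalLimit m μ W' η f)
    (hlim : Tendsto (fun n => eLpNorm (fun ω => f (W n ω) - f (W' n ω)) 1 μ) atTop (𝓝 0)) :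
    HasConditionalLimit m μ W η f where
  bounded := hf.bounded
  tendsto := by
    have hsum := hlim.add hf.tendsto
    rw [add_zero] at hsum
    refine tendsto_of_tendsto_of_tendsto_of_le_of_le tendsto_const_nhds hsum (fun _ => zero_le)
      fun n => ?_
    have e : μ[fun ω => f (W n ω) | m] - (fun ω => gaussianMean f (η ω)) =ᵐ[μ]
        μ[fun ω => f (W n ω) - f (W' n ω) | m] +
          (μ[fun ω => f (W' n ω) | m] - fun ω => gaussianMean f (η ω)) := by
      filter_upwards [condExp_sub (hf.bounded.integrable_comp (hW n))
        (hf.bounded.integrable_comp (hW' n)) m] with ω h1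
      change (μ[fun ω => f (W n ω) - f (W' n ω) | m]) ω = _ at h1
      simp only [Pi.sub_apply, Pi.add_apply] at h1 ⊢
      rw [h1]; ring
    simp only
    rw [eLpNorm_congr_ae e]
    refine (eLpNorm_add_le integrable_condExp.1
      (integrable_condExp.sub (hf.bounded.integrable_gaussianMean hη hη0)).1 le_rfl).trans ?_
    gcongr
    exact eLpNorm_condExp_le_eLpNorm _ le_rfl

lemma eLpNorm_two_eq_ofReal_sqrt {Z : Ω → ℝ} (hZ : MemLp Z 2 μ) :
    eLpNorm Z 2 μ = ENNReal.ofReal (√(∫ ω, Z ω ^ 2 ∂μ)) := by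
  rw [← norm_toLp_sq hZ, Real.sqrt_sq (norm_nonneg _), Lp.norm_toLp,
    ENNReal.ofReal_toReal hZ.eLpNorm_ne_top]

lemma tendsto_eLpNorm_cos_sub {W W' : ℕ → Ω → ℝ} (hW : ∀ n, MemLp (W n) 2 μ)
    (hW' : ∀ n, MemLp (W' n) 2 μ)
    (hlim : Tendsto (fun n => eLpNorm (W n - W' n) 2 μ) atTop (𝓝 0)) (t φ : ℝ) :
    Tendsto (fun n => eLpNorm (fun ω => Real.cos (t * W n ω + φ) - Real.cos (t * W' n ω + φ)) 1 μ)
      atTop (𝓝 0) := by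
  have h1 := ENNReal.Tendsto.const_mul (a := ‖t‖ₑ) hlim (Or.inr (by simp))
  rw [mul_zero] at h1
  refine tendsto_of_tendsto_of_tendsto_of_le_of_le tendsto_const_nhds h1 (fun _ => zero_le)
    fun n => ?_
  calc _ ≤ eLpNorm (t • (W n - W' n)) 1 μ := by
        refine eLpNorm_mono fun ω => ?_
        rw [Real.norm_eq_abs, Real.norm_eq_abs]
        refine (Real.abs_cos_sub_cos_le _ _).trans (le_of_eq ?_)
        simp only [Pi.smul_apply, Pi.sub_apply, smul_eq_mul]
        congr 1; ring
    _ = ‖t‖ₑ * eLpNorm (W n - W' n) 1 μ := eLpNorm_const_smul _ _ _ _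
    _ ≤ _ := by
        gcongr
        exact eLpNorm_le_eLpNorm_of_exponent_le one_le_two ((hW n).sub (hW' n)).1

lemma tendsto_eLpNorm_sq_sub {W W' : ℕ → Ω → ℝ} (hW : ∀ n, MemLp (W n) 2 μ)
    (hW' : ∀ n, MemLp (W' n) 2 μ)
    (hlim : Tendsto (fun n => eLpNorm (W n - W' n) 2 μ) atTop (𝓝 0)) {C : ℝ≥0∞} (hC : C ≠ ⊤)
    (hbound : ∀ n, eLpNorm (W' n) 2 μ ≤ C) :
    Tendsto (fun n => eLpNorm (fun ω => W n ω ^ 2 - W' n ω ^ 2) 1 μ) atTop (𝓝 0) := by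
  have h1 : Tendsto (fun n => eLpNorm (W n - W' n) 2 μ *
      (eLpNorm (W n - W' n) 2 μ + (C + C))) atTop (𝓝 0) := by
    have := ENNReal.Tendsto.mul hlim (Or.inr (by simp [hC])) (hlim.add_const (C + C))
      (Or.inr ENNReal.zero_ne_top)
    simpa using this
  refine tendsto_of_tendsto_of_tendsto_of_le_of_le tendsto_const_nhds h1 (fun _ => zero_le)
    fun n => ?_
  have hd := (hW n).sub (hW' n)
  -- This factorisation needs an `L²` bound on `W'` only, and Hölder's inequality applies to the
  -- product.
  have e : (fun ω => W n ω ^ 2 - W' n ω ^ 2) = (W n - W' n) • ((W n - W' n) + (W' n + W' n)) := by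
    ext ω
    simp only [Pi.smul_apply', Pi.sub_apply, Pi.add_apply, smul_eq_mul]
    ring
  simp only
  rw [e]
  refine (eLpNorm_smul_le_mul_eLpNorm (p := 2) (q := 2)
    (hd.1.add ((hW' n).1.add (hW' n).1)) hd.1).trans ?_
  gcongr
  refine (eLpNorm_add_le hd.1 ((hW' n).1.add (hW' n).1) one_le_two).trans ?_
  gcongr
  exact (eLpNorm_add_le (hW' n).1 (hW' n).1 one_le_two).trans (add_le_add (hbound n) (hbound n))

lemma IsMartingaleDifference.integral_sq_partialSum (hD : IsMartingaleDifference μ ℱ D)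
    (hTμ : MeasurePreserving T μ μ) (hℱ : ∀ k, ℱ (k + 1) = (ℱ k).comap T) (n : ℕ) :
    ∫ ω, partialSum T D n ω ^ 2 ∂μ = n * ∫ ω, D ω ^ 2 ∂μ := by
  have h1 : condProj μ ℱ 1 (hD.memLp.toLp D) = hD.memLp.toLp D := by
    rw [condProj_toLp]
    exact MemLp.toLp_congr _ _ (Eq.eventuallyEq (condExp_of_stronglyMeasurable (ℱ.le 1)
      hD.stronglyMeasurable (hD.memLp.integrable one_le_two)))
  have h0 : condProj μ ℱ 0 (hD.memLp.toLp D) = 0 := by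
    rw [condProj_toLp, ← MemLp.toLp_zero (MemLp.zero (ε := ℝ) (p := 2) (μ := μ))]
    exact MemLp.toLp_congr _ _ hD.condExp
  have h := (isShiftSystem hTμ hℱ).norm_sq_orbitSum h1 h0 n
  rwa [orbitSum_toLp, norm_toLp_sq, norm_toLp_sq] at h

/-- The conditional central limit theorem for sequences with a martingale approximation. -/
theorem IsMartingaleDifference.conditionalCLT (hD : IsMartingaleDifference μ ℱ D)
    (hTμ : MeasurePreserving T μ μ) (hℱ : ∀ k, ℱ (k + 1) = (ℱ k).comap T) (hX : MemLp X 2 μ)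
    (happ : MartingaleApprox μ (partialSum T X) (partialSum T D)) :
    ConditionalCLT μ T ℱ (partialSum T X) := by
  obtain ⟨η, hη⟩ := hD.exists_isLimitVariance hTμ hℱ
  set W : ℕ → Ω → ℝ := fun n ω => partialSum T X n ω / √n with hWdef
  set W' : ℕ → Ω → ℝ := fun n ω => partialSum T D n ω / √n with hWdef'
  have hW : ∀ n, MemLp (W n) 2 μ := fun n => by
    simp only [hWdef, div_eq_mul_inv]
    exact (memLp_partialSum hTμ hX n).mul_const _
  have hW' : ∀ n, MemLp (W' n) 2 μ := fun n => by
    simp only [hWdef', div_eq_mul_inv]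
    exact (memLp_partialSum hTμ hD.memLp n).mul_const _
  have hdiff : Tendsto (fun n => eLpNorm (W n - W' n) 2 μ) atTop (𝓝 0) := by
    have h1 := ENNReal.tendsto_ofReal happ.sqrt
    rw [Real.sqrt_zero, ENNReal.ofReal_zero] at h1
    refine h1.congr fun n => ?_
    rw [eLpNorm_two_eq_ofReal_sqrt ((hW n).sub (hW' n)), ← integral_div]
    congr 3
    ext ω
    simp only [hWdef, hWdef', Pi.sub_apply]
    rw [← sub_div, div_pow, Real.sq_sqrt n.cast_nonneg]
  -- Orthogonality of the differences gives equality for `n > 0`; at `n = 0` the left side is zero.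
  have hbound : ∀ n, eLpNorm (W' n) 2 μ ≤ ENNReal.ofReal (√(∫ ω, D ω ^ 2 ∂μ)) := fun n => by
    rw [eLpNorm_two_eq_ofReal_sqrt (hW' n)]
    refine ENNReal.ofReal_le_ofReal (Real.sqrt_le_sqrt ?_)
    simp only [hWdef', div_pow, Real.sq_sqrt n.cast_nonneg]
    rw [integral_div, hD.integral_sq_partialSum hTμ hℱ]
    have h0 : 0 ≤ ∫ ω, D ω ^ 2 ∂μ := integral_nonneg fun ω => sq_nonneg _
    rcases Nat.eq_zero_or_pos n with rfl | hn
    · simpa using h0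
    · rw [mul_div_cancel_left₀ _ (by exact_mod_cast hn.ne')]
  have hsq : ∀ k, HasConditionalLimit (ℱ k) μ W η fun x => x ^ 2 := fun k => by
    refine .of_tendsto_sub hW hW' hη.integrable hη.nonneg ⟨.sq, ?_⟩
      (tendsto_eLpNorm_sq_sub hW hW' hdiff ENNReal.ofReal_ne_top hbound)
    simp only [gaussianMean_sq (hη.nonneg _)]
    exact hD.tendsto_condExp_sq hTμ hℱ hη k
  have hcos : ∀ k t φ, HasConditionalLimit (ℱ k) μ W η fun x => Real.cos (t * x + φ) :=
    fun k t φ => by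
      refine .of_tendsto_sub hW hW' hη.integrable hη.nonneg ⟨.of_bounded (by fun_prop) (C := 1)
        fun x => Real.abs_cos_le_one _, ?_⟩ (tendsto_eLpNorm_cos_sub hW hW' hdiff t φ)
      simp only [gaussianMean_cos t φ (hη.nonneg _)]
      exact hD.tendsto_condExp_cos hTμ hℱ hη t φ k
  refine ⟨η, hη.measurable, hη.nonneg, hη.invariant, hη.integrable, ?_, fun f hf hfC k => ?_⟩
  · refine (hsq 0).tendsto.congr fun n => eLpNorm_congr_ae ?_
    have e : (fun ω => W n ω ^ 2) = (n : ℝ)⁻¹ • fun ω => partialSum T X n ω ^ 2 := by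
      ext ω
      simp only [hWdef, div_pow, Real.sq_sqrt n.cast_nonneg, Pi.smul_apply, smul_eq_mul]
      ring
    rw [e]
    filter_upwards [condExp_smul (μ := μ) (n : ℝ)⁻¹ (fun ω => partialSum T X n ω ^ 2) (ℱ 0)]
      with ω h1
    simp only [Pi.sub_apply, Pi.smul_apply, smul_eq_mul] at h1 ⊢
    rw [h1, gaussianMean_sq (hη.nonneg _)]
    ring
  · obtain ⟨C, hC⟩ := hfC
    have hfb : IsQuadraticallyBounded f := by
      refine ⟨hf, C, ?_, fun x => ?_⟩
      · exact le_trans (by positivity) (hC 0)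
      · exact (div_le_iff₀ (by positivity)).1 (hC x)
    exact (HasConditionalLimit.of_isQuadraticallyBounded (ℱ.le k) hW hη.integrable hη.nonneg
      (hcos k) (hsq k) hfb).tendsto

end Conclusion

end StationaryCLT

end

theorem theorem2 {Ω : Type*} {F₀ mΩ : MeasurableSpace Ω} (μ : Measure Ω) [IsProbabilityMeasure μ]
    (T : Ω ≃ᵐ Ω) (hTμ : MeasurePreserving T μ μ)
    (hF₀ : F₀ ≤ mΩ) (hT : F₀ ≤ F₀.comap T)
    (X₀ : Ω → ℝ) (hX₀ : Measurable[F₀] X₀) (hX₀L2 : MemLp X₀ 2 μ) (hX₀c : ∫ ω, X₀ ω ∂μ = 0) :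
    (Tendsto (fun m : ℕ => StationaryCLT.plusSeminorm μ T
        (StationaryCLT.averagedProjection μ T (StationaryCLT.shiftFiltration T hF₀ hT) X₀ m))
        atTop (𝓝 0) ↔
      ∃ M : ℕ → Ω → ℝ,
        StationaryCLT.IsStationaryMartingale μ T (StationaryCLT.shiftFiltration T hF₀ hT) M ∧
        StationaryCLT.MartingaleApprox μ (StationaryCLT.partialSum T X₀) M) ∧
    (∀ M M' : ℕ → Ω → ℝ,
      StationaryCLT.IsStationaryMartingale μ T (StationaryCLT.shiftFiltration T hF₀ hT) M →
      StationaryCLT.MartingaleApprox μ (StationaryCLT.partialSum T X₀) M →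
      StationaryCLT.IsStationaryMartingale μ T (StationaryCLT.shiftFiltration T hF₀ hT) M' →
      StationaryCLT.MartingaleApprox μ (StationaryCLT.partialSum T X₀) M' →
      ∀ n, M n =ᵐ[μ] M' n) ∧
    (Tendsto (fun m : ℕ => StationaryCLT.plusSeminorm μ T
        (StationaryCLT.averagedProjection μ T (StationaryCLT.shiftFiltration T hF₀ hT) X₀ m))
        atTop (𝓝 0) →
      StationaryCLT.ConditionalCLT μ T (StationaryCLT.shiftFiltration T hF₀ hT)
        (StationaryCLT.partialSum T X₀)) := by
  have hℱ := StationaryCLT.shiftFiltration_succ hF₀ hT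
  have hX₀' : StronglyMeasurable[StationaryCLT.shiftFiltration T hF₀ hT 0] X₀ := by
    rw [StationaryCLT.shiftFiltration_zero hF₀ hT]
    exact hX₀.stronglyMeasurable
  have hiff := StationaryCLT.tendsto_plusSeminorm_iff hTμ hℱ hX₀' hX₀L2
  refine ⟨hiff.trans (StationaryCLT.exists_isMartingaleDifference_iff hTμ hℱ hX₀L2),
    fun M M' hM hMX hM' hMX' n =>
      StationaryCLT.stationaryMartingale_unique hTμ hℱ hX₀L2 hM hMX hM' hMX' n, fun h => ?_⟩
  obtain ⟨D, hD, hDX⟩ := hiff.1 h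
  exact hD.conditionalCLT hTμ hℱ hX₀L2 hDX
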